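/- **Dynamic game forms.** Let $N$ be a finite non-empty set of players, $X$ a set of outcomes, and let player $i$ have a non-empty set $A_i$ of actions. A history is a finite sequence of action profiles, each profile giving an action to every player in some non-empty subset of $N$; $\preceq$ denotes the prefix order and $\prec$ its strict part. A dynamic game form with perfect recall consists of: * a prefix-closed set $\bar H$ of histories of bounded length containing the empty history $\varnothing$. Let $Z$ be the set of its maximal (terminal) elements. At every $h\in\bar H\setminus Z$ there is a non-empty set $\mathbb P(h)\subseteq N$ of active players such that every one-step continuation of $h$ in $\bar H$ is an action profile of exactly the players in $\mathbb P(h)$, and $(h,a)\in\bar H$ for all $a\in\prod_{i\in\mathbb P(h)}A_i(h)$, where $A_i(h)$ is the set of actions of $i$ occurring in continuations of $h$. The initial history is non-terminal and $\mathbb P(\varnothing)=N$. Let $H_i=\{h\in\bar H\setminus Z: i\in\mathbb P(h)\}$; $A_i(h)$ may be a singleton; * for each $i$, a partition $\boldsymbol H_i$ of $H_i$ into information sets such that, for $h,\tilde h$ in the same information set, $A_i(h)=A_i(\tilde h)$, $i$ made the same sequence of decisions along $h$ and $\tilde h$, and for every $\underline h\preceq h$ in $H_i$ some $\underline{\tilde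 h}\preceq\tilde h$ is in the same information set of $i$ as $\underline h$; * an outcome function $\mathcal X:Z\to X$. For information sets (or sets of histories) write $\boldsymbol h\preceq\bar h$ ($\boldsymbol h\prec \bar h$) if $h\preceq\bar h$ ($h\prec\bar h$) for some $h\in\boldsymbol h$, and $\boldsymbol h\preceq\bar{\boldsymbol h}$ ($\boldsymbol h\prec\bar{\boldsymbol h}$) if this holds for some $\bar h\in\bar{\boldsymbol h}$. $A(\boldsymbol h_i)$ is the common value of $A_i(h)$, $h\in\boldsymbol h_i$. **Gradual mechanisms.** Let each agent $i\in N$ have a finite non-empty set $\Theta_i$ of types, $\Theta=\prod_i\Theta_i$, and let $f:\Theta\to X$ be a social choice function. A gradual mechanism (GM) implementing $f$ is a dynamic game form with perfect recall in which $A_i=2^{\Theta_i}\setminus\{\varnothing\}$; for every $h\in H_i$ the sets in $A_i(h)$ are pairwise disjoint with union $\Theta_i(h)$, where $\Theta_i(h)$ is the last action of $i$ along $h$ ($\Theta_i$ if there is none); and $\mathcal X(z)=f(\theta)$ for all $z\in Z$ and $\theta\in\Theta(z)=\prod_i\Theta_i(z)$. For an information set $\boldsymbol h_i$ let $\Theta_{-i}(\boldsymbol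 h_i)=\bigcup_{h\in\boldsymbol h_i}\prod_{j\ne i}\Theta_j(h)$. The direct mechanism of $f$ is the GM in which all agents simultaneously report their exact types (singletons) at the initial history, and then the game ends. **Transformations of a GM $G$ into a GM $G^*$ (both implementing $f$).** * *SPL.* Let $\boldsymbol h_i\in\boldsymbol H_i$, $a_i\in A(\boldsymbol h_i)$, let $\{a_i^1,a_i^2\}$ be a partition of $a_i$ into two non-empty sets, and suppose $\bar{\boldsymbol h}_i=\{z\in Z:\Theta_i(z)=a_i,\ \boldsymbol h_i\prec z\}$ is non-empty. Then $\bar H^*=\bar H\cup\{(z,a_i^k): z\in\bar{\boldsymbol h}_i,\ k=1,2\}$, $\boldsymbol H_j^*=\boldsymbol H_j$ for $j\ne i$, $\boldsymbol H_i^*=\boldsymbol H_i\cup\{\bar{\boldsymbol h}_i\}$, and $\mathcal X^*(z^*)=\mathcal X(m(z^*))$ for a surjection $m:Z^*\to Z$ with $\Theta(z^*)\subseteq\Theta(m(z^*))$. * *COA.* Let $\boldsymbol h_i,\bar{\boldsymbol h}_i\in\boldsymbol H_i$ and $a_i\in A(\boldsymbol h_i)$ be such that $\bar{\boldsymbol h}_i$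 is an immediate successor of $\boldsymbol h_i$ in $\boldsymbol H_i$ consistent with $i$ choosing $a_i$ at $\boldsymbol h_i$, and $\Theta_{-i}(\boldsymbol h_i)=\Theta_{-i}(\bar{\boldsymbol h}_i)$. Then $\bar H^*$ consists of: (1) every $\bar h\in\bar H$ without a prefix $(h,(a_i,a_{-i}))$ with $h\in\boldsymbol h_i$; (2) for every $(h,(a_i,a_{-i}),g)\in\bar H$ with $h\in\boldsymbol h_i$ that is not strictly preceded by an element of $\bar{\boldsymbol h}_i$, and every $\bar a_i\in A(\bar{\boldsymbol h}_i)$, the history $(h,(\bar a_i,a_{-i}),g)$; (3) for every $(h,(a_i,a_{-i}),g,(\bar a_i,\bar a_{-i}),h')\in\bar H$ with $h\in\boldsymbol h_i$ and $(h,(a_i,a_{-i}),g)\in\bar{\boldsymbol h}_i$, the history $(h,(\bar a_i,a_{-i}),g,\bar a_{-i},h')$, where an empty profile $\bar a_{-i}$ is omitted. Let $T(h^*)$ be the history of $G$ that gives rise to $h^*$, the longest one if there are several. Then $\boldsymbol H_j^*$ consists of the non-empty sets among $\{h^*\in H_j^*:T(h^*)\in\boldsymbol h_j\}$, $\boldsymbol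 h_j\in\boldsymbol H_j$, for every $j\in N$, and $\mathcal X^*(z^*)=\mathcal X(T(z^*))$. * *ILL.* Let $\boldsymbol h_i\in\boldsymbol H_i$ be partitioned into two non-empty sets $\boldsymbol h_i^1,\boldsymbol h_i^2$. Then $\bar H^*=\bar H$, $\mathcal X^*=\mathcal X$, $\boldsymbol H_j^*=\boldsymbol H_j$ for $j\neq i$, and $\boldsymbol H_i^*$ arises from $\boldsymbol H_i$ by replacing each $\bar{\boldsymbol h}_i$ with $\boldsymbol h_i\preceq\bar{\boldsymbol h}_i$ by the non-empty ones among $\{\bar h\in\bar{\boldsymbol h}_i:\boldsymbol h_i^k\preceq\bar h\}$, $k=1,2$. An inverse ILL transforms $G^*$ into $G$. **Proposition.** Let $G$ be a GM implementing an SCF $f$ in which an agent whose type has been completely revealed does not move again: if $h\in H_i$ and $h\neq\varnothing$, then $\Theta_i(h)$ has at least two elements. Then $G$ can be transformed into the direct mechanism of $f$ by a finite (possibly empty) chain of SPLs, COAs and inverse ILLs, all intermediate objects being GMs implementing $f$. -/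

import Mathlib

/-! ### Dynamic game forms -/

section GameForms

universe u v w

/-- A possibly empty profile of actions: `a i = none` means that player `i` is not active in `a`. -/
abbrev ActProfile {N : Type u} (A : N → Type v) : Type (max u v) := ∀ i, Option (A i)

/-- Histories are finite sequences of action profiles; precedence is the prefix order `<+:`. -/
abbrev Hist {N : Type u} (A : N → Type v) : Type (max u v) := List (ActProfile A)

variable {N : Type u} {A : N → Type v}

/-- Strict precedence of histories. -/
def Precedes (h k : Hist A) : Prop := h <+: k ∧ h ≠ k

/-- The terminal histories: the maximal elements of a set of histories. -/
def terminals (H : Set (Hist A)) : Set (Hist A) := {z | z ∈ H ∧ ∀ h ∈ H, z <+: h → h = z}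

/-- The decision nodes of player `i`: the histories at which `i` takes part in some successor. -/
def decisionNodes (H : Set (Hist A)) (i : N) : Set (Hist A) :=
  {h | ∃ a : ActProfile A, h ++ [a] ∈ H ∧ a i ≠ none}

/-- The actions available to player `i` at the history `h`. -/
def available (H : Set (Hist A)) (i : N) (h : Hist A) : Set (A i) :=
  {x | ∃ a : ActProfile A, h ++ [a] ∈ H ∧ a i = some x}

/-- The sequence of decisions made by player `i` along the history `h`. -/
def decisions (i : N) (h : Hist A) : List (A i) := h.filterMap (fun a => a i)

/-- `I ≼ h` for a set `I` of histories (an information set) and a history `h`. -/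
def SetLE (I : Set (Hist A)) (h : Hist A) : Prop := ∃ k ∈ I, k <+: h

/-- `I ≺ h` for a set `I` of histories (an information set) and a history `h`. -/
def SetLT (I : Set (Hist A)) (h : Hist A) : Prop := ∃ k ∈ I, Precedes k h

/-- A dynamic game form with perfect recall, with players `N`, actions `A i` and outcomes in `X`,
in which every player is active at the initial history. -/
structure DynamicGameForm (N : Type u) (A : N → Type v) (X : Type w) where
  /-- the set of all (terminal and non-terminal) histories -/
  hist : Set (Hist A)
  nil_mem : [] ∈ hist
  mem_of_append : ∀ (h : Hist A) (a : ActProfile A), h ++ [a] ∈ hist → h ∈ hist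
  bounded : ∃ T : ℕ, ∀ h ∈ hist, h.length ≤ T
  /-- the non-empty valued active-player correspondence -/
  exists_active : ∀ h ∈ hist, h ∉ terminals hist → ∃ P : Set N, P.Nonempty ∧
    ∀ a : ActProfile A, h ++ [a] ∈ hist → ∀ i, a i ≠ none ↔ i ∈ P
  /-- every combination of available actions of the active players leads to a history -/
  product_mem : ∀ h ∈ hist, h ∉ terminals hist → ∀ a : ActProfile A,
    (∀ i, h ∈ decisionNodes hist i → ∃ x ∈ available hist i h, a i = some x) →
    (∀ i, h ∉ decisionNodes hist i → a i = none) → h ++ [a] ∈ hist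
  root_active : ∀ i, [] ∈ decisionNodes hist i
  /-- the information sets of each player, which partition her decision nodes -/
  infoSets : ∀ _ : N, Set (Set (Hist A))
  infoSets_nonempty : ∀ i, ∀ I ∈ infoSets i, I.Nonempty
  infoSets_disjoint : ∀ i, (infoSets i).PairwiseDisjoint id
  infoSets_cover : ∀ i, ⋃₀ infoSets i = decisionNodes hist i
  available_eq : ∀ i, ∀ I ∈ infoSets i, ∀ h ∈ I, ∀ k ∈ I, available hist i h = available hist i k
  perfect_recall : ∀ i, ∀ I ∈ infoSets i, ∀ h ∈ I, ∀ k ∈ I, decisions i h = decisions i k ∧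
    ∀ h' ∈ decisionNodes hist i, h' <+: h → ∃ k', k' <+: k ∧ ∃ J ∈ infoSets i, h' ∈ J ∧ k' ∈ J
  /-- the outcome function, defined on terminal histories only -/
  outcome : terminals hist → X

namespace DynamicGameForm

variable {X : Type w} (G : DynamicGameForm N A X)

/-- The actions available at an information set of player `i`. -/
def availableAt (i : N) (I : Set (Hist A)) : Set (A i) := {x | ∃ h ∈ I, x ∈ available G.hist i h}

/-- `I ≺ J` for two sets of histories. -/
def InfoLT (I J : Set (Hist A)) : Prop := ∃ h ∈ J, SetLT I h

/-- `J` is an immediate successor of `I` among the information sets of player `i`, and it is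
consistent with player `i` choosing `x` at `I`. -/
def IsImmediateSucc (i : N) (I : Set (Hist A)) (x : A i) (J : Set (Hist A)) : Prop :=
  InfoLT I J ∧ (¬ ∃ K ∈ G.infoSets i, InfoLT I K ∧ InfoLT K J) ∧
    ∃ h ∈ I, ∃ a : ActProfile A, a i = some x ∧ ∃ k ∈ J, (h ++ [a]) <+: k

end DynamicGameForm

end GameForms

/-! ### Gradual mechanisms -/

section Gradual

universe u v w

/-- The actions in a gradual mechanism: non-empty sets of types. -/
abbrev Report {N : Type u} (Θ : N → Type v) (i : N) : Type v := {s : Set (Θ i) // s.Nonempty}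

variable {N : Type u} {Θ : N → Type v} {X : Type w}

/-- `Θ_i(h)`: the last action of agent `i` along `h`, or all of `Θ i` if she has not acted. -/
def reported (i : N) (h : Hist (Report Θ)) : Set (Θ i) :=
  ((decisions i h).getLast?).elim Set.univ Subtype.val

/-- `Θ(h)`, the product of the sets `Θ_i(h)`. -/
def reportedProfiles (h : Hist (Report Θ)) : Set (∀ i, Θ i) := {θ | ∀ i, θ i ∈ reported i h}

/-- `Θ_{-i}(I)`, the union over `h ∈ I` of the products of the sets `Θ_j(h)` with `j ≠ i`. -/
def acquired (i : N) (I : Set (Hist (Report Θ))) : Set (∀ j : {j : N // j ≠ i}, Θ j.1) :=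
  {θ | ∃ h ∈ I, ∀ j, θ j ∈ reported j.1 h}

/-- A gradual mechanism implementing the social choice function `f`. -/
structure GradualMechanism (f : (∀ i, Θ i) → X) extends DynamicGameForm N (Report Θ) X where
  actions_disjoint : ∀ i, ∀ h ∈ decisionNodes hist i, ∀ x ∈ available hist i h,
    ∀ y ∈ available hist i h, x ≠ y → Disjoint x.1 y.1
  actions_cover : ∀ i, ∀ h ∈ decisionNodes hist i, ⋃ x ∈ available hist i h, x.1 = reported i h
  outcome_eq : ∀ z : terminals hist, ∀ θ ∈ reportedProfiles z.1, outcome z = f θ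

/-! ### The direct mechanism -/

/-- The action profile in which every agent reports her type. -/
def typeReport (θ : ∀ i, Θ i) : ActProfile (Report Θ) :=
  fun i => some ⟨{θ i}, Set.singleton_nonempty (θ i)⟩

/-- The histories of the direct mechanism. -/
def directHist (Θ : N → Type v) : Set (Hist (Report Θ)) :=
  {h | h = [] ∨ ∃ θ : ∀ i, Θ i, h = [typeReport θ]}

theorem append_mem_directHist {h : Hist (Report Θ)} {a : ActProfile (Report Θ)} :
    h ++ [a] ∈ directHist Θ ↔ h = [] ∧ ∃ θ, a = typeReport θ := by
  constructor
  · rintro (h1 | ⟨θ, h1⟩)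
    · simp at h1
    · cases h with
      | nil => exact ⟨rfl, θ, by simpa using h1⟩
      | cons b t => simp at h1
  · rintro ⟨rfl, θ, rfl⟩
    exact Or.inr ⟨θ, rfl⟩

theorem mem_directHist_nodes [∀ i, Nonempty (Θ i)] {i : N} {h : Hist (Report Θ)} :
    h ∈ decisionNodes (directHist Θ) i ↔ h = [] := by
  constructor
  · rintro ⟨a, ha, -⟩
    exact (append_mem_directHist.1 ha).1
  · rintro rfl
    exact ⟨typeReport fun j => Classical.arbitrary (Θ j),
      append_mem_directHist.2 ⟨rfl, _, rfl⟩, by simp [typeReport]⟩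

theorem mem_directHist_available [∀ i, Nonempty (Θ i)] {i : N} {x : Report Θ i} :
    x ∈ available (directHist Θ) i [] ↔ ∃ t : Θ i, x.1 = {t} := by
  classical
  constructor
  · rintro ⟨a, ha, hx⟩
    obtain ⟨-, θ, rfl⟩ := append_mem_directHist.1 ha
    simp only [typeReport, Option.some.injEq] at hx
    exact ⟨θ i, by rw [← hx]⟩
  · rintro ⟨t, ht⟩
    refine ⟨typeReport (Function.update (fun j => Classical.arbitrary (Θ j)) i t),
      append_mem_directHist.2 ⟨rfl, _, rfl⟩, ?_⟩
    simp only [typeReport, Function.update_self, Option.some.injEq]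
    exact Subtype.ext ht.symm

theorem exists_of_terminal_directHist [Nonempty N] [∀ i, Nonempty (Θ i)]
    (z : terminals (directHist Θ)) : ∃ θ, z.1 = [typeReport θ] := by
  obtain ⟨z, hz | hz, hmax⟩ := z
  · subst hz
    have := hmax [typeReport fun j => Classical.arbitrary (Θ j)] (Or.inr ⟨_, rfl⟩)
      List.nil_prefix
    simp at this
  · exact hz

theorem reported_typeReport {θ : ∀ i, Θ i} {i : N} :
    reported i [typeReport θ] = {θ i} := by
  simp [reported, decisions, typeReport]

/-- The direct mechanism of `f`: all agents simultaneously report their types at the initial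
history, and the outcome is the value of `f` at the reported profile. -/
noncomputable def directMechanism [Nonempty N] [∀ i, Nonempty (Θ i)] (f : (∀ i, Θ i) → X) :
    GradualMechanism f where
  hist := directHist Θ
  nil_mem := Or.inl rfl
  mem_of_append h a ha := Or.inl (append_mem_directHist.1 ha).1
  bounded := by
    refine ⟨1, ?_⟩
    rintro h (rfl | ⟨θ, rfl⟩) <;> simp
  exists_active h hh hz := by
    refine ⟨Set.univ, Set.univ_nonempty, fun a ha i => ?_⟩
    obtain ⟨-, θ, rfl⟩ := append_mem_directHist.1 ha
    simp [typeReport]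
  product_mem h hh hz a ha _ := by
    have hnil : h = [] := by
      rcases hh with hh | ⟨θ, rfl⟩
      · exact hh
      · refine absurd ⟨Or.inr ⟨θ, rfl⟩, ?_⟩ hz
        rintro k (rfl | ⟨θ', rfl⟩) hk
        · simp at hk
        · exact (hk.eq_of_length (by simp)).symm
    subst hnil
    have : ∀ i, ∃ t : Θ i, a i = some ⟨{t}, Set.singleton_nonempty t⟩ := by
      intro i
      obtain ⟨x, hx, hax⟩ := ha i (mem_directHist_nodes.2 rfl)
      obtain ⟨t, ht⟩ := mem_directHist_available.1 hx
      exact ⟨t, by rw [hax]; exact congrArg some (Subtype.ext ht)⟩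
    choose θ hθ using this
    exact append_mem_directHist.2 ⟨rfl, θ, funext hθ⟩
  root_active i := mem_directHist_nodes.2 rfl
  infoSets _ := {{[]}}
  infoSets_nonempty i I hI := by
    rw [Set.mem_singleton_iff.1 hI]; exact Set.singleton_nonempty _
  infoSets_disjoint i := Set.pairwiseDisjoint_singleton _ _
  infoSets_cover i := by
    ext h; simp [mem_directHist_nodes]
  available_eq i I hI h hh k hk := by
    rw [Set.mem_singleton_iff.1 hI] at hh hk
    rw [Set.mem_singleton_iff.1 hh, Set.mem_singleton_iff.1 hk]
  perfect_recall i I hI h hh k hk := by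
    rw [Set.mem_singleton_iff.1 hI] at hh hk
    rw [Set.mem_singleton_iff.1 hh, Set.mem_singleton_iff.1 hk]
    refine ⟨rfl, fun h' hh' hp => ⟨[], List.nil_prefix, {[]}, rfl, ?_, rfl⟩⟩
    exact mem_directHist_nodes.1 hh'
  outcome z := f (exists_of_terminal_directHist z).choose
  actions_disjoint i h hh x hx y hy hxy := by
    rw [mem_directHist_nodes] at hh
    subst hh
    obtain ⟨s, hs⟩ := mem_directHist_available.1 hx
    obtain ⟨t, ht⟩ := mem_directHist_available.1 hy
    rw [hs, ht, Set.disjoint_singleton]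
    rintro rfl
    exact hxy (Subtype.ext (hs.trans ht.symm))
  actions_cover i h hh := by
    rw [mem_directHist_nodes] at hh
    subst hh
    ext t
    simp only [Set.mem_iUnion, reported, decisions, List.filterMap_nil, List.getLast?_nil,
      Option.elim_none, Set.mem_univ, iff_true]
    exact ⟨⟨{t}, Set.singleton_nonempty t⟩, mem_directHist_available.2 ⟨t, rfl⟩, rfl⟩
  outcome_eq z θ hθ := by
    have hz := (exists_of_terminal_directHist z).choose_spec
    congr 1
    funext i
    have h1 := hθ i
    rw [hz, reported_typeReport] at h1
    exact h1.symm

/-! ### The three basic transformations -/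

namespace GradualMechanism

variable {f : (∀ i, Θ i) → X}

/-- Illuminating (ILL): `G'` arises from `G` by dividing an information set `I` of agent `i` into
`I₁` and `I₂`, and the information sets of `i` that succeed `I` accordingly. -/
def Illuminates (G G' : GradualMechanism f) : Prop :=
  ∃ i, ∃ I ∈ G.infoSets i, ∃ I₁ I₂ : Set (Hist (Report Θ)),
    I₁.Nonempty ∧ I₂.Nonempty ∧ Disjoint I₁ I₂ ∧ I₁ ∪ I₂ = I ∧
    G'.hist = G.hist ∧
    (∀ j, j ≠ i → G'.infoSets j = G.infoSets j) ∧
    G'.infoSets i = {K | K ∈ G.infoSets i ∧ ¬ ∃ h ∈ K, SetLE I h} ∪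
      {K' | K'.Nonempty ∧ ∃ K ∈ G.infoSets i, (∃ h ∈ K, SetLE I h) ∧
        (K' = {h | h ∈ K ∧ SetLE I₁ h} ∨ K' = {h | h ∈ K ∧ SetLE I₂ h})} ∧
    ∀ (z : Hist (Report Θ)) (hz : z ∈ terminals G.hist) (hz' : z ∈ terminals G'.hist),
      G'.outcome ⟨z, hz'⟩ = G.outcome ⟨z, hz⟩

variable [DecidableEq N]

/-- The action profile in which only agent `i` is active, choosing `x`. -/
def soloReport (i : N) (x : Report Θ i) : ActProfile (Report Θ) :=
  Function.update (fun _ => none) i (some x)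

/-- The terminal histories that pass through `I` and at which the last action of `i` is `x`. -/
def splitSet (G : GradualMechanism f) (i : N) (I : Set (Hist (Report Θ))) (x : Report Θ i) :
    Set (Hist (Report Θ)) :=
  {z | z ∈ terminals G.hist ∧ reported i z = x.1 ∧ SetLT I z}

/-- Splitting (SPL): `G'` arises from `G` by letting agent `i` choose between the two cells
`x₁`, `x₂` of a partition of `x` at the new information set `G.splitSet i I x`. -/
def Splits (G G' : GradualMechanism f) : Prop :=
  ∃ i, ∃ I ∈ G.infoSets i, ∃ x ∈ G.availableAt i I, ∃ x₁ x₂ : Report Θ i,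
    Disjoint x₁.1 x₂.1 ∧ x₁.1 ∪ x₂.1 = x.1 ∧ (G.splitSet i I x).Nonempty ∧
    G'.hist = G.hist ∪
      {h | ∃ z ∈ G.splitSet i I x, h = z ++ [soloReport i x₁] ∨ h = z ++ [soloReport i x₂]} ∧
    (∀ j, j ≠ i → G'.infoSets j = G.infoSets j) ∧
    G'.infoSets i = G.infoSets i ∪ {G.splitSet i I x} ∧
    ∃ m : terminals G'.hist → terminals G.hist, Function.Surjective m ∧
      ∀ z, reportedProfiles z.1 ⊆ reportedProfiles (m z).1 ∧ G'.outcome z = G.outcome (m z)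

/-- `G.Coalesced i I J x h h'`: the history `h` of `G` gives rise to the history `h'` when the
decision of agent `i` at `J` is moved forward to `I`, replacing her action `x` there. -/
inductive Coalesced (G : GradualMechanism f) (i : N) (I J : Set (Hist (Report Θ)))
    (x : Report Θ i) : Hist (Report Θ) → Hist (Report Θ) → Prop
  /-- `h` does not pass through the choice of `x` at `I` -/
  | outside (h : Hist (Report Θ)) (hh : h ∈ G.hist)
      (hx : ¬ ∃ k ∈ I, ∃ a : ActProfile (Report Θ), a i = some x ∧ (k ++ [a]) <+: h) :
      Coalesced G i I J x h h
  /-- `x` has been chosen at `I`, but `J` has not been left -/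
  | before (k : Hist (Report Θ)) (a : ActProfile (Report Θ)) (g : Hist (Report Θ))
      (hk : k ∈ I) (ha : a i = some x) (hh : k ++ [a] ++ g ∈ G.hist)
      (hJ : ¬ SetLT J (k ++ [a] ++ g)) (y : Report Θ i) (hy : y ∈ G.availableAt i J) :
      Coalesced G i I J x (k ++ [a] ++ g) (k ++ [Function.update a i (some y)] ++ g)
  /-- `y` has been chosen at `J`, together with actions of other agents -/
  | after (k : Hist (Report Θ)) (a : ActProfile (Report Θ)) (g : Hist (Report Θ))
      (b : ActProfile (Report Θ)) (g' : Hist (Report Θ)) (y : Report Θ i)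
      (hk : k ∈ I) (ha : a i = some x) (hJ : k ++ [a] ++ g ∈ J) (hb : b i = some y)
      (hh : k ++ [a] ++ g ++ [b] ++ g' ∈ G.hist) (hothers : ∃ j, j ≠ i ∧ b j ≠ none) :
      Coalesced G i I J x (k ++ [a] ++ g ++ [b] ++ g')
        (k ++ [Function.update a i (some y)] ++ g ++ [Function.update b i none] ++ g')
  /-- `y` has been chosen at `J`, where no other agent was active -/
  | afterAlone (k : Hist (Report Θ)) (a : ActProfile (Report Θ)) (g : Hist (Report Θ))
      (b : ActProfile (Report Θ)) (g' : Hist (Report Θ)) (y : Report Θ i)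
      (hk : k ∈ I) (ha : a i = some x) (hJ : k ++ [a] ++ g ∈ J) (hb : b i = some y)
      (hh : k ++ [a] ++ g ++ [b] ++ g' ∈ G.hist) (hothers : ∀ j, j ≠ i → b j = none) :
      Coalesced G i I J x (k ++ [a] ++ g ++ [b] ++ g')
        (k ++ [Function.update a i (some y)] ++ g ++ g')

/-- `h` is the history of `G` that corresponds to `h'`: the longest history of `G` that gives
rise to `h'`. -/
def IsSource (G : GradualMechanism f) (i : N) (I J : Set (Hist (Report Θ))) (x : Report Θ i)
    (h' h : Hist (Report Θ)) : Prop :=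
  G.Coalesced i I J x h h' ∧ ∀ k, G.Coalesced i I J x k h' → k <+: h

/-- Coalescing (COA): `G'` arises from `G` by moving the actions available at an information set
`J` of agent `i` to the immediately preceding `I`, replacing the action `x` that leads to `J`;
this is possible when `i` acquires no information between `I` and `J`. -/
def Coalesces (G G' : GradualMechanism f) : Prop :=
  ∃ i, ∃ I ∈ G.infoSets i, ∃ J ∈ G.infoSets i, ∃ x ∈ G.availableAt i I,
    G.IsImmediateSucc i I x J ∧ acquired i I = acquired i J ∧
    G'.hist = {h' | ∃ h, G.Coalesced i I J x h h'} ∧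
    (∀ j, G'.infoSets j = {K' | K'.Nonempty ∧ ∃ K ∈ G.infoSets j,
      K' = {h' | h' ∈ decisionNodes G'.hist j ∧ ∃ h ∈ K, G.IsSource i I J x h' h}}) ∧
    ∀ z' : terminals G'.hist, ∃ z : terminals G.hist,
      G.IsSource i I J x z'.1 z.1 ∧ G'.outcome z' = G.outcome z

/-- One step of a chain of SPLs, COAs and inverse ILLs. -/
def Step (G G' : GradualMechanism f) : Prop :=
  G.Splits G' ∨ G.Coalesces G' ∨ G'.Illuminates G

end GradualMechanism

end Gradual

/-! ### Histories, decision counts and perfect recall -/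

section Histories

universe u v w

variable {N : Type u} {A : N → Type v}

/-! The exact types are elicited first, by SPLs; the tree is then contracted by inverse ILLs and
COAs.

Elicitation (`exists_splits`). Suppose some terminal history leaves agent `i` with at least two
possible types. Among all such terminal histories choose one with the most decisions of `i`, and let
`x` be her last action on it, taken at the information set `I`. By maximality, every terminal
history through `I` with final report `x` contains exactly one decision of `i` from `I` onwards,
namely `x`. All these histories look alike to `i`, so letting her split `x` there respects perfect
recall. Each SPL makes the finite set `unseparated` of pairs of type profiles strictly smaller and
preserves `StopsWhenRevealed`; hence `RevealsTypes` holds after finitely many of them.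

Contraction (`exists_step`). Suppose some action is not a singleton. Choose such an action `x`,
available to `i` at `I`, with the largest possible number of earlier decisions of `i`
(`exists_lastCoarse`). After `x` she is offered singletons only. On every complete play she then
moves exactly once more: at least once because her type is revealed in the end, at most once because
she stops when it is revealed. The nodes of this second move all offer precisely the singletons from
`x` and carry the same recollections, so two different information sets there can be merged by an
inverse ILL. Once a single one, `J`, remains, every play choosing `x` at `I` reaches `J`; so `i`
learns nothing in between and COA applies. Both moves lower the number of information sets and
preserve the two invariants. When only singletons can be reported, everybody reports at the root and
nobody moves again: this is the direct mechanism (`eq_directMechanism`).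

The laborious point is that COA yields a gradual mechanism. For a type `t`, `coaMap` rewrites the
histories consistent with `t` entry by entry. Two of them have the same image only if they differ by
an erased profile, one in which `i` acted alone at `J`; choosing the longer one (`Proper`) makes the
correspondence exact. By `append_mem_coaHist` the continuations of an image are the images of
continuations, and every axiom is then checked on the original tree. -/

theorem decisions_append (i : N) (h k : Hist A) :
    decisions i (h ++ k) = decisions i h ++ decisions i k :=
  List.filterMap_append

theorem decisions_singleton (i : N) (a : ActProfile A) : decisions i [a] = (a i).toList := by
  cases h : a i <;> simp [decisions, h]

theorem decisions_length_le_of_prefix {i : N} {h k : Hist A} (hk : h <+: k) :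
    (decisions i h).length ≤ (decisions i k).length := by
  obtain ⟨g, rfl⟩ := hk
  simp [decisions_append]

theorem exists_snoc_prefix {α : Type*} {h k : List α} (hk : h <+: k) (hne : h ≠ k) :
    ∃ a, h ++ [a] <+: k := by
  obtain ⟨g, rfl⟩ := hk
  cases g with
  | nil => simp at hne
  | cons a g => exact ⟨a, g, by simp⟩

theorem not_snoc_prefix_self {α : Type*} (h : List α) (a : α) : ¬ h ++ [a] <+: h := by
  intro hp
  have := hp.length_le
  simp at this

theorem snoc_prefix_unique {α : Type*} {h k : List α} {a b : α} (ha : h ++ [a] <+: k)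
    (hb : h ++ [b] <+: k) : a = b := by
  have := List.prefix_of_prefix_length_le ha hb (by simp)
  simpa using this.eq_of_length (by simp)

theorem mem_decisionNodes_iff {H : Set (Hist A)} {i : N} {h : Hist A} :
    h ∈ decisionNodes H i ↔ (available H i h).Nonempty := by
  constructor
  · rintro ⟨a, ha, hi⟩
    obtain ⟨x, hx⟩ := Option.ne_none_iff_exists'.1 hi
    exact ⟨x, a, ha, hx⟩
  · rintro ⟨x, a, ha, hx⟩
    exact ⟨a, ha, by simp [hx]⟩

/-- By prefix-closedness, any proper extension in `H` would contain a one-step extension in `H`. -/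
theorem mem_terminals_of_forall {H : Set (Hist A)}
    (hH : ∀ (h : Hist A) (a : ActProfile A), h ++ [a] ∈ H → h ∈ H) {z : Hist A} (hz : z ∈ H)
    (hmax : ∀ a, z ++ [a] ∉ H) : z ∈ terminals H := by
  refine ⟨hz, fun h hh hp => ?_⟩
  by_contra hne
  obtain ⟨a, g, rfl⟩ := exists_snoc_prefix hp (Ne.symm hne)
  have : ∀ g : Hist A, z ++ [a] ++ g ∉ H := by
    intro g
    induction g using List.reverseRecOn with
    | nil => simpa using hmax a
    | append_singleton g b ih => intro h; exact ih (hH _ b (by simpa using h))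
  exact this g hh

theorem append_notMem_of_terminal {H : Set (Hist A)} {z : Hist A} (hz : z ∈ terminals H)
    (a : ActProfile A) : z ++ [a] ∉ H := by
  intro h
  have := hz.2 _ h (List.prefix_append _ _)
  simp at this

theorem exists_last_decision {i : N} {h : Hist A} (hd : decisions i h ≠ []) :
    ∃ (k : Hist A) (a : ActProfile A) (g : Hist A) (x : A i),
      h = k ++ [a] ++ g ∧ a i = some x ∧ decisions i g = [] := by
  induction h using List.reverseRecOn with
  | nil => simp [decisions] at hd
  | append_singleton h b ih =>
    cases hb : b i with
    | some x => exact ⟨h, b, [], x, by simp, hb, rfl⟩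
    | none =>
      have h1 : decisions i h ≠ [] := by
        simpa [decisions_append, decisions_singleton, hb] using hd
      obtain ⟨k, a, g, x, rfl, hx, hg⟩ := ih h1
      exact ⟨k, a, g ++ [b], x, by simp, hx, by
        simp [decisions_append, decisions_singleton, hb, hg]⟩

namespace DynamicGameForm

variable {X : Type w} (G : DynamicGameForm N A X)

theorem mem_of_prefix {h k : Hist A} (hk : k ∈ G.hist) (hp : h <+: k) : h ∈ G.hist := by
  obtain ⟨g, rfl⟩ := hp
  induction g using List.reverseRecOn with
  | nil => simpa using hk
  | append_singleton g b ih => exact ih (G.mem_of_append _ b (by simpa using hk))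

theorem mem_of_mem_decisionNodes {i : N} {h : Hist A} (hh : h ∈ decisionNodes G.hist i) :
    h ∈ G.hist := by
  obtain ⟨a, ha, -⟩ := hh
  exact G.mem_of_append _ _ ha

theorem notMem_terminals_of_append {h : Hist A} {a : ActProfile A} (ha : h ++ [a] ∈ G.hist) :
    h ∉ terminals G.hist := fun hz => append_notMem_of_terminal hz a ha

theorem exists_append_of_notMem_terminals {h : Hist A} (hh : h ∈ G.hist)
    (hz : h ∉ terminals G.hist) : ∃ a, h ++ [a] ∈ G.hist := by
  by_contra! hcon
  exact hz (mem_terminals_of_forall G.mem_of_append hh hcon)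

theorem eq_none_of_eq_none {h : Hist A} {a b : ActProfile A} (ha : h ++ [a] ∈ G.hist)
    (hb : h ++ [b] ∈ G.hist) {i : N} (hi : a i = none) : b i = none := by
  obtain ⟨P, -, hP⟩ := G.exists_active h (G.mem_of_append _ _ ha) (G.notMem_terminals_of_append ha)
  by_contra hne
  exact (hP a ha i).2 ((hP b hb i).1 hne) hi

theorem ne_none_of_mem_decisionNodes {h : Hist A} {a : ActProfile A} {i : N}
    (hi : h ∈ decisionNodes G.hist i) (ha : h ++ [a] ∈ G.hist) : a i ≠ none := by
  obtain ⟨b, hb, hbi⟩ := hi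
  exact fun hn => hbi (G.eq_none_of_eq_none ha hb hn)

theorem exists_ne_none {h : Hist A} {a : ActProfile A} (ha : h ++ [a] ∈ G.hist) :
    ∃ i, a i ≠ none := by
  obtain ⟨P, ⟨i, hi⟩, hP⟩ :=
    G.exists_active h (G.mem_of_append _ _ ha) (G.notMem_terminals_of_append ha)
  exact ⟨i, (hP a ha i).2 hi⟩

/-- The profiles that continue a history form a product set. -/
theorem append_mem_of_forall {h : Hist A} {a b : ActProfile A} (ha : h ++ [a] ∈ G.hist)
    (hb : ∀ i, ∃ c : ActProfile A, h ++ [c] ∈ G.hist ∧ c i = b i) : h ++ [b] ∈ G.hist := by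
  refine G.product_mem h (G.mem_of_append _ _ ha) (G.notMem_terminals_of_append ha) b ?_ ?_
  · intro i hi
    obtain ⟨c, hc, hci⟩ := hb i
    obtain ⟨x, hx⟩ := Option.ne_none_iff_exists'.1 (G.ne_none_of_mem_decisionNodes hi hc)
    exact ⟨x, ⟨c, hc, hx⟩, hci ▸ hx⟩
  · intro i hi
    obtain ⟨c, hc, hci⟩ := hb i
    by_contra hne
    exact hi ⟨c, hc, hci ▸ hne⟩

/-- A player active at a node acts in every profile that continues it. The number of her decisions
is thus a clock that advances strictly from each of her nodes; most comparisons of nodes below use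
it. -/
theorem decisions_length_lt {i : N} {h k : Hist A} (hk : k ∈ decisionNodes G.hist i)
    (hh : h ∈ G.hist) (hp : k <+: h) (hne : k ≠ h) :
    (decisions i k).length < (decisions i h).length := by
  obtain ⟨a, ha⟩ := exists_snoc_prefix hp hne
  have h1 := G.ne_none_of_mem_decisionNodes hk (G.mem_of_prefix hh ha)
  obtain ⟨x, hx⟩ := Option.ne_none_iff_exists'.1 h1
  have h2 := decisions_length_le_of_prefix (i := i) ha
  simp [decisions_append, decisions_singleton, hx] at h2
  omega

/-- The two prefixes of `h` are comparable, and anything strictly after the decision node `k` would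
have more decisions than `k`. -/
theorem prefix_of_decisions_length_le {i : N} {h k l : Hist A} (hk : k ∈ decisionNodes G.hist i)
    (hh : h ∈ G.hist) (hkh : k <+: h) (hlh : l <+: h)
    (hle : (decisions i l).length ≤ (decisions i k).length) : l <+: k := by
  rcases List.prefix_or_prefix_of_prefix hlh hkh with h1 | h1
  · exact h1
  · by_cases hne : k = l
    · exact hne ▸ List.prefix_rfl
    · have := G.decisions_length_lt hk (G.mem_of_prefix hh hlh) h1 hne
      omega

theorem mem_decisionNodes_of_mem {i : N} {I : Set (Hist A)} (hI : I ∈ G.infoSets i) {h : Hist A}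
    (hh : h ∈ I) : h ∈ decisionNodes G.hist i := by
  rw [← G.infoSets_cover i]
  exact ⟨I, hI, hh⟩

theorem mem_hist_of_mem {i : N} {I : Set (Hist A)} (hI : I ∈ G.infoSets i) {h : Hist A}
    (hh : h ∈ I) : h ∈ G.hist :=
  G.mem_of_mem_decisionNodes (G.mem_decisionNodes_of_mem hI hh)

theorem exists_infoSet {i : N} {h : Hist A} (hh : h ∈ decisionNodes G.hist i) :
    ∃ I ∈ G.infoSets i, h ∈ I := by
  rw [← G.infoSets_cover i] at hh
  exact hh

theorem infoSet_unique {i : N} {I J : Set (Hist A)} (hI : I ∈ G.infoSets i)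
    (hJ : J ∈ G.infoSets i) {h : Hist A} (h1 : h ∈ I) (h2 : h ∈ J) : I = J := by
  by_contra hne
  exact Set.disjoint_left.1 (G.infoSets_disjoint i hI hJ hne) h1 h2

theorem decisions_eq {i : N} {I : Set (Hist A)} (hI : I ∈ G.infoSets i) {h k : Hist A}
    (hh : h ∈ I) (hk : k ∈ I) : decisions i h = decisions i k :=
  (G.perfect_recall i I hI h hh k hk).1

/-- Perfect recall: an information set that has been visited has been visited at all nodes of
a later one. -/
theorem exists_prefix_mem {i : N} {I J : Set (Hist A)} (hI : I ∈ G.infoSets i)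
    (hJ : J ∈ G.infoSets i) {h k l : Hist A} (hh : h ∈ J) (hk : k ∈ J) (hl : l ∈ I)
    (hlh : l <+: h) : ∃ m ∈ I, m <+: k := by
  obtain ⟨m, hm, K, hK, hlK, hmK⟩ :=
    (G.perfect_recall i J hJ h hh k hk).2 l (G.mem_decisionNodes_of_mem hI hl) hlh
  obtain rfl := G.infoSet_unique hI hK hl hlK
  exact ⟨m, hmK, hm⟩

/-- There is no absent-mindedness: nodes of one information set have equally many decisions, which
is impossible along a proper extension. -/
theorem eq_of_mem_of_prefix {i : N} {I : Set (Hist A)} (hI : I ∈ G.infoSets i) {h k : Hist A}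
    (hh : h ∈ I) (hk : k ∈ I) (hp : h <+: k) : h = k := by
  by_contra hne
  have := G.decisions_length_lt (G.mem_decisionNodes_of_mem hI hh) (G.mem_hist_of_mem hI hk) hp hne
  rw [G.decisions_eq hI hh hk] at this
  omega

theorem availableAt_eq {i : N} {I : Set (Hist A)} (hI : I ∈ G.infoSets i) {h : Hist A}
    (hh : h ∈ I) : G.availableAt i I = available G.hist i h := by
  ext x
  constructor
  · rintro ⟨k, hk, hx⟩
    rwa [G.available_eq i I hI h hh k hk]
  · exact fun hx => ⟨h, hh, hx⟩

theorem append_update_mem [DecidableEq N] {i : N} {h : Hist A} {a : ActProfile A} {x : A i}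
    (ha : h ++ [a] ∈ G.hist) (hx : x ∈ available G.hist i h) :
    h ++ [Function.update a i (some x)] ∈ G.hist := by
  refine G.append_mem_of_forall ha fun j => ?_
  by_cases hj : j = i
  · subst hj
    obtain ⟨c, hc, hcx⟩ := hx
    exact ⟨c, hc, by simp [hcx]⟩
  · exact ⟨a, ha, by simp [hj]⟩

theorem eq_nil_or_decisions_ne_nil {h : Hist A} (hh : h ∈ G.hist) (i : N) :
    h = [] ∨ decisions i h ≠ [] := by
  by_cases h0 : h = []
  · exact Or.inl h0
  · right
    have := G.decisions_length_lt (G.root_active i) hh List.nil_prefix (Ne.symm h0)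
    intro h1
    simp [h1] at this

theorem nil_notMem_terminals [Nonempty N] : [] ∉ terminals G.hist := by
  intro h
  obtain ⟨a, ha, -⟩ := G.root_active (Classical.arbitrary N)
  exact append_notMem_of_terminal h a ha

theorem finite_hist [Finite N] [∀ i, Finite (A i)] : G.hist.Finite := by
  obtain ⟨T, hT⟩ := G.bounded
  exact (List.finite_length_le (ActProfile A) T).subset hT

theorem finite_infoSets [Finite N] [∀ i, Finite (A i)] (i : N) : (G.infoSets i).Finite := by
  refine (G.finite_hist.powerset).subset fun I hI h hh => G.mem_hist_of_mem hI hh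

end DynamicGameForm

end Histories

/-! ### Reported types, and the play induced by a type profile -/

section Mechanisms

universe u v w

variable {N : Type u} {Θ : N → Type v} {X : Type w}

theorem reported_nil (i : N) : reported (Θ := Θ) i [] = Set.univ := by
  simp [reported, decisions]

theorem reported_of_decisions_eq {i : N} {h k : Hist (Report Θ)}
    (hd : decisions i h = decisions i k) : reported i h = reported i k := by
  simp [reported, hd]

theorem reported_append_of_decisions_eq_nil {i : N} {h g : Hist (Report Θ)}
    (hg : decisions i g = []) : reported i (h ++ g) = reported i h :=
  reported_of_decisions_eq (by simp [decisions_append, hg])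

theorem reported_append_none {i : N} {h : Hist (Report Θ)} {a : ActProfile (Report Θ)}
    (ha : a i = none) : reported i (h ++ [a]) = reported i h :=
  reported_append_of_decisions_eq_nil (by simp [decisions_singleton, ha])

theorem reported_append_some {i : N} {h : Hist (Report Θ)} {a : ActProfile (Report Θ)}
    {x : Report Θ i} (ha : a i = some x) : reported i (h ++ [a]) = x.1 := by
  simp [reported, decisions_append, decisions_singleton, ha]

theorem reported_nonempty [∀ i, Nonempty (Θ i)] (i : N) (h : Hist (Report Θ)) :
    (reported i h).Nonempty := by
  unfold reported
  cases (decisions i h).getLast? with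
  | none => simp
  | some x => exact x.2

theorem reportedProfiles_nonempty [∀ i, Nonempty (Θ i)] (h : Hist (Report Θ)) :
    (reportedProfiles h).Nonempty :=
  ⟨fun i => (reported_nonempty i h).some, fun i => (reported_nonempty i h).some_mem⟩

theorem exists_mem_reportedProfiles [∀ i, Nonempty (Θ i)] [DecidableEq N] {h : Hist (Report Θ)}
    {i : N} {t : Θ i} (ht : t ∈ reported i h) : ∃ θ ∈ reportedProfiles h, θ i = t := by
  obtain ⟨θ, hθ⟩ := reportedProfiles_nonempty h
  refine ⟨Function.update θ i t, fun j => ?_, by simp⟩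
  by_cases hj : j = i
  · subst hj; simpa using ht
  · simpa [hj] using hθ j

namespace GradualMechanism

variable {f : (∀ i, Θ i) → X}

/-- A gradual mechanism from a set of histories in which the profiles that continue a history
form a product set; the outcomes are those of the social choice function. -/
noncomputable def ofTree [∀ i, Nonempty (Θ i)] (f : (∀ i, Θ i) → X) (H : Set (Hist (Report Θ)))
    (nil_mem : [] ∈ H)
    (mem_of_append : ∀ (h : Hist (Report Θ)) (a : ActProfile (Report Θ)), h ++ [a] ∈ H → h ∈ H)
    (bounded : ∃ T : ℕ, ∀ h ∈ H, h.length ≤ T)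
    (eq_none : ∀ (h : Hist (Report Θ)) (a b : ActProfile (Report Θ)), h ++ [a] ∈ H →
      h ++ [b] ∈ H → ∀ i, a i = none → b i = none)
    (ne_none : ∀ (h : Hist (Report Θ)) (a : ActProfile (Report Θ)), h ++ [a] ∈ H →
      ∃ i, a i ≠ none)
    (prod_mem : ∀ (h : Hist (Report Θ)) (a b : ActProfile (Report Θ)), h ++ [a] ∈ H →
      (∀ i, ∃ c : ActProfile (Report Θ), h ++ [c] ∈ H ∧ c i = b i) → h ++ [b] ∈ H)
    (root_active : ∀ i, [] ∈ decisionNodes H i)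
    (infoSets : ∀ _ : N, Set (Set (Hist (Report Θ))))
    (infoSets_nonempty : ∀ i, ∀ I ∈ infoSets i, I.Nonempty)
    (infoSets_disjoint : ∀ i, (infoSets i).PairwiseDisjoint id)
    (infoSets_cover : ∀ i, ⋃₀ infoSets i = decisionNodes H i)
    (available_eq : ∀ i, ∀ I ∈ infoSets i, ∀ h ∈ I, ∀ k ∈ I, available H i h = available H i k)
    (perfect_recall : ∀ i, ∀ I ∈ infoSets i, ∀ h ∈ I, ∀ k ∈ I, decisions i h = decisions i k ∧
      ∀ h' ∈ decisionNodes H i, h' <+: h → ∃ k', k' <+: k ∧ ∃ J ∈ infoSets i, h' ∈ J ∧ k' ∈ J)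
    (actions_disjoint : ∀ i, ∀ h ∈ decisionNodes H i, ∀ x ∈ available H i h,
      ∀ y ∈ available H i h, x ≠ y → Disjoint x.1 y.1)
    (actions_cover : ∀ i, ∀ h ∈ decisionNodes H i, ⋃ x ∈ available H i h, x.1 = reported i h)
    (const : ∀ z ∈ terminals H, ∀ θ ∈ reportedProfiles z, ∀ θ' ∈ reportedProfiles z,
      f θ = f θ') : GradualMechanism f where
  hist := H
  nil_mem := nil_mem
  mem_of_append := mem_of_append
  bounded := bounded
  exists_active h hh hz := by
    have h0 : ∃ a, h ++ [a] ∈ H := by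
      by_contra! hcon
      exact hz (mem_terminals_of_forall mem_of_append hh hcon)
    obtain ⟨a, ha⟩ := h0
    refine ⟨{i | a i ≠ none}, ne_none h a ha, fun b hb i => not_congr ?_⟩
    exact ⟨eq_none h b a hb ha i, eq_none h a b ha hb i⟩
  product_mem h hh hz b hb hb' := by
    have h0 : ∃ a, h ++ [a] ∈ H := by
      by_contra! hcon
      exact hz (mem_terminals_of_forall mem_of_append hh hcon)
    obtain ⟨a, ha⟩ := h0
    refine prod_mem h a b ha fun i => ?_
    by_cases hi : h ∈ decisionNodes H i
    · obtain ⟨x, ⟨c, hc, hcx⟩, hbx⟩ := hb i hi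
      exact ⟨c, hc, hcx.trans hbx.symm⟩
    · refine ⟨a, ha, ?_⟩
      rw [hb' i hi]
      by_contra hne
      exact hi ⟨a, ha, hne⟩
  root_active := root_active
  infoSets := infoSets
  infoSets_nonempty := infoSets_nonempty
  infoSets_disjoint := infoSets_disjoint
  infoSets_cover := infoSets_cover
  available_eq := available_eq
  perfect_recall := perfect_recall
  outcome z := f (reportedProfiles_nonempty z.1).some
  actions_disjoint := actions_disjoint
  actions_cover := actions_cover
  outcome_eq z θ hθ := const z.1 z.2 _ (reportedProfiles_nonempty z.1).some_mem θ hθ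

/-- The outcome function carries no further data: each terminal history is consistent with some type
profile, so `f` dictates its outcome. -/
theorem eq_of_hist_of_infoSets [∀ i, Nonempty (Θ i)] {G G' : GradualMechanism f}
    (h1 : G.hist = G'.hist) (h2 : G.infoSets = G'.infoSets) : G = G' := by
  have key : ∀ (z : Hist (Report Θ)) (hz : z ∈ terminals G.hist) (hz' : z ∈ terminals G'.hist),
      G.outcome ⟨z, hz⟩ = G'.outcome ⟨z, hz'⟩ := by
    intro z hz hz'
    obtain ⟨θ, hθ⟩ := reportedProfiles_nonempty z
    rw [G.outcome_eq ⟨z, hz⟩ θ hθ, G'.outcome_eq ⟨z, hz'⟩ θ hθ]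
  obtain ⟨⟨H, a1, a2, a3, a4, a5, a6, S, a7, a8, a9, a10, a11, o⟩, b1, b2, b3⟩ := G
  obtain ⟨⟨H', c1, c2, c3, c4, c5, c6, S', c7, c8, c9, c10, c11, o'⟩, d1, d2, d3⟩ := G'
  dsimp only at h1 h2 key
  subst h1 h2
  have : o = o' := funext fun z => key z.1 z.2 z.2
  subst this
  rfl

variable (G : GradualMechanism f)

theorem const_of_terminal {z : Hist (Report Θ)} (hz : z ∈ terminals G.hist) {θ θ' : ∀ i, Θ i}
    (h : θ ∈ reportedProfiles z) (h' : θ' ∈ reportedProfiles z) : f θ = f θ' := by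
  rw [← G.outcome_eq ⟨z, hz⟩ θ h, ← G.outcome_eq ⟨z, hz⟩ θ' h']

theorem subset_reported {i : N} {h : Hist (Report Θ)} {x : Report Θ i}
    (hx : x ∈ available G.hist i h) : x.1 ⊆ reported i h := by
  rw [← G.actions_cover i h (mem_decisionNodes_iff.2 ⟨x, hx⟩)]
  exact Set.subset_biUnion_of_mem (u := fun y : Report Θ i => y.1) hx

theorem exists_available_mem {i : N} {h : Hist (Report Θ)} (hh : h ∈ decisionNodes G.hist i)
    {t : Θ i} (ht : t ∈ reported i h) : ∃ x ∈ available G.hist i h, t ∈ x.1 := by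
  rw [← G.actions_cover i h hh] at ht
  simpa using ht

theorem available_eq_of_mem {i : N} {h : Hist (Report Θ)} {x y : Report Θ i}
    (hx : x ∈ available G.hist i h) (hy : y ∈ available G.hist i h) {t : Θ i} (h1 : t ∈ x.1)
    (h2 : t ∈ y.1) : x = y := by
  by_contra hne
  exact Set.disjoint_left.1
    (G.actions_disjoint i h (mem_decisionNodes_iff.2 ⟨x, hx⟩) x hx y hy hne) h1 h2

theorem reported_append_subset {i : N} {h : Hist (Report Θ)} {a : ActProfile (Report Θ)}
    (ha : h ++ [a] ∈ G.hist) : reported i (h ++ [a]) ⊆ reported i h := by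
  cases hx : a i with
  | none => rw [reported_append_none hx]
  | some x =>
    rw [reported_append_some hx]
    exact G.subset_reported ⟨a, ha, hx⟩

theorem reported_anti {i : N} {h k : Hist (Report Θ)} (hk : k ∈ G.hist) (hp : h <+: k) :
    reported i k ⊆ reported i h := by
  obtain ⟨g, rfl⟩ := hp
  induction g using List.reverseRecOn with
  | nil => simp
  | append_singleton g b ih =>
    rw [← List.append_assoc] at hk ⊢
    exact (G.reported_append_subset hk).trans (ih (G.mem_of_append _ _ hk))

/-- Histories that are consistent with a common type profile are comparable. -/
theorem prefix_or_prefix {h k : Hist (Report Θ)} (hh : h ∈ G.hist) (hk : k ∈ G.hist)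
    {θ : ∀ i, Θ i} (h1 : θ ∈ reportedProfiles h) (h2 : θ ∈ reportedProfiles k) :
    h <+: k ∨ k <+: h := by
  induction h using List.reverseRecOn with
  | nil => exact Or.inl List.nil_prefix
  | append_singleton p a ih =>
    rcases ih (G.mem_of_append _ _ hh) (fun j => G.reported_append_subset hh (h1 j)) with hp | hp
    · by_cases hne : p = k
      · exact Or.inr (hne ▸ List.prefix_append _ _)
      · obtain ⟨b, hb⟩ := exists_snoc_prefix hp hne
        have hbm := G.mem_of_prefix hk hb
        -- At `p` the profile `θ` leaves no choice: the actions available to an active agent are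
        -- disjoint, so only one of them contains her type.
        have hab : a = b := by
          funext j
          cases ha : a j with
          | none => exact (G.eq_none_of_eq_none hh hbm ha).symm
          | some x =>
            cases hbj : b j with
            | none => rw [G.eq_none_of_eq_none hbm hh hbj] at ha; exact absurd ha (by simp)
            | some y =>
              have e1 := h1 j
              have e2 := G.reported_anti hk hb (h2 j)
              rw [reported_append_some ha] at e1
              rw [reported_append_some hbj] at e2
              rw [G.available_eq_of_mem ⟨a, hh, ha⟩ ⟨b, hbm, hbj⟩ e1 e2]
        exact Or.inl (hab ▸ hb)
    · exact Or.inr (hp.trans (List.prefix_append _ _))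

/-- Every active agent chooses the cell that contains her type. The cells cover what she has
reported so far, and any combination of available actions is a legal continuation. -/
theorem exists_append_mem {h : Hist (Report Θ)} (hh : h ∈ G.hist) (hz : h ∉ terminals G.hist)
    {θ : ∀ i, Θ i} (h1 : θ ∈ reportedProfiles h) :
    ∃ a, h ++ [a] ∈ G.hist ∧ θ ∈ reportedProfiles (h ++ [a]) := by
  have : ∀ j, ∃ o : Option (Report Θ j),
      (h ∈ decisionNodes G.hist j → ∃ x ∈ available G.hist j h, o = some x ∧ θ j ∈ x.1) ∧
      (h ∉ decisionNodes G.hist j → o = none) := by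
    intro j
    by_cases hj : h ∈ decisionNodes G.hist j
    · obtain ⟨x, hx, hxt⟩ := G.exists_available_mem hj (h1 j)
      exact ⟨some x, fun _ => ⟨x, hx, rfl, hxt⟩, fun h => absurd hj h⟩
    · exact ⟨none, fun h => absurd h hj, fun _ => rfl⟩
  choose a ha ha' using this
  refine ⟨a, G.product_mem h hh hz a (fun j hj => ?_) ha', fun j => ?_⟩
  · obtain ⟨x, hx, hax, -⟩ := ha j hj
    exact ⟨x, hx, hax⟩
  · by_cases hj : h ∈ decisionNodes G.hist j
    · obtain ⟨x, hx, hax, ht⟩ := ha j hj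
      rw [reported_append_some hax]
      exact ht
    · rw [reported_append_none (ha' j hj)]
      exact h1 j

theorem exists_terminal {h : Hist (Report Θ)} (hh : h ∈ G.hist) {θ : ∀ i, Θ i}
    (h1 : θ ∈ reportedProfiles h) :
    ∃ z ∈ terminals G.hist, h <+: z ∧ θ ∈ reportedProfiles z := by
  -- Truthful play is continued until it stops; `T - h.length` bounds the number of remaining
  -- rounds.
  obtain ⟨T, hT⟩ := G.bounded
  induction hn : T - h.length using Nat.strong_induction_on generalizing h with
  | _ n ih =>
    by_cases hz : h ∈ terminals G.hist
    · exact ⟨h, hz, List.prefix_rfl, h1⟩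
    · obtain ⟨a, ha, hθ⟩ := G.exists_append_mem hh hz h1
      have hl := hT _ ha
      simp only [List.length_append, List.length_singleton] at hl
      obtain ⟨z, hz, hp, hzθ⟩ := ih (T - (h ++ [a]).length)
        (by simp only [List.length_append, List.length_singleton]; omega) ha hθ rfl
      exact ⟨z, hz, (List.prefix_append _ _).trans hp, hzθ⟩

end GradualMechanism

end Mechanisms

/-! ### Splitting (SPL) -/

section Splitting

universe u v w

variable {N : Type u} {Θ : N → Type v} {X : Type w} {f : (∀ i, Θ i) → X}

namespace GradualMechanism

theorem notMem_of_append_mem {H S : Set (Hist (Report Θ))} (hS : S ⊆ terminals H) {h : Hist (Report Θ)}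
    {a : ActProfile (Report Θ)} (ha : h ++ [a] ∈ H) : h ∉ S :=
  fun hh => append_notMem_of_terminal (hS hh) a ha

variable [DecidableEq N]

theorem soloReport_self (i : N) (x : Report Θ i) : soloReport i x i = some x := by
  simp [soloReport]

theorem soloReport_of_ne {i j : N} (hj : j ≠ i) (x : Report Θ i) : soloReport i x j = none := by
  simp [soloReport, hj]

/-- An agent whose type has been completely revealed does not move again. -/
def StopsWhenRevealed (G : GradualMechanism f) : Prop :=
  ∀ i, ∀ h ∈ decisionNodes G.hist i, h ≠ [] → (reported i h).Nontrivial

/-- The pairs of type profiles that are not told apart by the mechanism. -/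
def unseparated (G : GradualMechanism f) : Set ((∀ i, Θ i) × (∀ i, Θ i)) :=
  {p | ∃ z ∈ terminals G.hist, p.1 ∈ reportedProfiles z ∧ p.2 ∈ reportedProfiles z}

/-- The histories after splitting `x` into `x₁` and `x₂` at the end of the histories in `S`. -/
def splitHist (H S : Set (Hist (Report Θ))) (i : N) (x₁ x₂ : Report Θ i) :
    Set (Hist (Report Θ)) :=
  H ∪ {h | ∃ z ∈ S, h = z ++ [soloReport i x₁] ∨ h = z ++ [soloReport i x₂]}

theorem append_mem_splitHist {H S : Set (Hist (Report Θ))} {i : N} {x₁ x₂ : Report Θ i}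
    {h : Hist (Report Θ)} {a : ActProfile (Report Θ)} :
    h ++ [a] ∈ splitHist H S i x₁ x₂ ↔
      h ++ [a] ∈ H ∨ h ∈ S ∧ (a = soloReport i x₁ ∨ a = soloReport i x₂) := by
  refine or_congr Iff.rfl ?_
  constructor
  · rintro ⟨z, hz, h1 | h1⟩ <;> obtain ⟨rfl, h2⟩ := List.append_inj' h1 rfl <;>
      simp only [List.cons.injEq, and_true] at h2
    · exact ⟨hz, Or.inl h2⟩
    · exact ⟨hz, Or.inr h2⟩
  · rintro ⟨hz, rfl | rfl⟩
    · exact ⟨h, hz, Or.inl rfl⟩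
    · exact ⟨h, hz, Or.inr rfl⟩

section SplitHist

variable {H S : Set (Hist (Report Θ))} {i : N} {x₁ x₂ : Report Θ i}

theorem available_splitHist_of_notMem {j : N} {h : Hist (Report Θ)} (hh : h ∉ S) :
    available (splitHist H S i x₁ x₂) j h = available H j h := by
  ext y
  simp only [available, append_mem_splitHist, hh, false_and, or_false]

theorem available_splitHist_of_mem (hS : S ⊆ terminals H) {h : Hist (Report Θ)} (hh : h ∈ S) :
    available (splitHist H S i x₁ x₂) i h = {x₁, x₂} := by
  ext y
  constructor
  · rintro ⟨a, ha, hy⟩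
    rcases append_mem_splitHist.1 ha with h1 | ⟨-, rfl | rfl⟩
    · exact absurd h1 (append_notMem_of_terminal (hS hh) a)
    · exact Or.inl (by simpa [soloReport_self] using hy.symm)
    · exact Or.inr (by simpa [soloReport_self] using hy.symm)
  · rintro (rfl | rfl)
    · exact ⟨_, append_mem_splitHist.2 (Or.inr ⟨hh, Or.inl rfl⟩), soloReport_self _ _⟩
    · exact ⟨_, append_mem_splitHist.2 (Or.inr ⟨hh, Or.inr rfl⟩), soloReport_self _ _⟩

theorem decisionNodes_splitHist_of_ne {j : N} (hj : j ≠ i) :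
    decisionNodes (splitHist H S i x₁ x₂) j = decisionNodes H j := by
  ext h
  constructor
  · rintro ⟨a, ha, hy⟩
    rcases append_mem_splitHist.1 ha with h1 | ⟨-, rfl | rfl⟩
    · exact ⟨a, h1, hy⟩
    · simp [soloReport_of_ne hj] at hy
    · simp [soloReport_of_ne hj] at hy
  · rintro ⟨a, ha, hy⟩
    exact ⟨a, append_mem_splitHist.2 (Or.inl ha), hy⟩

theorem decisionNodes_splitHist_self :
    decisionNodes (splitHist H S i x₁ x₂) i = decisionNodes H i ∪ S := by
  ext h
  constructor
  · rintro ⟨a, ha, hy⟩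
    rcases append_mem_splitHist.1 ha with h1 | ⟨h1, -⟩
    · exact Or.inl ⟨a, h1, hy⟩
    · exact Or.inr h1
  · rintro (⟨a, ha, hy⟩ | hh)
    · exact ⟨a, append_mem_splitHist.2 (Or.inl ha), hy⟩
    · exact ⟨_, append_mem_splitHist.2 (Or.inr ⟨hh, Or.inl rfl⟩), by simp [soloReport_self]⟩

theorem decisionNodes_splitHist_subset (j : N) :
    decisionNodes (splitHist H S i x₁ x₂) j ⊆ decisionNodes H j ∪ S := by
  by_cases hj : j = i
  · subst hj; exact decisionNodes_splitHist_self.le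
  · rw [decisionNodes_splitHist_of_ne hj]; exact Set.subset_union_left

/-- A terminal history after splitting is an old one, or consists of a split one and a choice
between the two cells. -/
def IsSplitOf (H S : Set (Hist (Report Θ))) (i : N) (x₁ x₂ : Report Θ i)
    (z' z : Hist (Report Θ)) : Prop :=
  z ∈ terminals H ∧ ((z' = z ∧ z ∉ S) ∨
    z ∈ S ∧ (z' = z ++ [soloReport i x₁] ∨ z' = z ++ [soloReport i x₂]))

theorem exists_isSplitOf (hS : S ⊆ terminals H) {z' : Hist (Report Θ)}
    (hz : z' ∈ terminals (splitHist H S i x₁ x₂)) : ∃ z, IsSplitOf H S i x₁ x₂ z' z := by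
  rcases hz.1 with h1 | ⟨z, hzS, h1⟩
  · refine ⟨z', ⟨h1, fun h hh hp => hz.2 h (Or.inl hh) hp⟩, Or.inl ⟨rfl, fun hzS => ?_⟩⟩
    exact append_notMem_of_terminal hz _ (append_mem_splitHist.2 (Or.inr ⟨hzS, Or.inl rfl⟩))
  · exact ⟨z, hS hzS, Or.inr ⟨hzS, h1⟩⟩

theorem IsSplitOf.mem_terminals (hS : S ⊆ terminals H)
    (hH : ∀ (h : Hist (Report Θ)) (a : ActProfile (Report Θ)), h ++ [a] ∈ H → h ∈ H)
    (hH' : ∀ (h : Hist (Report Θ)) (a : ActProfile (Report Θ)),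
      h ++ [a] ∈ splitHist H S i x₁ x₂ → h ∈ splitHist H S i x₁ x₂)
    {z' z : Hist (Report Θ)} (h : IsSplitOf H S i x₁ x₂ z' z) :
    z' ∈ terminals (splitHist H S i x₁ x₂) := by
  obtain ⟨hz, ⟨rfl, hzS⟩ | ⟨hzS, h1⟩⟩ := h
  · refine mem_terminals_of_forall hH' (Or.inl hz.1) fun a ha => ?_
    rcases append_mem_splitHist.1 ha with h1 | ⟨h1, -⟩
    · exact append_notMem_of_terminal hz a h1
    · exact hzS h1
  · have hn : z' ∉ H := by
      rcases h1 with rfl | rfl <;> exact append_notMem_of_terminal hz _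
    refine mem_terminals_of_forall hH' (Or.inr ⟨z, hzS, h1⟩) fun a ha => ?_
    rcases append_mem_splitHist.1 ha with h1 | ⟨h1, -⟩
    · exact hn (hH _ _ h1)
    · exact hn (hS h1).1

/-- A terminal history has no extension by one profile in `H`, so an old history and an appended one
never coincide. The map `m` required by SPL is therefore determined by the relation, which gives its
surjectivity. -/
theorem IsSplitOf.unique {z' z w : Hist (Report Θ)}
    (h : IsSplitOf H S i x₁ x₂ z' z) (h' : IsSplitOf H S i x₁ x₂ z' w) : z = w := by
  obtain ⟨hz, ⟨rfl, hzS⟩ | ⟨hzS, h1⟩⟩ := h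
  · obtain ⟨hw, ⟨rfl, hwS⟩ | ⟨hwS, h2⟩⟩ := h'
    · rfl
    · rcases h2 with rfl | rfl <;> exact absurd hz.1 (append_notMem_of_terminal hw _)
  · obtain ⟨hw, ⟨rfl, hwS⟩ | ⟨hwS, h2⟩⟩ := h'
    · rcases h1 with rfl | rfl <;> exact absurd hw.1 (append_notMem_of_terminal hz _)
    · rcases h1 with rfl | rfl <;> rcases h2 with h2 | h2 <;>
        exact (List.append_inj' h2 rfl).1

theorem reported_append_solo_subset {j : N} {z : Hist (Report Θ)} {y : Report Θ i}
    (hy : y.1 ⊆ reported i z) : reported j (z ++ [soloReport i y]) ⊆ reported j z := by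
  by_cases hj : j = i
  · subst hj; rwa [reported_append_some (soloReport_self _ _)]
  · rw [reported_append_none (soloReport_of_ne hj _)]

theorem IsSplitOf.reportedProfiles_subset {x : Report Θ i} (hu : x₁.1 ∪ x₂.1 = x.1)
    (hrep : ∀ z ∈ S, reported i z = x.1) {z' z : Hist (Report Θ)}
    (h : IsSplitOf H S i x₁ x₂ z' z) : reportedProfiles z' ⊆ reportedProfiles z := by
  obtain ⟨-, ⟨rfl, -⟩ | ⟨hzS, rfl | rfl⟩⟩ := h
  · exact subset_rfl
  · refine fun θ hθ j => reported_append_solo_subset ?_ (hθ j)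
    rw [hrep z hzS, ← hu]; exact Set.subset_union_left
  · refine fun θ hθ j => reported_append_solo_subset ?_ (hθ j)
    rw [hrep z hzS, ← hu]; exact Set.subset_union_right

end SplitHist

section Construction

variable [∀ i, Nonempty (Θ i)] (G : GradualMechanism f) {i : N} {I : Set (Hist (Report Θ))}
  {x x₁ x₂ : Report Θ i}

/-- The mechanism after splitting `x` into `x₁` and `x₂` at the end of the histories through `I`,
when `x` is the last action of `i` along these histories. -/
noncomputable def split (hI : I ∈ G.infoSets i) (hd : Disjoint x₁.1 x₂.1)
    (hu : x₁.1 ∪ x₂.1 = x.1) (hne : (G.splitSet i I x).Nonempty)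
    (hdec : ∀ z ∈ G.splitSet i I x, ∀ k ∈ I, decisions i z = decisions i k ++ [x]) :
    GradualMechanism f :=
  have hS : G.splitSet i I x ⊆ terminals G.hist := fun _ hz => hz.1
  have hpre : ∀ (h : Hist (Report Θ)) (a : ActProfile (Report Θ)),
      h ++ [a] ∈ splitHist G.hist (G.splitSet i I x) i x₁ x₂ →
      h ∈ splitHist G.hist (G.splitSet i I x) i x₁ x₂ := by
    intro h a ha
    rcases append_mem_splitHist.1 ha with h1 | ⟨h1, -⟩
    · exact Or.inl (G.mem_of_append _ _ h1)
    · exact Or.inl (hS h1).1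
  have hold : ∀ j, ∀ h ∈ decisionNodes G.hist j, h ∉ G.splitSet i I x := by
    rintro j h ⟨a, ha, -⟩
    exact notMem_of_append_mem hS ha
  have hnode : ∀ j, ∀ K ∈ G.infoSets j, ∀ h ∈ K, h ∉ G.splitSet i I x :=
    fun j K hK h hh => hold j h (G.mem_decisionNodes_of_mem hK hh)
  ofTree f (splitHist G.hist (G.splitSet i I x) i x₁ x₂) (Or.inl G.nil_mem) hpre
    (by
      obtain ⟨T, hT⟩ := G.bounded
      refine ⟨T + 1, ?_⟩
      rintro h (hh | ⟨z, hz, rfl | rfl⟩)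
      · exact (hT h hh).trans (Nat.le_succ T)
      · simpa using hT z (hS hz).1
      · simpa using hT z (hS hz).1)
    (by
      intro h a b ha hb j hj
      rcases append_mem_splitHist.1 ha with h1 | ⟨h1, h2⟩
      · rcases append_mem_splitHist.1 hb with h3 | ⟨h3, h4⟩
        · exact G.eq_none_of_eq_none h1 h3 hj
        · exact absurd h3 (notMem_of_append_mem hS h1)
      · rcases append_mem_splitHist.1 hb with h3 | ⟨h3, h4⟩
        · exact absurd h1 (notMem_of_append_mem hS h3)
        · have hji : j ≠ i := by
            rintro rfl
            rcases h2 with rfl | rfl <;> simp [soloReport_self] at hj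
          rcases h4 with rfl | rfl <;> exact soloReport_of_ne hji _)
    (by
      intro h a ha
      rcases append_mem_splitHist.1 ha with h1 | ⟨h1, rfl | rfl⟩
      · exact G.exists_ne_none h1
      · exact ⟨i, by simp [soloReport_self]⟩
      · exact ⟨i, by simp [soloReport_self]⟩)
    (by
      intro h a b ha hb
      by_cases hh : h ∈ G.splitSet i I x
      · refine append_mem_splitHist.2 (Or.inr ⟨hh, ?_⟩)
        have hb' : ∀ j, ∃ c : ActProfile (Report Θ),
            (c = soloReport i x₁ ∨ c = soloReport i x₂) ∧ c j = b j := by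
          intro j
          obtain ⟨c, hc, hcj⟩ := hb j
          rcases append_mem_splitHist.1 hc with h1 | ⟨-, h1⟩
          · exact absurd hh (notMem_of_append_mem hS h1)
          · exact ⟨c, h1, hcj⟩
        have hbj : ∀ j, j ≠ i → b j = none := by
          intro j hj
          obtain ⟨c, rfl | rfl, hcj⟩ := hb' j <;> rw [← hcj, soloReport_of_ne hj]
        obtain ⟨c, hc, hci⟩ := hb' i
        have : b = c := by
          funext j
          by_cases hj : j = i
          · subst hj; exact hci.symm
          · rw [hbj j hj]
            rcases hc with rfl | rfl <;> rw [soloReport_of_ne hj]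
        rw [this]; exact hc
      · simp only [append_mem_splitHist, hh, false_and, or_false] at ha hb ⊢
        exact G.append_mem_of_forall ha hb)
    (by
      intro j
      obtain ⟨a, ha, hj⟩ := G.root_active j
      exact ⟨a, append_mem_splitHist.2 (Or.inl ha), hj⟩)
    (fun j => {K | K ∈ G.infoSets j ∨ j = i ∧ K = G.splitSet i I x})
    (by
      rintro j K (hK | ⟨-, rfl⟩)
      · exact G.infoSets_nonempty j K hK
      · exact hne)
    (by
      rintro j K (hK | ⟨rfl, rfl⟩) L (hL | ⟨h1, rfl⟩) hKL
      · exact G.infoSets_disjoint j hK hL hKL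
      · exact Set.disjoint_left.2 fun h hh hS' => hnode j K hK h hh hS'
      · exact Set.disjoint_left.2 fun h hS' hh => hnode j L hL h hh hS'
      · exact absurd rfl hKL)
    (by
      intro j
      by_cases hj : j = i
      · subst hj
        rw [decisionNodes_splitHist_self, ← G.infoSets_cover j]
        ext h
        constructor
        · rintro ⟨K, hK | ⟨-, rfl⟩, hh⟩
          · exact Or.inl ⟨K, hK, hh⟩
          · exact Or.inr hh
        · rintro (⟨K, hK, hh⟩ | hh)
          · exact ⟨K, Or.inl hK, hh⟩
          · exact ⟨_, Or.inr ⟨rfl, rfl⟩, hh⟩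
      · rw [decisionNodes_splitHist_of_ne hj, ← G.infoSets_cover j]
        simp [hj])
    (by
      rintro j K (hK | ⟨rfl, rfl⟩) h hh k hk
      · rw [available_splitHist_of_notMem (hnode j K hK h hh),
          available_splitHist_of_notMem (hnode j K hK k hk)]
        exact G.available_eq j K hK h hh k hk
      · rw [available_splitHist_of_mem hS hh, available_splitHist_of_mem hS hk])
    (by
      rintro j K (hK | ⟨rfl, rfl⟩) h hh k hk
      · refine ⟨G.decisions_eq hK hh hk, fun h' hh' hp => ?_⟩
        rcases decisionNodes_splitHist_subset j hh' with h1 | h1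
        · obtain ⟨k', hk', J, hJ, h2, h3⟩ := (G.perfect_recall j K hK h hh k hk).2 h' h1 hp
          exact ⟨k', hk', J, Or.inl hJ, h2, h3⟩
        · obtain rfl := (hS h1).2 h (G.mem_hist_of_mem hK hh) hp
          exact absurd h1 (hnode j K hK h hh)
      · obtain ⟨p, hpI, hph, hpne⟩ := hh.2.2
        obtain ⟨q, hqI, hqk, hqne⟩ := hk.2.2
        refine ⟨(hdec h hh p hpI).trans (hdec k hk p hpI).symm, fun h' hh' hp => ?_⟩
        rcases decisionNodes_splitHist_subset j hh' with h1 | h1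
        · by_cases hne' : h' = h
          · subst hne'
            exact ⟨k, List.prefix_rfl, _, Or.inr ⟨rfl, rfl⟩, hh, hk⟩
          have hlt := G.decisions_length_lt h1 (hS hh).1 hp hne'
          rw [hdec h hh p hpI, List.length_append, List.length_singleton] at hlt
          -- Along `h` the agent decides exactly once from `p` onwards, so each of her nodes
          -- strictly before `h` lies at or before `p`. Perfect recall at `I` then carries it over
          -- to `q`, and hence to `k`.
          have hp' := G.prefix_of_decisions_length_le (G.mem_decisionNodes_of_mem hI hpI)
            (hS hh).1 hph hp (by omega)
          obtain ⟨k', hk', J, hJ, h2, h3⟩ := (G.perfect_recall j I hI p hpI q hqI).2 h' h1 hp'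
          exact ⟨k', hk'.trans hqk, J, Or.inl hJ, h2, h3⟩
        · obtain rfl := (hS h1).2 h (hS hh).1 hp
          exact ⟨k, List.prefix_rfl, _, Or.inr ⟨rfl, rfl⟩, h1, hk⟩)
    (by
      intro j h hh y hy y' hy' hyy
      by_cases hhS : h ∈ G.splitSet i I x
      · by_cases hj : j = i
        · subst hj
          rw [available_splitHist_of_mem hS hhS] at hy hy'
          rcases hy with rfl | rfl <;> rcases hy' with rfl | rfl
          · exact absurd rfl hyy
          · exact hd
          · exact hd.symm
          · exact absurd rfl hyy
        · rw [decisionNodes_splitHist_of_ne hj] at hh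
          exact absurd hhS (hold j h hh)
      · rw [available_splitHist_of_notMem hhS] at hy hy'
        exact G.actions_disjoint j h (mem_decisionNodes_iff.2 ⟨y, hy⟩) y hy y' hy' hyy)
    (by
      intro j h hh
      by_cases hhS : h ∈ G.splitSet i I x
      · by_cases hj : j = i
        · subst hj
          rw [available_splitHist_of_mem hS hhS, hhS.2.1, ← hu]
          simp
        · rw [decisionNodes_splitHist_of_ne hj] at hh
          exact absurd hhS (hold j h hh)
      · rw [mem_decisionNodes_iff, available_splitHist_of_notMem hhS] at hh
        rw [available_splitHist_of_notMem hhS]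
        exact G.actions_cover j h (mem_decisionNodes_iff.2 hh))
    (by
      intro z' hz' θ hθ θ' hθ'
      obtain ⟨z, hz⟩ := exists_isSplitOf hS hz'
      have hsub := hz.reportedProfiles_subset hu fun z hz => hz.2.1
      exact G.const_of_terminal hz.1 (hsub hθ) (hsub hθ'))

variable (hI : I ∈ G.infoSets i) (hd : Disjoint x₁.1 x₂.1)
  (hu : x₁.1 ∪ x₂.1 = x.1) (hne : (G.splitSet i I x).Nonempty)
  (hdec : ∀ z ∈ G.splitSet i I x, ∀ k ∈ I, decisions i z = decisions i k ++ [x])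

theorem splits_split (hx : x ∈ G.availableAt i I) :
    G.Splits (G.split hI hd hu hne hdec) := by
  set G' := G.split hI hd hu hne hdec
  have hS : G.splitSet i I x ⊆ terminals G.hist := fun _ hz => hz.1
  have hex : ∀ z' : terminals G'.hist, ∃ z : terminals G.hist,
      IsSplitOf G.hist (G.splitSet i I x) i x₁ x₂ z'.1 z.1 := by
    intro z'
    obtain ⟨z, hz⟩ := exists_isSplitOf hS z'.2
    exact ⟨⟨z, hz.1⟩, hz⟩
  choose m hm using hex
  refine ⟨i, I, hI, x, hx, x₁, x₂, hd, hu, hne, rfl, ?_, ?_, m, ?_, ?_⟩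
  · intro j hj
    ext K
    exact or_iff_left fun h => hj h.1
  · ext K
    exact or_congr Iff.rfl (and_iff_right rfl)
  · rintro ⟨z, hz⟩
    have hex : ∃ z', IsSplitOf G.hist (G.splitSet i I x) i x₁ x₂ z' z := by
      by_cases hzS : z ∈ G.splitSet i I x
      · exact ⟨_, hz, Or.inr ⟨hzS, Or.inl rfl⟩⟩
      · exact ⟨z, hz, Or.inl ⟨rfl, hzS⟩⟩
    obtain ⟨z', hz'⟩ := hex
    exact ⟨⟨z', hz'.mem_terminals hS G.mem_of_append G'.mem_of_append⟩,
      Subtype.ext ((hm _).unique hz')⟩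
  · intro z
    have hsub := (hm z).reportedProfiles_subset hu fun z hz => hz.2.1
    refine ⟨hsub, ?_⟩
    -- A profile consistent with the longer history is consistent with the shorter one, so both
    -- outcomes are the value of `f` there.
    obtain ⟨θ, hθ⟩ := reportedProfiles_nonempty z.1
    rw [G'.outcome_eq z θ hθ, G.outcome_eq (m z) θ (hsub hθ)]

/-- At the new nodes the report is the union of two disjoint non-empty cells, so it still has two
elements. -/
theorem stopsWhenRevealed_split (hG : G.StopsWhenRevealed) :
    (G.split hI hd hu hne hdec).StopsWhenRevealed := by
  intro j h hh h0
  by_cases hj : j = i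
  · subst hj
    rcases (decisionNodes_splitHist_subset j) hh with h1 | h1
    · exact hG j h h1 h0
    · rw [h1.2.1, ← hu]
      obtain ⟨s, hs⟩ := x₁.2
      obtain ⟨t, ht⟩ := x₂.2
      refine ⟨s, Or.inl hs, t, Or.inr ht, ?_⟩
      rintro rfl
      exact Set.disjoint_left.1 hd hs ht
  · have : h ∈ decisionNodes (splitHist G.hist (G.splitSet i I x) i x₁ x₂) j := hh
    rw [decisionNodes_splitHist_of_ne hj] at this
    exact hG j h this h0

/-- Terminal histories only become more informative. The inclusion is strict: two profiles
consistent with a split history, with types of `i` in different cells, were not told apart before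
but are now. -/
theorem unseparated_split : (G.split hI hd hu hne hdec).unseparated ⊂ G.unseparated := by
  set G' := G.split hI hd hu hne hdec
  have hS : G.splitSet i I x ⊆ terminals G.hist := fun _ hz => hz.1
  refine ⟨?_, fun hsub => ?_⟩
  · rintro p ⟨z', hz', h1, h2⟩
    obtain ⟨z, hz⟩ := exists_isSplitOf hS hz'
    have hsub := hz.reportedProfiles_subset hu fun z hz => hz.2.1
    exact ⟨z, hz.1, hsub h1, hsub h2⟩
  · obtain ⟨z, hz⟩ := hne
    obtain ⟨s, hs⟩ := x₁.2
    obtain ⟨t, ht⟩ := x₂.2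
    have hsx : s ∈ reported i z := by rw [hz.2.1, ← hu]; exact Or.inl hs
    have htx : t ∈ reported i z := by rw [hz.2.1, ← hu]; exact Or.inr ht
    obtain ⟨θ, hθ, rfl⟩ := exists_mem_reportedProfiles hsx
    obtain ⟨θ', hθ', rfl⟩ := exists_mem_reportedProfiles htx
    obtain ⟨w, hw, h1, h2⟩ := hsub (a := (θ, θ')) ⟨z, hz.1, hθ, hθ'⟩
    have hz' : z ++ [soloReport i x₁] ∈ terminals G'.hist :=
      IsSplitOf.mem_terminals hS G.mem_of_append G'.mem_of_append
        ⟨hz.1, Or.inr ⟨hz, Or.inl rfl⟩⟩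
    have hθz : θ ∈ reportedProfiles (z ++ [soloReport i x₁]) := by
      intro j
      by_cases hj : j = i
      · subst hj; rwa [reported_append_some (soloReport_self _ _)]
      · rw [reported_append_none (soloReport_of_ne hj _)]; exact hθ j
    -- Terminal histories consistent with the same profile `θ` are comparable, hence equal.
    have hwz : w = z ++ [soloReport i x₁] := by
      rcases G'.prefix_or_prefix hw.1 hz'.1 h1 hθz with hp | hp
      · exact (hw.2 _ hz'.1 hp).symm
      · exact hz'.2 _ hw.1 hp
    subst hwz
    have := h2 i
    rw [reported_append_some (soloReport_self _ _)] at this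
    exact Set.disjoint_left.1 hd this ht

/-- If the mechanism does not elicit the exact types, some action can be split. -/
theorem exists_splits [Finite N] [∀ i, Finite (Θ i)] (hG : G.StopsWhenRevealed)
    {z : Hist (Report Θ)} (hz : z ∈ terminals G.hist) (hzi : (reported i z).Nontrivial) :
    ∃ G' : GradualMechanism f, G.Splits G' ∧ G'.StopsWhenRevealed ∧
      G'.unseparated ⊂ G.unseparated := by
  have : Nonempty N := ⟨i⟩
  -- Maximality of the decision count makes `hdec` true below: without it, some terminal history in
  -- the split set might contain further decisions of `i` after `I`.
  obtain ⟨z, ⟨hz, hzi⟩, hmax⟩ := Set.exists_max_image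
    {z | z ∈ terminals G.hist ∧ (reported i z).Nontrivial} (fun z => (decisions i z).length)
    (G.finite_hist.subset fun z hz => hz.1.1) ⟨z, hz, hzi⟩
  have hz0 : decisions i z ≠ [] := (G.eq_nil_or_decisions_ne_nil hz.1 i).resolve_left
    (by rintro rfl; exact G.nil_notMem_terminals hz)
  obtain ⟨k, a, g, x, rfl, hx, hg⟩ := exists_last_decision hz0
  have hka : k ++ [a] ∈ G.hist := G.mem_of_prefix hz.1 (List.prefix_append _ _)
  obtain ⟨I, hI, hkI⟩ := G.exists_infoSet (i := i) ⟨a, hka, by simp [hx]⟩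
  have hrep : reported i (k ++ [a] ++ g) = x.1 := by
    rw [reported_append_of_decisions_eq_nil hg, reported_append_some hx]
  have hlen : (decisions i (k ++ [a] ++ g)).length = (decisions i k).length + 1 := by
    rw [decisions_append, decisions_append, hg, decisions_singleton, hx]
    simp
  rw [hrep] at hzi
  have hne : (G.splitSet i I x).Nonempty :=
    ⟨_, hz, hrep, k, hkI, ⟨[a] ++ g, by simp⟩, by simp⟩
  have hdec : ∀ z ∈ G.splitSet i I x, ∀ k ∈ I, decisions i z = decisions i k ++ [x] := by
    rintro z ⟨hzt, hzx, p, hpI, hpz, hpne⟩ q hq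
    have h1 := G.decisions_length_lt (G.mem_decisionNodes_of_mem hI hpI) hzt.1 hpz hpne
    have h2 := hmax z ⟨hzt, hzx ▸ hzi⟩
    rw [hlen, G.decisions_eq hI hkI hpI] at h2
    rw [G.decisions_eq hI hq hpI]
    obtain ⟨r, rfl⟩ := hpz
    rw [decisions_append, List.length_append] at h1 h2
    rw [decisions_append]
    -- At least one, since `z` lies strictly after the node `p` of `i`; at most one, by maximality,
    -- since the report `x` at `z` is not a singleton.
    have h3 : (decisions i r).length = 1 := by omega
    obtain ⟨y, hy⟩ := List.length_eq_one_iff.1 h3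
    rw [hy]
    have : y.1 = x.1 := by
      rw [← hzx]
      simp [reported, decisions_append, hy]
    rw [Subtype.ext this]
  obtain ⟨s, hs, t, ht, hst⟩ := hzi
  -- Any partition of `x` into two non-empty cells would do; here one type is separated from the
  -- others.
  have hd : Disjoint ({s} : Set (Θ i)) (x.1 \ {s}) := Set.disjoint_sdiff_right
  have hu : {s} ∪ (x.1 \ {s}) = x.1 := Set.union_sdiff_cancel (by simpa using hs)
  have h2 : (x.1 \ {s}).Nonempty := ⟨t, ht, fun h => hst h.symm⟩
  exact ⟨G.split (x₁ := ⟨{s}, Set.singleton_nonempty s⟩) (x₂ := ⟨_, h2⟩) hI hd hu hne hdec,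
    G.splits_split hI _ hu hne hdec ⟨k, hkI, a, hka, hx⟩,
    G.stopsWhenRevealed_split hI _ hu hne hdec hG, G.unseparated_split hI _ hu hne hdec⟩

end Construction

end GradualMechanism

end Splitting

/-! ### Merging information sets (inverse ILL) -/

section Merging

universe u v w

variable {N : Type u} {Θ : N → Type v} {X : Type w} {f : (∀ i, Θ i) → X}

namespace GradualMechanism

variable (G : GradualMechanism f)

/-- The total number of information sets. -/
noncomputable def infoCount : ℕ := ∑ᶠ i, (G.infoSets i).ncard

theorem infoCount_lt_of_le_of_lt [Finite N] {G G' : GradualMechanism f}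
    (hle : ∀ j, (G'.infoSets j).ncard ≤ (G.infoSets j).ncard) {i : N}
    (hlt : (G'.infoSets i).ncard < (G.infoSets i).ncard) : G'.infoCount < G.infoCount := by
  have := Fintype.ofFinite N
  rw [infoCount, infoCount, finsum_eq_sum_of_fintype, finsum_eq_sum_of_fintype]
  exact Finset.sum_lt_sum (fun j _ => hle j) ⟨i, Finset.mem_univ i, hlt⟩

/-- Two information sets of agent `i` that have no successors and can be merged without violating
perfect recall. -/
structure Mergeable (i : N) (J₁ J₂ : Set (Hist (Report Θ))) : Prop where
  left_mem : J₁ ∈ G.infoSets i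
  right_mem : J₂ ∈ G.infoSets i
  ne : J₁ ≠ J₂
  available_eq : ∀ h ∈ J₁ ∪ J₂, ∀ k ∈ J₁ ∪ J₂, available G.hist i h = available G.hist i k
  decisions_eq : ∀ h ∈ J₁ ∪ J₂, ∀ k ∈ J₁ ∪ J₂, decisions i h = decisions i k
  visited : ∀ h ∈ J₁ ∪ J₂, ∀ k ∈ J₁ ∪ J₂, ∀ h' ∈ decisionNodes G.hist i, h' <+: h → h' ≠ h →
    ∃ k', k' <+: k ∧ ∃ L ∈ G.infoSets i, h' ∈ L ∧ k' ∈ L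
  last : ∀ h ∈ J₁ ∪ J₂, ∀ l ∈ decisionNodes G.hist i, h <+: l → h = l

variable {G} {i : N} {J₁ J₂ : Set (Hist (Report Θ))}

/-- The information sets after merging `J₁` and `J₂`. -/
def mergedSets (G : GradualMechanism f) (i : N) (J₁ J₂ : Set (Hist (Report Θ))) (j : N) :
    Set (Set (Hist (Report Θ))) :=
  {K | K ∈ G.infoSets j ∧ ¬ (j = i ∧ (K = J₁ ∨ K = J₂)) ∨ j = i ∧ K = J₁ ∪ J₂}

theorem exists_mergedSets_superset {j : N} {K : Set (Hist (Report Θ))}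
    (hK : K ∈ G.infoSets j) : ∃ L ∈ mergedSets G i J₁ J₂ j, K ⊆ L := by
  by_cases h : j = i ∧ (K = J₁ ∨ K = J₂)
  · refine ⟨J₁ ∪ J₂, Or.inr ⟨h.1, rfl⟩, ?_⟩
    rcases h.2 with rfl | rfl
    · exact Set.subset_union_left
    · exact Set.subset_union_right
  · exact ⟨K, Or.inl ⟨hK, h⟩, subset_rfl⟩

theorem Mergeable.eq_or_eq_of_mem (hm : G.Mergeable i J₁ J₂) {K : Set (Hist (Report Θ))}
    (hK : K ∈ G.infoSets i) {h : Hist (Report Θ)} (hh : h ∈ K) (hJ : h ∈ J₁ ∪ J₂) :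
    K = J₁ ∨ K = J₂ :=
  hJ.imp (G.infoSet_unique hK hm.left_mem hh) (G.infoSet_unique hK hm.right_mem hh)

theorem Mergeable.disjoint_of_mem (hm : G.Mergeable i J₁ J₂) {K : Set (Hist (Report Θ))}
    (hK : K ∈ G.infoSets i) (hne : ¬ (K = J₁ ∨ K = J₂)) : Disjoint K (J₁ ∪ J₂) :=
  Set.disjoint_left.2 fun _ h1 h2 => hne (hm.eq_or_eq_of_mem hK h1 h2)

/-- The mechanism after merging two information sets. -/
def merge (G : GradualMechanism f) {i : N} {J₁ J₂ : Set (Hist (Report Θ))}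
    (hm : G.Mergeable i J₁ J₂) : GradualMechanism f where
  toDynamicGameForm :=
    { G.toDynamicGameForm with
      infoSets := mergedSets G i J₁ J₂
      infoSets_nonempty := by
        rintro j K (⟨hK, -⟩ | ⟨-, rfl⟩)
        · exact G.infoSets_nonempty j K hK
        · exact (G.infoSets_nonempty i J₁ hm.left_mem).inl
      infoSets_disjoint := by
        rintro j K (⟨hK, hKn⟩ | ⟨rfl, rfl⟩) L (⟨hL, hLn⟩ | ⟨hji, rfl⟩) hKL
        · exact G.infoSets_disjoint j hK hL hKL
        · subst hji
          exact hm.disjoint_of_mem hK fun h => hKn ⟨rfl, h⟩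
        · exact (hm.disjoint_of_mem hL fun h => hLn ⟨rfl, h⟩).symm
        · exact absurd rfl hKL
      infoSets_cover := by
        intro j
        rw [← G.infoSets_cover j]
        ext h
        constructor
        · rintro ⟨K, ⟨hK, -⟩ | ⟨rfl, rfl⟩, hh⟩
          · exact ⟨K, hK, hh⟩
          · rcases hh with hh | hh
            · exact ⟨_, hm.left_mem, hh⟩
            · exact ⟨_, hm.right_mem, hh⟩
        · rintro ⟨K, hK, hh⟩
          obtain ⟨L, hL, hKL⟩ := exists_mergedSets_superset (i := i) (J₁ := J₁) (J₂ := J₂) hK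
          exact ⟨L, hL, hKL hh⟩
      available_eq := by
        rintro j K (⟨hK, -⟩ | ⟨rfl, rfl⟩) h hh k hk
        · exact G.available_eq j K hK h hh k hk
        · exact hm.available_eq h hh k hk
      perfect_recall := by
        have key : ∀ (j : N) (h' k : Hist (Report Θ)),
            (∃ k', k' <+: k ∧ ∃ L ∈ G.infoSets j, h' ∈ L ∧ k' ∈ L) →
            ∃ k', k' <+: k ∧ ∃ L ∈ mergedSets G i J₁ J₂ j, h' ∈ L ∧ k' ∈ L := by
          rintro j h' k ⟨k', hk', L, hL, h1, h2⟩
          obtain ⟨M, hM, hLM⟩ := exists_mergedSets_superset (i := i) (J₁ := J₁) (J₂ := J₂) hL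
          exact ⟨k', hk', M, hM, hLM h1, hLM h2⟩
        rintro j K (⟨hK, -⟩ | ⟨rfl, rfl⟩) h hh k hk
        · have := G.perfect_recall j K hK h hh k hk
          exact ⟨this.1, fun h' hh' hp => key j h' k (this.2 h' hh' hp)⟩
        · refine ⟨hm.decisions_eq h hh k hk, fun h' hh' hp => ?_⟩
          by_cases hne : h' = h
          · subst hne
            exact ⟨k, List.prefix_rfl, _, Or.inr ⟨rfl, rfl⟩, hh, hk⟩
          · exact key j h' k (hm.visited h hh k hk h' hh' hp hne) }
  actions_disjoint := G.actions_disjoint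
  actions_cover := G.actions_cover
  outcome_eq := G.outcome_eq

variable (hm : G.Mergeable i J₁ J₂)

theorem Mergeable.setLE_iff {J : Set (Hist (Report Θ))} (hJ : J ⊆ J₁ ∪ J₂)
    {h : Hist (Report Θ)} (hh : h ∈ decisionNodes G.hist i) (hm : G.Mergeable i J₁ J₂) :
    SetLE J h ↔ h ∈ J := by
  constructor
  · rintro ⟨k, hk, hp⟩
    exact hm.last k (hJ hk) h hh hp ▸ hk
  · exact fun h1 => ⟨h, h1, List.prefix_rfl⟩

/-- No decision node of `i` comes strictly after a node of `J₁ ∪ J₂`. Dividing the union again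
therefore affects no other information set and restores exactly `J₁` and `J₂`. -/
theorem illuminates_merge : (G.merge hm).Illuminates G := by
  have hnode : ∀ h ∈ J₁ ∪ J₂, h ∈ decisionNodes G.hist i := by
    rintro h (hh | hh)
    · exact G.mem_decisionNodes_of_mem hm.left_mem hh
    · exact G.mem_decisionNodes_of_mem hm.right_mem hh
  have hset : ∀ J ⊆ J₁ ∪ J₂, {h | h ∈ J₁ ∪ J₂ ∧ SetLE J h} = J := by
    intro J hJ
    ext h
    constructor
    · rintro ⟨h1, h2⟩
      exact (hm.setLE_iff hJ (hnode h h1)).1 h2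
    · exact fun h1 => ⟨hJ h1, h, h1, List.prefix_rfl⟩
  have hne1 := G.infoSets_nonempty i J₁ hm.left_mem
  have hne2 := G.infoSets_nonempty i J₂ hm.right_mem
  refine ⟨i, J₁ ∪ J₂, Or.inr ⟨rfl, rfl⟩, J₁, J₂, hne1, hne2,
    G.infoSets_disjoint i hm.left_mem hm.right_mem hm.ne, rfl, rfl, ?_, ?_, fun _ _ _ => rfl⟩
  · intro j hj
    ext K
    change _ ↔ _ ∨ _
    simp [hj]
  · ext K
    constructor
    · intro hK
      have hself : ∃ h ∈ J₁ ∪ J₂, SetLE (J₁ ∪ J₂) h := by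
        obtain ⟨h, hh⟩ := hne1
        exact ⟨h, Or.inl hh, h, Or.inl hh, List.prefix_rfl⟩
      by_cases hKJ : K = J₁ ∨ K = J₂
      · refine Or.inr ⟨G.infoSets_nonempty i K hK, J₁ ∪ J₂, Or.inr ⟨rfl, rfl⟩, hself, ?_⟩
        refine hKJ.imp (fun h => ?_) (fun h => ?_)
        · rw [hset _ Set.subset_union_left, h]
        · rw [hset _ Set.subset_union_right, h]
      · refine Or.inl ⟨Or.inl ⟨hK, fun h => hKJ h.2⟩, ?_⟩
        rintro ⟨h, hh, hle⟩
        exact hKJ (hm.eq_or_eq_of_mem hK hh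
          ((hm.setLE_iff subset_rfl (G.mem_decisionNodes_of_mem hK hh)).1 hle))
    · rintro (⟨⟨hK, -⟩ | ⟨-, rfl⟩, hle⟩ | ⟨-, L, ⟨hL, hLn⟩ | ⟨-, rfl⟩, ⟨h, hh, hle⟩, hKL⟩)
      · exact hK
      · obtain ⟨h, hh⟩ := hne1
        exact absurd ⟨h, Or.inl hh, h, Or.inl hh, List.prefix_rfl⟩ hle
      · exact absurd ⟨rfl, hm.eq_or_eq_of_mem hL hh
          ((hm.setLE_iff subset_rfl (G.mem_decisionNodes_of_mem hL hh)).1 hle)⟩ hLn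
      · rw [hset _ Set.subset_union_left, hset _ Set.subset_union_right] at hKL
        rcases hKL with rfl | rfl
        · exact hm.left_mem
        · exact hm.right_mem

theorem infoCount_merge_lt [Finite N] [∀ i, Finite (Θ i)] :
    (G.merge hm).infoCount < G.infoCount := by
  have hlt : ((G.merge hm).infoSets i).ncard < (G.infoSets i).ncard := by
    -- Two sets are removed and one is inserted, so the count drops.
    have hsub : (G.merge hm).infoSets i ⊆ insert (J₁ ∪ J₂) (G.infoSets i \ {J₁, J₂}) := by
      rintro K (⟨hK, hKn⟩ | ⟨-, rfl⟩)
      · exact Or.inr ⟨hK, fun h => hKn ⟨rfl, h⟩⟩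
      · exact Or.inl rfl
    have hfin := G.finite_infoSets i
    have h1 := Set.ncard_le_ncard hsub ((hfin.sdiff).insert _)
    have h2 := Set.ncard_insert_le (J₁ ∪ J₂) (G.infoSets i \ {J₁, J₂})
    have h3 := Set.ncard_sdiff_add_ncard_of_subset (s := {J₁, J₂}) (t := G.infoSets i)
      (by rintro K (rfl | rfl); exacts [hm.left_mem, hm.right_mem]) hfin
    rw [Set.ncard_pair hm.ne] at h3
    omega
  refine infoCount_lt_of_le_of_lt (fun j => ?_) hlt
  by_cases hj : j = i
  · subst hj; exact hlt.le
  · refine le_of_eq (congrArg Set.ncard ?_)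
    ext K
    change _ ∨ _ ↔ _
    simp [hj]

end GradualMechanism

end Merging

/-! ### Rewriting lists entry by entry -/

section Expand

variable {α β : Type*}

/-- Replace every entry `b` of a list by `σ p b`, where `p` consists of the entries before `b`. -/
def expandFrom (σ : List α → α → List β) : List α → List α → List β
  | _, [] => []
  | p, b :: r => σ p b ++ expandFrom σ (p ++ [b]) r

/-- Replace every entry `b` of a list by `σ p b`, where `p` consists of the entries before `b`. -/
def expand (σ : List α → α → List β) (h : List α) : List β := expandFrom σ [] h

variable (σ : List α → α → List β)

theorem expandFrom_append (p r s : List α) :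
    expandFrom σ p (r ++ s) = expandFrom σ p r ++ expandFrom σ (p ++ r) s := by
  induction r generalizing p with
  | nil => simp [expandFrom]
  | cons b r ih => simp [expandFrom, ih]

theorem expand_nil : expand σ [] = [] := rfl

theorem expand_snoc (h : List α) (b : α) : expand σ (h ++ [b]) = expand σ h ++ σ h b := by
  simp [expand, expandFrom_append, expandFrom]

variable {σ} (hσ : ∀ p b, (σ p b).length ≤ 1)

include hσ in
theorem eq_nil_or_singleton (p : List α) (b : α) : σ p b = [] ∨ ∃ c, σ p b = [c] := by
  have := hσ p b
  interval_cases h : (σ p b).length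
  · exact Or.inl (List.length_eq_zero_iff.1 h)
  · exact Or.inr (List.length_eq_one_iff.1 h)

include hσ in
theorem length_expand_le (h : List α) : (expand σ h).length ≤ h.length := by
  induction h using List.reverseRecOn with
  | nil => simp [expand_nil]
  | append_singleton h b ih =>
    rw [expand_snoc, List.length_append, List.length_append, List.length_singleton]
    have := hσ h b
    omega

include hσ in
-- Since an entry yields at most one entry, the last entry of the image has a single entry `b` as
-- its origin, and everything after `b` is erased.
theorem exists_of_expand_eq_append {k : List α} {g : List β} {c : β}
    (h : expand σ k = g ++ [c]) : ∃ l b, l ++ [b] <+: k ∧ expand σ l = g ∧ σ l b = [c] := by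
  induction k using List.reverseRecOn with
  | nil => simp [expand_nil] at h
  | append_singleton k b ih =>
    rw [expand_snoc] at h
    rcases eq_nil_or_singleton hσ k b with h1 | ⟨d, h1⟩
    · rw [h1, List.append_nil] at h
      obtain ⟨l, b', hp, h2⟩ := ih h
      exact ⟨l, b', hp.trans (List.prefix_append _ _), h2⟩
    · rw [h1] at h
      obtain ⟨h2, h3⟩ := List.append_inj' h rfl
      exact ⟨k, b, List.prefix_rfl, h2, h1.trans h3⟩

include hσ in
-- Among the prefixes of `k` with image `g`, one is taken that is all of `k` or is followed by an
-- entry that survives. For `coaMap`, survival of the next entry makes the prefix `Proper`.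
theorem exists_of_prefix_expand {k : List α} {g : List β} (h : g <+: expand σ k) :
    ∃ l, l <+: k ∧ expand σ l = g ∧ (l = k ∨ ∃ b c, l ++ [b] <+: k ∧ σ l b = [c]) := by
  by_cases hg : g = expand σ k
  · exact ⟨k, List.prefix_rfl, hg.symm, Or.inl rfl⟩
  · induction k using List.reverseRecOn with
    | nil => exact absurd (by simpa [expand_nil] using h) hg
    | append_singleton k b ih =>
      have hp : k <+: k ++ [b] := List.prefix_append _ _
      rw [expand_snoc] at h hg
      have main : g <+: expand σ k → g ≠ expand σ k →
          ∃ l, l <+: k ++ [b] ∧ expand σ l = g ∧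
            (l = k ++ [b] ∨ ∃ b' c, l ++ [b'] <+: k ++ [b] ∧ σ l b' = [c]) := by
        intro h1 h2
        obtain ⟨l, hl, hlg, rfl | ⟨b', c, h3, h4⟩⟩ := ih h1 h2
        · exact absurd hlg.symm h2
        · exact ⟨l, hl.trans hp, hlg, Or.inr ⟨b', c, h3.trans hp, h4⟩⟩
      rcases eq_nil_or_singleton hσ k b with h1 | ⟨d, h1⟩
      · rw [h1, List.append_nil] at h hg
        exact main h hg
      · rw [h1] at h hg
        rcases List.prefix_concat_iff.1 h with h2 | h2
        · exact absurd h2 hg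
        · by_cases h3 : g = expand σ k
          · exact ⟨k, hp, h3.symm, Or.inr ⟨b, d, List.prefix_rfl, h1⟩⟩
          · exact main h2 h3

theorem expand_append_of_forall {σ : List α → α → List α} {p g : List α}
    (h : ∀ q c, q ++ [c] <+: g → σ (p ++ q) c = [c]) : expand σ (p ++ g) = expand σ p ++ g := by
  induction g using List.reverseRecOn with
  | nil => simp
  | append_singleton g b ih =>
    rw [← List.append_assoc, expand_snoc, h g b List.prefix_rfl,
      ih fun q c hq => h q c (hq.trans (List.prefix_append _ _)), List.append_assoc]

end Expand

/-! ### Coalescing (COA): the rewritten tree and its available actions -/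

section Coalescing

universe u v w

variable {N : Type u} {Θ : N → Type v} {X : Type w} {f : (∀ i, Θ i) → X}

/-- The report of an exact type. -/
def exactReport {i : N} (t : Θ i) : Report Θ i := ⟨{t}, Set.singleton_nonempty t⟩

/-- `h` passes through the choice of `x` by agent `i` at `I`. -/
def Passes (i : N) (I : Set (Hist (Report Θ))) (x : Report Θ i) (h : Hist (Report Θ)) : Prop :=
  ∃ k ∈ I, ∃ a : ActProfile (Report Θ), a i = some x ∧ (k ++ [a]) <+: h

section Passes

variable {i : N} {I : Set (Hist (Report Θ))} {x : Report Θ i} {h k : Hist (Report Θ)}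

theorem Passes.mono (hh : Passes i I x h) (hp : h <+: k) : Passes i I x k := by
  obtain ⟨l, hl, a, ha, hp'⟩ := hh
  exact ⟨l, hl, a, ha, hp'.trans hp⟩

theorem passes_snoc {b : ActProfile (Report Θ)} :
    Passes i I x (h ++ [b]) ↔ Passes i I x h ∨ h ∈ I ∧ b i = some x := by
  constructor
  · rintro ⟨k, hk, a, ha, hp⟩
    rcases List.prefix_concat_iff.1 hp with h1 | h1
    · obtain ⟨rfl, h2⟩ := List.append_inj' h1 rfl
      simp only [List.cons.injEq, and_true] at h2
      exact Or.inr ⟨hk, h2 ▸ ha⟩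
    · exact Or.inl ⟨k, hk, a, ha, h1⟩
  · rintro (h1 | ⟨h1, h2⟩)
    · exact h1.mono (List.prefix_append _ _)
    · exact ⟨h, h1, b, h2, List.prefix_rfl⟩

theorem not_passes_nil : ¬ Passes i I x [] := by
  rintro ⟨k, -, a, -, hp⟩
  simp at hp

end Passes

namespace GradualMechanism

variable (G : GradualMechanism f)

/-- `J` is the only information set of agent `i` after she has chosen `x` at `I`, and at `J` she
reveals her exact type. -/
structure Coalescible (i : N) (I J : Set (Hist (Report Θ))) (x : Report Θ i) : Prop where
  left_mem : I ∈ G.infoSets i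
  right_mem : J ∈ G.infoSets i
  available_left : x ∈ G.availableAt i I
  mem_iff : ∀ l, l ∈ J ↔ l ∈ decisionNodes G.hist i ∧ Passes i I x l
  available_right : ∀ l ∈ J, ∀ y, y ∈ available G.hist i l ↔ ∃ t ∈ x.1, y = exactReport t
  reaches : ∀ z ∈ terminals G.hist, Passes i I x z → SetLE J z

variable {G} {i : N} {I J : Set (Hist (Report Θ))} {x : Report Θ i}

namespace Coalescible

variable (hc : G.Coalescible i I J x)
include hc

theorem not_passes_of_mem {h : Hist (Report Θ)} (hh : h ∈ I) : ¬ Passes i I x h := by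
  rintro ⟨k, hk, a, -, hp⟩
  obtain rfl := G.eq_of_mem_of_prefix hc.left_mem hk hh ((List.prefix_append _ _).trans hp)
  exact not_snoc_prefix_self _ _ hp

theorem notMem_of_passes {h : Hist (Report Θ)} (hh : Passes i I x h) : h ∉ I :=
  fun hI => hc.not_passes_of_mem hI hh

theorem passes_of_mem {h : Hist (Report Θ)} (hh : h ∈ J) : Passes i I x h :=
  ((hc.mem_iff h).1 hh).2

theorem notMem_left {h : Hist (Report Θ)} (hh : h ∈ J) : h ∉ I :=
  hc.notMem_of_passes (hc.passes_of_mem hh)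

theorem notMem_right {h : Hist (Report Θ)} (hh : h ∈ I) : h ∉ J :=
  fun hJ => hc.notMem_left hJ hh

theorem eq_none_of_passes {h : Hist (Report Θ)} {b : ActProfile (Report Θ)}
    (hb : h ++ [b] ∈ G.hist) (hp : Passes i I x h) (hJ : h ∉ J) : b i = none := by
  by_contra hne
  exact hJ ((hc.mem_iff h).2 ⟨⟨b, hb, hne⟩, hp⟩)

theorem not_setLT_of_mem {h : Hist (Report Θ)} (hh : h ∈ J) : ¬ SetLT J h := by
  rintro ⟨k, hk, hp, hne⟩
  exact hne (G.eq_of_mem_of_prefix hc.right_mem hk hh hp)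

/-- All decision nodes of `i` after the choice of `x` lie in `J`. Until `J` is left, `x` therefore
remains her last action. -/
theorem reported_eq {h : Hist (Report Θ)} (hh : h ∈ G.hist) (hp : Passes i I x h)
    (hJ : ¬ SetLT J h) : reported i h = x.1 := by
  induction h using List.reverseRecOn with
  | nil => exact absurd hp not_passes_nil
  | append_singleton h b ih =>
    rcases passes_snoc.1 hp with h1 | ⟨h1, h2⟩
    · have hJ' : h ∉ J := fun hJ' => hJ ⟨h, hJ', List.prefix_append _ _, by simp⟩
      rw [reported_append_none (hc.eq_none_of_passes hh h1 hJ')]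
      refine ih (G.mem_of_append _ _ hh) h1 ?_
      rintro ⟨k, hk, hkp, hne⟩
      refine hJ ⟨k, hk, hkp.trans (List.prefix_append _ _), ?_⟩
      rintro rfl
      exact not_snoc_prefix_self _ _ hkp
    · rw [reported_append_some h2]

/-- The report at `J` is a singleton and reports only shrink, so a type still possible at `h`
identifies it. -/
theorem apply_eq_of_mem {l h : Hist (Report Θ)} {b : ActProfile (Report Θ)} {t : Θ i}
    (hl : l ∈ J) (hp : l ++ [b] <+: h) (hh : h ∈ G.hist) (ht : t ∈ reported i h) :
    b i = some (exactReport t) := by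
  have hb := G.mem_of_prefix hh hp
  have hlm : l ∈ decisionNodes G.hist i := ((hc.mem_iff l).1 hl).1
  obtain ⟨y, hy⟩ := Option.ne_none_iff_exists'.1 (G.ne_none_of_mem_decisionNodes hlm hb)
  obtain ⟨s, -, rfl⟩ := (hc.available_right l hl y).1 ⟨b, hb, hy⟩
  have := G.reported_anti hh hp ht
  rw [reported_append_some hy] at this
  obtain rfl : t = s := this
  exact hy

end Coalescible

end GradualMechanism

variable [DecidableEq N]

open Classical in
/-- The profiles that replace `b` at `h` when the choice of `t` by agent `i` at `J` is moved
forward to `I`, where it replaces `x`. -/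
noncomputable def coaStep (i : N) (I J : Set (Hist (Report Θ))) (x : Report Θ i) (t : Θ i)
    (h : Hist (Report Θ)) (b : ActProfile (Report Θ)) : Hist (Report Θ) :=
  if h ∈ I ∧ b i = some x then [Function.update b i (some (exactReport t))]
  else if h ∈ J then
    if ∀ j, j ≠ i → b j = none then [] else [Function.update b i none]
  else [b]

/-- The history that `h` gives rise to when the choice of `t` by agent `i` at `J` is moved
forward to `I`, where it replaces `x`. -/
noncomputable def coaMap (i : N) (I J : Set (Hist (Report Θ))) (x : Report Θ i) (t : Θ i)
    (h : Hist (Report Θ)) : Hist (Report Θ) := expand (coaStep i I J x t) h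

section CoaMap

variable {i : N} {I J : Set (Hist (Report Θ))} {x : Report Θ i}

theorem coaStep_length_le (t : Θ i) (h : Hist (Report Θ)) (b : ActProfile (Report Θ)) :
    (coaStep i I J x t h b).length ≤ 1 := by
  unfold coaStep
  split_ifs <;> simp

theorem coaStep_length_eq (s t : Θ i) (h : Hist (Report Θ)) (b : ActProfile (Report Θ)) :
    (coaStep i I J x s h b).length = (coaStep i I J x t h b).length := by
  unfold coaStep
  split_ifs <;> simp

theorem coaMap_nil (t : Θ i) : coaMap i I J x t [] = [] := rfl

theorem coaMap_snoc (t : Θ i) (h : Hist (Report Θ)) (b : ActProfile (Report Θ)) :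
    coaMap i I J x t (h ++ [b]) = coaMap i I J x t h ++ coaStep i I J x t h b :=
  expand_snoc _ _ _

/-- Whether an entry is erased does not depend on the type; only the report inserted at `I` does. -/
theorem coaMap_length_eq (s t : Θ i) (h : Hist (Report Θ)) :
    (coaMap i I J x s h).length = (coaMap i I J x t h).length := by
  induction h using List.reverseRecOn with
  | nil => rfl
  | append_singleton h b ih =>
    rw [coaMap_snoc, coaMap_snoc, List.length_append, List.length_append, ih,
      coaStep_length_eq s t]

theorem coaMap_prefix (t : Θ i) {h k : Hist (Report Θ)} (hp : h <+: k) :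
    coaMap i I J x t h <+: coaMap i I J x t k := by
  obtain ⟨g, rfl⟩ := hp
  induction g using List.reverseRecOn with
  | nil => simp
  | append_singleton g b ih =>
    rw [← List.append_assoc, coaMap_snoc]
    exact ih.trans (List.prefix_append _ _)

theorem coaStep_of_notMem (t : Θ i) {h : Hist (Report Θ)} (hI : h ∉ I) (hJ : h ∉ J)
    (b : ActProfile (Report Θ)) : coaStep i I J x t h b = [b] := by
  simp [coaStep, hI, hJ]

theorem coaStep_of_ne (t : Θ i) {h : Hist (Report Θ)} (hJ : h ∉ J)
    {b : ActProfile (Report Θ)} (hb : b i ≠ some x) : coaStep i I J x t h b = [b] := by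
  simp [coaStep, hb, hJ]

theorem coaStep_of_eq (t : Θ i) {h : Hist (Report Θ)} (hI : h ∈ I)
    {b : ActProfile (Report Θ)} (hb : b i = some x) :
    coaStep i I J x t h b = [Function.update b i (some (exactReport t))] := by
  simp only [coaStep, hI, hb, and_self, if_true]

theorem coaStep_of_mem (t : Θ i) {h : Hist (Report Θ)} (hI : h ∉ I) (hJ : h ∈ J)
    {b : ActProfile (Report Θ)} (hb : ∃ j, j ≠ i ∧ b j ≠ none) :
    coaStep i I J x t h b = [Function.update b i none] := by
  have : ¬ ∀ j, j ≠ i → b j = none := by push Not; exact hb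
  simp only [coaStep, hI, hJ, false_and, if_false, if_true, if_neg this]

theorem coaStep_of_mem_alone (t : Θ i) {h : Hist (Report Θ)} (hI : h ∉ I) (hJ : h ∈ J)
    {b : ActProfile (Report Θ)} (hb : ∀ j, j ≠ i → b j = none) :
    coaStep i I J x t h b = [] := by
  simp only [coaStep, hI, hJ, false_and, if_false, if_true, if_pos hb]

/-- Only the component of `i` is altered, and a profile is erased only if nobody else acts in it. -/
theorem decisions_coaStep (t : Θ i) {j : N} (hj : j ≠ i) (h : Hist (Report Θ))
    (b : ActProfile (Report Θ)) : decisions j (coaStep i I J x t h b) = (b j).toList := by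
  unfold coaStep
  split_ifs with h1 h2 h3
  · simp [decisions_singleton, hj]
  · simp [h3 j hj, decisions]
  · simp [decisions_singleton, hj]
  · simp [decisions_singleton]

theorem decisions_coaMap (t : Θ i) {j : N} (hj : j ≠ i) (h : Hist (Report Θ)) :
    decisions j (coaMap i I J x t h) = decisions j h := by
  induction h using List.reverseRecOn with
  | nil => rfl
  | append_singleton h b ih =>
    rw [coaMap_snoc, decisions_append, decisions_append, ih, decisions_coaStep t hj,
      decisions_singleton]

end CoaMap

namespace GradualMechanism

variable (G : GradualMechanism f)

/-- `h` is not a history in `J` at which agent `i` is the only active agent. -/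
def Proper (i : N) (J : Set (Hist (Report Θ))) (h : Hist (Report Θ)) : Prop :=
  h ∈ J → ∃ b : ActProfile (Report Θ), h ++ [b] ∈ G.hist ∧ ∃ j, j ≠ i ∧ b j ≠ none

/-- The histories of the coalesced mechanism. -/
def coaHist (i : N) (I J : Set (Hist (Report Θ))) (x : Report Θ i) : Set (Hist (Report Θ)) :=
  {h' | ∃ h ∈ G.hist, ∃ t ∈ reported i h, h' = coaMap i I J x t h}

variable {G} {i : N} {I J : Set (Hist (Report Θ))} {x : Report Θ i}

namespace Coalescible

variable (hc : G.Coalescible i I J x)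
include hc

/-- Every node of `J` passes the choice of `x`, so no entry of `h` is touched. In particular the
image does not depend on `t`. -/
theorem coaMap_of_not_passes {h : Hist (Report Θ)} (hp : ¬ Passes i I x h) (t : Θ i) :
    coaMap i I J x t h = h := by
  induction h using List.reverseRecOn with
  | nil => rfl
  | append_singleton h b ih =>
    rw [passes_snoc, not_or] at hp
    have hJ : h ∉ J := fun hJ => hp.1 (hc.passes_of_mem hJ)
    have : coaStep i I J x t h b = [b] := by
      simp only [coaStep, if_neg hp.2, if_neg hJ]
    rw [coaMap_snoc, ih hp.1, this]

/-- The exact type inserted at `I` is the last action of `i` in the image, because her action at `J`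
is deleted and she has no other decision node after `x`. -/
theorem reported_coaMap {h : Hist (Report Θ)} (hh : h ∈ G.hist) (hp : Passes i I x h) (t : Θ i) :
    reported i (coaMap i I J x t h) = {t} := by
  induction h using List.reverseRecOn with
  | nil => exact absurd hp not_passes_nil
  | append_singleton h b ih =>
    rw [coaMap_snoc]
    rcases passes_snoc.1 hp with h1 | ⟨h1, h2⟩
    · rw [← ih (G.mem_of_append _ _ hh) h1]
      refine reported_append_of_decisions_eq_nil ?_
      have hI := hc.notMem_of_passes h1
      by_cases hJ : h ∈ J
      · by_cases hb : ∀ j, j ≠ i → b j = none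
        · rw [coaStep_of_mem_alone t hI hJ hb]; rfl
        · push Not at hb
          rw [coaStep_of_mem t hI hJ hb]
          simp [decisions_singleton]
      · rw [coaStep_of_notMem t hI hJ, decisions_singleton, hc.eq_none_of_passes hh h1 hJ]
        rfl
    · rw [coaStep_of_eq t h1 h2, reported_append_some (Function.update_self ..)]
      rfl

theorem reported_coaMap_subset {h : Hist (Report Θ)} (hh : h ∈ G.hist) {t : Θ i}
    (ht : t ∈ reported i h) (j : N) : reported j (coaMap i I J x t h) ⊆ reported j h := by
  by_cases hj : j = i
  · subst hj
    by_cases hp : Passes j I x h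
    · rw [hc.reported_coaMap hh hp]
      simpa using ht
    · rw [hc.coaMap_of_not_passes hp]
  · rw [reported_of_decisions_eq (decisions_coaMap t hj h)]

/-- A proper history is the longest one with a given image. -/
theorem prefix_of_coaMap_eq [∀ i, Nonempty (Θ i)] {h l : Hist (Report Θ)} (hh : h ∈ G.hist)
    (hl : l ∈ G.hist) {s t : Θ i} (ht : t ∈ reported i h) (hs : s ∈ reported i l)
    (heq : coaMap i I J x t h = coaMap i I J x s l) (hlp : G.Proper i J l) : h <+: l := by
  obtain ⟨θ, hθ⟩ := reportedProfiles_nonempty (coaMap i I J x t h)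
  have h1 : θ ∈ reportedProfiles h := fun j => hc.reported_coaMap_subset hh ht j (hθ j)
  have h2 : θ ∈ reportedProfiles l :=
    fun j => hc.reported_coaMap_subset hl hs j (by rw [← heq]; exact hθ j)
  rcases G.prefix_or_prefix hh hl h1 h2 with hp | hp
  · exact hp
  · by_contra hne
    obtain ⟨b, hb⟩ := exists_snoc_prefix hp (by rintro rfl; exact hne List.prefix_rfl)
    have hlen := (coaMap_prefix (I := I) (J := J) (x := x) t hb).length_le
    rw [coaMap_snoc, List.length_append, heq, coaMap_length_eq t s] at hlen
    -- If `l` were strictly shorter, equality of the images would force the entry after `l` to be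
    -- erased. That happens only at a node of `J` where `i` is alone, which properness of `l`
    -- excludes.
    have h0 : coaStep i I J x t l b = [] := List.length_eq_zero_iff.1 (by omega)
    by_cases hJ : l ∈ J
    · obtain ⟨b', hb', j, hj, hbj⟩ := hlp hJ
      have : b j ≠ none :=
        G.ne_none_of_mem_decisionNodes ⟨b', hb', hbj⟩ (G.mem_of_prefix hh hb)
      rw [coaStep_of_mem t (hc.notMem_left hJ) hJ ⟨j, hj, this⟩] at h0
      simp at h0
    · by_cases hbx : l ∈ I ∧ b i = some x
      · rw [coaStep_of_eq t hbx.1 hbx.2] at h0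
        simp at h0
      · simp [coaStep, hbx, hJ] at h0

theorem proper_of_coaStep_ne_nil {l : Hist (Report Θ)} {b : ActProfile (Report Θ)} {t : Θ i}
    (hb : l ++ [b] ∈ G.hist) (hne : coaStep i I J x t l b ≠ []) : G.Proper i J l := by
  intro hJ
  by_contra! hcon
  exact hne (coaStep_of_mem_alone t (hc.notMem_left hJ) hJ (hcon b hb))

/-- A continuation of the image comes from some `l ++ [b]` whose entry `b` survives, so `l` is
proper; `l` and `h` are then both the longest history with this image and coincide. The type `s` may
differ from `t`, since before `x` is chosen the image does not record it. The next three lemmas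
evaluate this away from `I` and `J`, at `I`, and at `J`. -/
theorem append_mem_coaHist [∀ i, Nonempty (Θ i)] {h : Hist (Report Θ)} (hh : h ∈ G.hist)
    (hp : G.Proper i J h) {t : Θ i} (ht : t ∈ reported i h) {c : ActProfile (Report Θ)} :
    coaMap i I J x t h ++ [c] ∈ G.coaHist i I J x ↔
      ∃ b s, h ++ [b] ∈ G.hist ∧ s ∈ reported i (h ++ [b]) ∧
        coaMap i I J x s h = coaMap i I J x t h ∧ coaStep i I J x s h b = [c] := by
  constructor
  · rintro ⟨k, hk, s, hs, heq⟩
    obtain ⟨l, b, hlb, h1, h2⟩ := exists_of_expand_eq_append (coaStep_length_le s) heq.symm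
    have hb := G.mem_of_prefix hk hlb
    have hl := G.mem_of_append _ _ hb
    have hs' := G.reported_anti hk hlb hs
    have hsl := G.reported_append_subset hb hs'
    have hlp := hc.proper_of_coaStep_ne_nil (t := s) hb (by rw [h2]; simp)
    have hlh := hc.prefix_of_coaMap_eq hl hh hsl ht h1 hp
    have hhl := hc.prefix_of_coaMap_eq hh hl ht hsl h1.symm hlp
    obtain rfl : l = h := hlh.eq_of_length_le hhl.length_le
    exact ⟨b, s, hb, hs', h1, h2⟩
  · rintro ⟨b, s, hb, hs, h1, h2⟩
    exact ⟨h ++ [b], hb, s, hs, by rw [coaMap_snoc, h1, h2]⟩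

theorem append_mem_of_notMem [∀ i, Nonempty (Θ i)] {h : Hist (Report Θ)} (hh : h ∈ G.hist)
    (hI : h ∉ I) (hJ : h ∉ J) {t : Θ i} (ht : t ∈ reported i h) {c : ActProfile (Report Θ)} :
    coaMap i I J x t h ++ [c] ∈ G.coaHist i I J x ↔ h ++ [c] ∈ G.hist := by
  rw [hc.append_mem_coaHist hh (fun h => absurd h hJ) ht]
  constructor
  · rintro ⟨b, s, hb, -, -, h1⟩
    rw [coaStep_of_notMem s hI hJ] at h1
    simp only [List.cons.injEq, and_true] at h1
    exact h1 ▸ hb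
  · intro hcm
    by_cases hp : Passes i I x h
    · refine ⟨c, t, hcm, ?_, rfl, coaStep_of_notMem t hI hJ c⟩
      rwa [reported_append_none (hc.eq_none_of_passes hcm hp hJ)]
    · obtain ⟨s, hs⟩ := reported_nonempty i (h ++ [c])
      refine ⟨c, s, hcm, hs, ?_, coaStep_of_notMem s hI hJ c⟩
      rw [hc.coaMap_of_not_passes hp, hc.coaMap_of_not_passes hp]

theorem append_mem_of_mem_left [∀ i, Nonempty (Θ i)] {h : Hist (Report Θ)}
    (hI : h ∈ I) {t : Θ i} (ht : t ∈ reported i h) {c : ActProfile (Report Θ)} :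
    coaMap i I J x t h ++ [c] ∈ G.coaHist i I J x ↔
      h ++ [c] ∈ G.hist ∧ c i ≠ some x ∨
      ∃ s ∈ x.1, c i = some (exactReport s) ∧
        h ++ [Function.update c i (some x)] ∈ G.hist := by
  have hh := G.mem_hist_of_mem hc.left_mem hI
  have hJ := hc.notMem_right hI
  have hid := hc.coaMap_of_not_passes (hc.not_passes_of_mem hI)
  rw [hc.append_mem_coaHist hh (fun h => absurd h hJ) ht]
  constructor
  · rintro ⟨b, s, hb, hs, -, h1⟩
    by_cases hbx : b i = some x
    · rw [coaStep_of_eq s hI hbx] at h1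
      simp only [List.cons.injEq, and_true] at h1
      rw [reported_append_some hbx] at hs
      refine Or.inr ⟨s, hs, by rw [← h1]; simp, ?_⟩
      convert hb
      rw [← h1, ← hbx]
      funext j
      by_cases hj : j = i
      · subst hj; simp
      · simp [hj]
    · rw [coaStep_of_ne s hJ hbx] at h1
      simp only [List.cons.injEq, and_true] at h1
      exact Or.inl ⟨h1 ▸ hb, h1 ▸ hbx⟩
  · rintro (⟨hcm, hcx⟩ | ⟨s, hs, hcs, hcm⟩)
    · obtain ⟨s, hs⟩ := reported_nonempty i (h ++ [c])
      exact ⟨c, s, hcm, hs, by rw [hid, hid], coaStep_of_ne s hJ hcx⟩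
    · refine ⟨_, s, hcm, ?_, by rw [hid, hid], ?_⟩
      · rw [reported_append_some (Function.update_self ..)]
        exact hs
      · rw [coaStep_of_eq s hI (Function.update_self ..)]
        congr 1
        funext j
        by_cases hj : j = i
        · subst hj; simp [hcs]
        · simp [hj]

theorem append_mem_of_mem_right [∀ i, Nonempty (Θ i)] {h : Hist (Report Θ)}
    (hJ : h ∈ J) (hp : G.Proper i J h) {t : Θ i} (ht : t ∈ reported i h)
    {c : ActProfile (Report Θ)} :
    coaMap i I J x t h ++ [c] ∈ G.coaHist i I J x ↔
      c i = none ∧ h ++ [Function.update c i (some (exactReport t))] ∈ G.hist := by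
  have hh := G.mem_hist_of_mem hc.right_mem hJ
  have hI := hc.notMem_left hJ
  rw [hc.append_mem_coaHist hh hp ht]
  constructor
  · rintro ⟨b, s, hb, hs, h1, h2⟩
    -- At `J` the image already records the exact type of `i`, so `s` cannot differ from `t`.
    have hst : ({s} : Set (Θ i)) = {t} := by
      rw [← hc.reported_coaMap hh (hc.passes_of_mem hJ) s, h1,
        hc.reported_coaMap hh (hc.passes_of_mem hJ)]
    obtain rfl := Set.singleton_injective hst
    have hbs := hc.apply_eq_of_mem hJ List.prefix_rfl hb hs
    by_cases hbj : ∀ j, j ≠ i → b j = none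
    · rw [coaStep_of_mem_alone s hI hJ hbj] at h2
      simp at h2
    · push Not at hbj
      rw [coaStep_of_mem s hI hJ hbj] at h2
      simp only [List.cons.injEq, and_true] at h2
      refine ⟨by rw [← h2]; simp, ?_⟩
      convert hb
      rw [← h2, ← hbs]
      funext j
      by_cases hj : j = i
      · subst hj; simp
      · simp [hj]
  · rintro ⟨hcn, hcm⟩
    refine ⟨_, t, hcm, ?_, rfl, ?_⟩
    · rw [reported_append_some (Function.update_self ..)]
      exact Set.mem_singleton t
    · obtain ⟨b', hb', j, hj, hbj⟩ := hp hJ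
      rw [coaStep_of_mem t hI hJ ⟨j, hj, G.ne_none_of_mem_decisionNodes ⟨b', hb', hbj⟩ hcm⟩]
      congr 1
      funext j
      by_cases hj : j = i
      · subst hj; simp [hcn]
      · simp [hj]

/-- Here `i` is alone at a node of `J`. Her report of `t` is erased, so the successor has the same
image, and it has left `J`. -/
theorem exists_proper [∀ i, Nonempty (Θ i)] {h : Hist (Report Θ)} (hh : h ∈ G.hist) {t : Θ i}
    (ht : t ∈ reported i h) (hp : ¬ G.Proper i J h) :
    ∃ b, h ++ [b] ∈ G.hist ∧ G.Proper i J (h ++ [b]) ∧ t ∈ reported i (h ++ [b]) ∧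
      coaMap i I J x t (h ++ [b]) = coaMap i I J x t h := by
  classical
  simp only [Proper, Classical.not_imp] at hp
  obtain ⟨hJ, halone⟩ := hp
  push Not at halone
  have htx : t ∈ x.1 := by
    rwa [hc.reported_eq hh (hc.passes_of_mem hJ) (hc.not_setLT_of_mem hJ)] at ht
  obtain ⟨b, hb, hbi⟩ := (hc.available_right h hJ _).2 ⟨t, htx, rfl⟩
  refine ⟨b, hb, fun hJ' => ?_, ?_, ?_⟩
  · exact absurd (G.eq_of_mem_of_prefix hc.right_mem hJ hJ' (List.prefix_append _ _)) (by simp)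
  · rw [reported_append_some hbi]
    exact Set.mem_singleton t
  · rw [coaMap_snoc, coaStep_of_mem_alone t (hc.notMem_left hJ) hJ (halone b hb),
      List.append_nil]

theorem exists_proper_of_mem [∀ i, Nonempty (Θ i)] {h' : Hist (Report Θ)}
    (hh' : h' ∈ G.coaHist i I J x) :
    ∃ h ∈ G.hist, G.Proper i J h ∧ ∃ t ∈ reported i h, h' = coaMap i I J x t h := by
  obtain ⟨h, hh, t, ht, rfl⟩ := hh'
  by_cases hp : G.Proper i J h
  · exact ⟨h, hh, hp, t, ht, rfl⟩
  · obtain ⟨b, hb, hbp, hbt, heq⟩ := hc.exists_proper hh ht hp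
    exact ⟨_, hb, hbp, t, hbt, heq.symm⟩

section Available

variable [∀ i, Nonempty (Θ i)] {h : Hist (Report Θ)} {t : Θ i}

theorem available_of_ne (hh : h ∈ G.hist) (hp : G.Proper i J h) (ht : t ∈ reported i h) {j : N}
    (hj : j ≠ i) : available (G.coaHist i I J x) j (coaMap i I J x t h) =
      available G.hist j h := by
  ext y
  by_cases hI : h ∈ I
  · constructor
    · rintro ⟨c, hcm, hcy⟩
      rcases (hc.append_mem_of_mem_left hI ht).1 hcm with ⟨h1, -⟩ | ⟨s, -, -, h1⟩
      · exact ⟨c, h1, hcy⟩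
      · exact ⟨_, h1, by simpa [hj] using hcy⟩
    · rintro ⟨b, hb, hby⟩
      by_cases hbx : b i = some x
      · obtain ⟨s, hs⟩ := x.2
        refine ⟨Function.update b i (some (exactReport s)),
          (hc.append_mem_of_mem_left hI ht).2 (Or.inr ⟨s, hs, by simp, ?_⟩), by simpa [hj] using hby⟩
        rwa [Function.update_idem, ← hbx, Function.update_eq_self]
      · exact ⟨b, (hc.append_mem_of_mem_left hI ht).2 (Or.inl ⟨hb, hbx⟩), hby⟩
  · by_cases hJ : h ∈ J
    · have htx : t ∈ x.1 := by
        rwa [hc.reported_eq hh (hc.passes_of_mem hJ) (hc.not_setLT_of_mem hJ)] at ht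
      constructor
      · rintro ⟨c, hcm, hcy⟩
        exact ⟨_, ((hc.append_mem_of_mem_right hJ hp ht).1 hcm).2, by simpa [hj] using hcy⟩
      · rintro ⟨b, hb, hby⟩
        refine ⟨Function.update b i none, (hc.append_mem_of_mem_right hJ hp ht).2 ⟨by simp, ?_⟩,
          by simpa [hj] using hby⟩
        rw [Function.update_idem]
        exact G.append_update_mem hb ((hc.available_right h hJ _).2 ⟨t, htx, rfl⟩)
    · simp only [available, hc.append_mem_of_notMem hh hI hJ ht]

theorem available_self_of_notMem (hh : h ∈ G.hist) (hI : h ∉ I) (hJ : h ∉ J)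
    (ht : t ∈ reported i h) : available (G.coaHist i I J x) i (coaMap i I J x t h) =
      available G.hist i h := by
  simp only [available, hc.append_mem_of_notMem hh hI hJ ht]

theorem available_self_of_mem_left (hI : h ∈ I) (ht : t ∈ reported i h) :
    available (G.coaHist i I J x) i (coaMap i I J x t h) =
      {y | y ∈ available G.hist i h ∧ y ≠ x ∨ ∃ s ∈ x.1, y = exactReport s} := by
  ext y
  constructor
  · rintro ⟨c, hcm, hcy⟩
    rcases (hc.append_mem_of_mem_left hI ht).1 hcm with ⟨h1, h2⟩ | ⟨s, hs, h1, h2⟩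
    · refine Or.inl ⟨⟨c, h1, hcy⟩, ?_⟩
      rintro rfl
      exact h2 hcy
    · exact Or.inr ⟨s, hs, Option.some_injective _ (hcy.symm.trans h1)⟩
  · rintro (⟨⟨b, hb, hby⟩, hyx⟩ | ⟨s, hs, rfl⟩)
    · refine ⟨b, (hc.append_mem_of_mem_left hI ht).2 (Or.inl ⟨hb, ?_⟩), hby⟩
      rw [hby]
      simpa using hyx
    · have hx := hc.available_left
      rw [G.availableAt_eq hc.left_mem hI] at hx
      obtain ⟨b, hb, hbx⟩ := hx
      refine ⟨Function.update b i (some (exactReport s)),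
        (hc.append_mem_of_mem_left hI ht).2 (Or.inr ⟨s, hs, by simp, ?_⟩), by simp⟩
      rwa [Function.update_idem, ← hbx, Function.update_eq_self]

theorem available_self_of_mem_right (hJ : h ∈ J) (hp : G.Proper i J h)
    (ht : t ∈ reported i h) :
    available (G.coaHist i I J x) i (coaMap i I J x t h) = ∅ := by
  ext y
  simp only [Set.mem_empty_iff_false, iff_false]
  rintro ⟨c, hcm, hcy⟩
  rw [((hc.append_mem_of_mem_right hJ hp ht).1 hcm).1] at hcy
  simp at hcy

theorem mem_decisionNodes_of_ne (hh : h ∈ G.hist) (hp : G.Proper i J h) (ht : t ∈ reported i h)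
    {j : N} (hj : j ≠ i) : coaMap i I J x t h ∈ decisionNodes (G.coaHist i I J x) j ↔
      h ∈ decisionNodes G.hist j := by
  rw [mem_decisionNodes_iff, mem_decisionNodes_iff, hc.available_of_ne hh hp ht hj]

theorem mem_decisionNodes_self (hh : h ∈ G.hist) (hp : G.Proper i J h) (ht : t ∈ reported i h) :
    coaMap i I J x t h ∈ decisionNodes (G.coaHist i I J x) i ↔
      h ∈ decisionNodes G.hist i ∧ h ∉ J := by
  rw [mem_decisionNodes_iff, mem_decisionNodes_iff]
  by_cases hJ : h ∈ J
  · simp [hc.available_self_of_mem_right hJ hp ht, hJ]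
  · by_cases hI : h ∈ I
    · rw [hc.available_self_of_mem_left hI ht]
      have hx := hc.available_left
      rw [G.availableAt_eq hc.left_mem hI] at hx
      obtain ⟨s, hs⟩ := x.2
      exact iff_of_true ⟨_, Or.inr ⟨s, hs, rfl⟩⟩ ⟨⟨x, hx⟩, hJ⟩
    · simp [hc.available_self_of_notMem hh hI hJ ht, hJ]

theorem mem_decisionNodes_of_mem (hh : h ∈ G.hist) (hp : G.Proper i J h) (ht : t ∈ reported i h)
    {j : N} (hj : coaMap i I J x t h ∈ decisionNodes (G.coaHist i I J x) j) :
    h ∈ decisionNodes G.hist j := by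
  by_cases hji : j = i
  · subst hji
    exact ((hc.mem_decisionNodes_self hh hp ht).1 hj).1
  · exact (hc.mem_decisionNodes_of_ne hh hp ht hji).1 hj

/-- In the new tree `i` no longer moves after having passed `x`, so her decision nodes are
unmodified histories. -/
theorem coaMap_eq_self_of_mem_decisionNodes (hh : h ∈ G.hist) (hp : G.Proper i J h)
    (ht : t ∈ reported i h)
    (hi : coaMap i I J x t h ∈ decisionNodes (G.coaHist i I J x) i) (s : Θ i) :
    coaMap i I J x s h = h := by
  obtain ⟨h1, h2⟩ := (hc.mem_decisionNodes_self hh hp ht).1 hi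
  exact hc.coaMap_of_not_passes (fun hpass => h2 ((hc.mem_iff h).2 ⟨h1, hpass⟩)) s

theorem decisions_coaMap_of_mem_decisionNodes (hh : h ∈ G.hist) (hp : G.Proper i J h)
    (ht : t ∈ reported i h) {j : N}
    (hj : coaMap i I J x t h ∈ decisionNodes (G.coaHist i I J x) j) :
    decisions j (coaMap i I J x t h) = decisions j h := by
  by_cases hji : j = i
  · subst hji
    rw [hc.coaMap_eq_self_of_mem_decisionNodes hh hp ht hj]
  · exact decisions_coaMap t hji h

/-- If `h` can be continued, somebody is active at its image: outside `J` whoever is active at `h`,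
and in `J` the other agent that properness provides. -/
theorem mem_terminals (hh : h ∈ G.hist) (hp : G.Proper i J h) (ht : t ∈ reported i h)
    (hz : coaMap i I J x t h ∈ terminals (G.coaHist i I J x)) : h ∈ terminals G.hist := by
  by_contra hcon
  obtain ⟨b, hb⟩ := G.exists_append_of_notMem_terminals hh hcon
  have : ∃ j, coaMap i I J x t h ∈ decisionNodes (G.coaHist i I J x) j := by
    by_cases hJ : h ∈ J
    · obtain ⟨b', hb', j, hj, hbj⟩ := hp hJ
      exact ⟨j, (hc.mem_decisionNodes_of_ne hh hp ht hj).2 ⟨b', hb', hbj⟩⟩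
    · obtain ⟨j, hj⟩ := G.exists_ne_none hb
      by_cases hji : j = i
      · subst hji
        exact ⟨j, (hc.mem_decisionNodes_self hh hp ht).2 ⟨⟨b, hb, hj⟩, hJ⟩⟩
      · exact ⟨j, (hc.mem_decisionNodes_of_ne hh hp ht hji).2 ⟨b, hb, hj⟩⟩
  obtain ⟨j, c, hcm, -⟩ := this
  exact append_notMem_of_terminal hz c hcm

end Available

end Coalescible

end GradualMechanism

end Coalescing

/-! ### The coalesced mechanism and its relation to COA -/

section Coalescence

universe u v w

variable {N : Type u} {Θ : N → Type v} {X : Type w} {f : (∀ i, Θ i) → X}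

namespace GradualMechanism

variable {G : GradualMechanism f} {i : N} {I J : Set (Hist (Report Θ))} {x : Report Θ i}

theorem mem_reported_after [∀ i, Nonempty (Θ i)] {l g : Hist (Report Θ)}
    {b : ActProfile (Report Θ)} {t : Θ i} (hb : b i = some (exactReport t))
    (hh : l ++ [b] ++ g ∈ G.hist) : t ∈ reported i (l ++ [b] ++ g) := by
  obtain ⟨s, hs⟩ := reported_nonempty i (l ++ [b] ++ g)
  have h1 := G.reported_anti hh (List.prefix_append _ _) hs
  rw [reported_append_some hb] at h1
  obtain rfl : s = t := h1
  exact hs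

/-- An information set strictly between `I` and `J` would contain a node after the choice of `x`,
but all such nodes belong to `J`. -/
theorem Coalescible.isImmediateSucc (hc : G.Coalescible i I J x) :
    G.IsImmediateSucc i I x J := by
  obtain ⟨l, hl⟩ := G.infoSets_nonempty i J hc.right_mem
  obtain ⟨k, hk, a, ha, hp⟩ := hc.passes_of_mem hl
  refine ⟨⟨l, hl, k, hk, (List.prefix_append _ _).trans hp, ?_⟩, ?_, k, hk, a, ha, l, hl, hp⟩
  · rintro rfl
    exact not_snoc_prefix_self _ _ hp
  · rintro ⟨K, hK, ⟨h1, hh1, k1, hk1, hp1, hne1⟩, ⟨h2, hh2, k2, hk2, hp2, hne2⟩⟩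
    obtain ⟨k3, hk3, a3, ha3, hp3⟩ := hc.passes_of_mem hh2
    have hk2n := G.mem_decisionNodes_of_mem hK hk2
    have hh2m := G.mem_hist_of_mem hc.right_mem hh2
    have hlt := G.decisions_length_lt (G.mem_decisionNodes_of_mem hc.left_mem hk1)
      (G.mem_hist_of_mem hK hh1) hp1 hne1
    rw [G.decisions_eq hc.left_mem hk1 hk3, G.decisions_eq hK hh1 hk2] at hlt
    -- Nodes of `K` have more decisions than nodes of `I`, so on the way to `h2` the node `k3` of
    -- `I` comes before `k2`. Thus `k2` passes `x` and lies in `J`.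
    have hpre := G.prefix_of_decisions_length_le hk2n hh2m hp2
      ((List.prefix_append _ _).trans hp3) hlt.le
    obtain ⟨a4, ha4⟩ := exists_snoc_prefix hpre (by rintro rfl; exact lt_irrefl _ hlt)
    obtain rfl := snoc_prefix_unique hp3 (ha4.trans hp2)
    have hk2J := (hc.mem_iff k2).2 ⟨hk2n, k3, hk3, a3, ha3, ha4⟩
    exact hne2 (G.eq_of_mem_of_prefix hc.right_mem hk2J hh2 hp2)

theorem Coalescible.proper_nil (hc : G.Coalescible i I J x) : G.Proper i J [] :=
  fun h => absurd (hc.passes_of_mem h) not_passes_nil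

variable [DecidableEq N]

theorem coaHist_mem_of_append (h : Hist (Report Θ)) (a : ActProfile (Report Θ))
    (ha : h ++ [a] ∈ G.coaHist i I J x) : h ∈ G.coaHist i I J x := by
  obtain ⟨k, hk, s, hs, heq⟩ := ha
  obtain ⟨l, b, hlb, rfl, -⟩ := exists_of_expand_eq_append (coaStep_length_le s) heq.symm
  have hb := G.mem_of_prefix hk hlb
  exact ⟨l, G.mem_of_append _ _ hb, s,
    G.reported_append_subset hb (G.reported_anti hk hlb hs), rfl⟩

theorem coaHist_bounded : ∃ T : ℕ, ∀ h ∈ G.coaHist i I J x, h.length ≤ T := by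
  obtain ⟨T, hT⟩ := G.bounded
  refine ⟨T, ?_⟩
  rintro _ ⟨h, hh, t, -, rfl⟩
  exact (length_expand_le (coaStep_length_le t) h).trans (hT h hh)

theorem isSource_unique {h' h k : Hist (Report Θ)} (h1 : G.IsSource i I J x h' h)
    (h2 : G.IsSource i I J x h' k) : h = k :=
  (h2.2 h h1.1).eq_of_length_le (h1.2 k h2.1).length_le

theorem mem_coaHist_of_decisionNodes {j : N} {h' : Hist (Report Θ)}
    (hh' : h' ∈ decisionNodes (G.coaHist i I J x) j) : h' ∈ G.coaHist i I J x := by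
  obtain ⟨a, ha, -⟩ := hh'
  exact coaHist_mem_of_append _ _ ha

/-- A profile of the others that is possible at `I` survives to `J` because every complete play
choosing `x` at `I` reaches `J`; conversely, reports only shrink. -/
theorem Coalescible.acquired_eq (hc : G.Coalescible i I J x) : acquired i I = acquired i J := by
  ext θ
  constructor
  · rintro ⟨h, hh, hθ⟩
    have hx := hc.available_left
    rw [G.availableAt_eq hc.left_mem hh] at hx
    obtain ⟨t, ht⟩ := x.2
    have hm := G.mem_hist_of_mem hc.left_mem hh
    -- Agent `i` is given a type `t` in `x`, so that truthful play of `θ'` from `h` chooses `x` at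
    -- `I`.
    let θ' : ∀ j, Θ j := fun j => if hj : j = i then hj ▸ t else θ ⟨j, hj⟩
    have hθi : θ' i = t := by simp [θ']
    have hθj : ∀ j : {j // j ≠ i}, θ' j.1 = θ j := fun j => by simp [θ', j.2]
    have h1 : θ' ∈ reportedProfiles h := by
      intro j
      by_cases hj : j = i
      · subst hj; rw [hθi]; exact G.subset_reported hx ht
      · rw [hθj ⟨j, hj⟩]; exact hθ ⟨j, hj⟩
    obtain ⟨b, hb, -⟩ := id hx
    obtain ⟨a, ha, h2⟩ := G.exists_append_mem hm (G.notMem_terminals_of_append hb) h1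
    obtain ⟨y, hy⟩ := Option.ne_none_iff_exists'.1
      (G.ne_none_of_mem_decisionNodes (G.mem_decisionNodes_of_mem hc.left_mem hh) ha)
    have h3 := h2 i
    rw [reported_append_some hy, hθi] at h3
    obtain rfl := G.available_eq_of_mem ⟨a, ha, hy⟩ hx h3 ht
    obtain ⟨z, hz, hpz, hzθ⟩ := G.exists_terminal ha h2
    obtain ⟨l, hl, hlz⟩ := hc.reaches z hz ⟨h, hh, a, hy, hpz⟩
    refine ⟨l, hl, fun j => ?_⟩
    rw [← hθj j]
    exact G.reported_anti hz.1 hlz (hzθ j)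
  · rintro ⟨l, hl, hθ⟩
    obtain ⟨k, hk, a, ha, hp⟩ := hc.passes_of_mem hl
    exact ⟨k, hk, fun j => G.reported_anti (G.mem_hist_of_mem hc.right_mem hl)
      ((List.prefix_append _ _).trans hp) (hθ j)⟩

namespace Coalescible

variable (hc : G.Coalescible i I J x)
include hc

theorem coaMap_before {k g : Hist (Report Θ)} {a : ActProfile (Report Θ)} (hk : k ∈ I)
    (ha : a i = some x) (hJ : ¬ SetLT J (k ++ [a] ++ g)) (t : Θ i) :
    coaMap i I J x t (k ++ [a] ++ g) =
      k ++ [Function.update a i (some (exactReport t))] ++ g := by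
  have h1 : coaMap i I J x t (k ++ [a]) =
      k ++ [Function.update a i (some (exactReport t))] := by
    rw [coaMap_snoc, hc.coaMap_of_not_passes (hc.not_passes_of_mem hk), coaStep_of_eq t hk ha]
  rw [← h1]
  refine expand_append_of_forall fun q c hq => ?_
  have hp : Passes i I x (k ++ [a] ++ q) := ⟨k, hk, a, ha, List.prefix_append _ _⟩
  refine coaStep_of_notMem t (hc.notMem_of_passes hp) (fun hJ' => hJ ⟨_, hJ', ?_, ?_⟩) c
  · exact (List.prefix_append_right_inj _).2 ((List.prefix_append _ _).trans hq)
  · intro heq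
    obtain rfl := List.append_cancel_left heq
    exact not_snoc_prefix_self _ _ hq

theorem coaMap_after {k g g' : Hist (Report Θ)} {a b : ActProfile (Report Θ)} (hk : k ∈ I)
    (ha : a i = some x) (hJ : k ++ [a] ++ g ∈ J) (t : Θ i) :
    coaMap i I J x t (k ++ [a] ++ g ++ [b] ++ g') =
      k ++ [Function.update a i (some (exactReport t))] ++ g ++
        coaStep i I J x t (k ++ [a] ++ g) b ++ g' := by
  rw [← hc.coaMap_before hk ha (hc.not_setLT_of_mem hJ), ← coaMap_snoc]
  refine expand_append_of_forall fun q c hq => ?_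
  have hp : k ++ [a] ++ g <+: k ++ [a] ++ g ++ [b] ++ q :=
    (List.prefix_append _ _).trans (List.prefix_append _ _)
  refine coaStep_of_notMem t (hc.notMem_of_passes ((hc.passes_of_mem hJ).mono hp))
    (fun hJ' => ?_) c
  have := (G.eq_of_mem_of_prefix hc.right_mem hJ hJ' hp)
  have h2 := congrArg List.length this
  simp only [List.length_append, List.length_singleton] at h2
  omega

/-- The clauses of COA match `coaMap` because the actions at `J` are the singletons from `x`: the
action `y` in a clause is the report of `t`. After `J` the type is determined by `h`, between `I`
and `J` it ranges over `x`, and elsewhere it is immaterial. -/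
theorem coalesced_iff [∀ i, Nonempty (Θ i)] {h h' : Hist (Report Θ)} :
    G.Coalesced i I J x h h' ↔
      h ∈ G.hist ∧ ∃ t ∈ reported i h, h' = coaMap i I J x t h := by
  constructor
  · rintro (⟨_, hh, hx⟩ | ⟨k, a, g, hk, ha, hh, hJ, y, hy⟩ |
      ⟨k, a, g, b, g', y, hk, ha, hJ, hb, hh, hoth⟩ |
      ⟨k, a, g, b, g', y, hk, ha, hJ, hb, hh, hoth⟩)
    · obtain ⟨t, ht⟩ := reported_nonempty i h
      exact ⟨hh, t, ht, (hc.coaMap_of_not_passes hx t).symm⟩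
    · obtain ⟨l, hl⟩ := G.infoSets_nonempty i J hc.right_mem
      rw [G.availableAt_eq hc.right_mem hl] at hy
      obtain ⟨t, ht, rfl⟩ := (hc.available_right l hl y).1 hy
      refine ⟨hh, t, ?_, (hc.coaMap_before hk ha hJ t).symm⟩
      rw [hc.reported_eq hh ⟨k, hk, a, ha, List.prefix_append _ _⟩ hJ]
      exact ht
    · obtain ⟨t, ht, rfl⟩ := (hc.available_right _ hJ y).1
        ⟨b, G.mem_of_prefix hh (List.prefix_append _ _), hb⟩
      refine ⟨hh, t, mem_reported_after hb hh, ?_⟩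
      rw [hc.coaMap_after hk ha hJ, coaStep_of_mem t (hc.notMem_left hJ) hJ hoth]
    · obtain ⟨t, ht, rfl⟩ := (hc.available_right _ hJ y).1
        ⟨b, G.mem_of_prefix hh (List.prefix_append _ _), hb⟩
      refine ⟨hh, t, mem_reported_after hb hh, ?_⟩
      rw [hc.coaMap_after hk ha hJ, coaStep_of_mem_alone t (hc.notMem_left hJ) hJ hoth,
        List.append_nil]
  · rintro ⟨hh, t, ht, rfl⟩
    by_cases hp : Passes i I x h
    · obtain ⟨k, hk, a, ha, hka⟩ := id hp
      by_cases hJ : SetLT J h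
      · obtain ⟨l, hl, hlh, hne⟩ := hJ
        obtain ⟨k', hk', a', ha', hkl⟩ := hc.passes_of_mem hl
        obtain ⟨g, rfl⟩ := hkl
        obtain ⟨b, g', rfl⟩ := exists_snoc_prefix hlh hne
        have hb := hc.apply_eq_of_mem hl (List.prefix_append _ _) hh ht
        rw [hc.coaMap_after hk' ha' hl]
        by_cases hoth : ∀ j, j ≠ i → b j = none
        · rw [coaStep_of_mem_alone t (hc.notMem_left hl) hl hoth, List.append_nil]
          exact .afterAlone k' a' g b g' _ hk' ha' hl hb hh hoth
        · push Not at hoth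
          rw [coaStep_of_mem t (hc.notMem_left hl) hl hoth]
          exact .after k' a' g b g' _ hk' ha' hl hb hh hoth
      · obtain ⟨g, rfl⟩ := hka
        rw [hc.coaMap_before hk ha hJ]
        obtain ⟨l, hl⟩ := G.infoSets_nonempty i J hc.right_mem
        refine .before k a g hk ha hh hJ _ ?_
        rw [G.availableAt_eq hc.right_mem hl]
        rw [hc.reported_eq hh hp hJ] at ht
        exact (hc.available_right l hl _).2 ⟨t, ht, rfl⟩
    · rw [hc.coaMap_of_not_passes hp]
      exact .outside h hh hp

/-- Being the longest preimage amounts to being proper: an improper one can be lengthened without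
changing the image, and a proper one contains every other preimage as a prefix. -/
theorem isSource_iff [∀ i, Nonempty (Θ i)] {h h' : Hist (Report Θ)} :
    G.IsSource i I J x h' h ↔
      h ∈ G.hist ∧ G.Proper i J h ∧ ∃ t ∈ reported i h, h' = coaMap i I J x t h := by
  constructor
  · rintro ⟨h1, h2⟩
    obtain ⟨hh, t, ht, rfl⟩ := hc.coalesced_iff.1 h1
    refine ⟨hh, ?_, t, ht, rfl⟩
    by_contra hp
    obtain ⟨b, hb, -, hbt, heq⟩ := hc.exists_proper hh ht hp
    exact not_snoc_prefix_self _ _ (h2 _ (hc.coalesced_iff.2 ⟨hb, t, hbt, heq.symm⟩))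
  · rintro ⟨hh, hp, t, ht, rfl⟩
    refine ⟨hc.coalesced_iff.2 ⟨hh, t, ht, rfl⟩, fun k hk => ?_⟩
    obtain ⟨hkm, s, hs, heq⟩ := hc.coalesced_iff.1 hk
    exact hc.prefix_of_coaMap_eq hkm hh hs ht heq.symm hp

end Coalescible

/-- The information sets of the coalesced mechanism. -/
def coaSets (G : GradualMechanism f) (i : N) (I J : Set (Hist (Report Θ))) (x : Report Θ i)
    (j : N) : Set (Set (Hist (Report Θ))) :=
  {K' | K'.Nonempty ∧ ∃ K ∈ G.infoSets j,
    K' = {h' | h' ∈ decisionNodes (G.coaHist i I J x) j ∧ ∃ h ∈ K, G.IsSource i I J x h' h}}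

theorem coaSets_disjoint (j : N) : (G.coaSets i I J x j).PairwiseDisjoint id := by
  rintro _ ⟨-, K, hK, rfl⟩ _ ⟨-, L, hL, rfl⟩ hne
  refine Set.disjoint_left.2 ?_
  rintro h' ⟨-, h, hh, hs⟩ ⟨-, k, hk, hs'⟩
  obtain rfl := isSource_unique hs hs'
  obtain rfl := G.infoSet_unique hK hL hh hk
  exact hne rfl

namespace Coalescible

variable [∀ i, Nonempty (Θ i)] (hc : G.Coalescible i I J x)
include hc

theorem coaHist_eq_none (h : Hist (Report Θ)) (a b : ActProfile (Report Θ))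
    (ha : h ++ [a] ∈ G.coaHist i I J x) (hb : h ++ [b] ∈ G.coaHist i I J x) (j : N)
    (hj : a j = none) : b j = none := by
  obtain ⟨h, hh, hp, t, ht, rfl⟩ := hc.exists_proper_of_mem (coaHist_mem_of_append h a ha)
  by_cases hI : h ∈ I
  · have key : ∀ c, coaMap i I J x t h ++ [c] ∈ G.coaHist i I J x →
        ∃ c', h ++ [c'] ∈ G.hist ∧ (c' j = none ↔ c j = none) := by
      intro c hcm
      rcases (hc.append_mem_of_mem_left hI ht).1 hcm with ⟨h1, -⟩ | ⟨s, -, h2, h1⟩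
      · exact ⟨c, h1, Iff.rfl⟩
      · refine ⟨_, h1, ?_⟩
        by_cases hji : j = i
        · subst hji; simp [h2]
        · simp [hji]
    obtain ⟨a', ha', h1⟩ := key a ha
    obtain ⟨b', hb', h2⟩ := key b hb
    exact h2.1 (G.eq_none_of_eq_none ha' hb' (h1.2 hj))
  · by_cases hJ : h ∈ J
    · obtain ⟨h1, h2⟩ := (hc.append_mem_of_mem_right hJ hp ht).1 ha
      obtain ⟨h3, h4⟩ := (hc.append_mem_of_mem_right hJ hp ht).1 hb
      by_cases hji : j = i
      · subst hji; exact h3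
      · have := G.eq_none_of_eq_none h2 h4 (i := j) (by simpa [hji] using hj)
        simpa [hji] using this
    · exact G.eq_none_of_eq_none ((hc.append_mem_of_notMem hh hI hJ ht).1 ha)
        ((hc.append_mem_of_notMem hh hI hJ ht).1 hb) hj

theorem coaHist_ne_none (h : Hist (Report Θ)) (a : ActProfile (Report Θ))
    (ha : h ++ [a] ∈ G.coaHist i I J x) : ∃ j, a j ≠ none := by
  obtain ⟨h, hh, hp, t, ht, rfl⟩ := hc.exists_proper_of_mem (coaHist_mem_of_append h a ha)
  by_cases hI : h ∈ I
  · rcases (hc.append_mem_of_mem_left hI ht).1 ha with ⟨h1, -⟩ | ⟨s, -, h2, -⟩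
    · exact G.exists_ne_none h1
    · exact ⟨i, by simp [h2]⟩
  · by_cases hJ : h ∈ J
    · obtain ⟨-, h2⟩ := (hc.append_mem_of_mem_right hJ hp ht).1 ha
      obtain ⟨b, hb, j, hj, hbj⟩ := hp hJ
      exact ⟨j, by simpa [hj] using G.ne_none_of_mem_decisionNodes ⟨b, hb, hbj⟩ h2⟩
    · exact G.exists_ne_none ((hc.append_mem_of_notMem hh hI hJ ht).1 ha)

theorem coaHist_prod_mem (h : Hist (Report Θ)) (a b : ActProfile (Report Θ))
    (ha : h ++ [a] ∈ G.coaHist i I J x)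
    (hb : ∀ j, ∃ c : ActProfile (Report Θ), h ++ [c] ∈ G.coaHist i I J x ∧ c j = b j) :
    h ++ [b] ∈ G.coaHist i I J x := by
  obtain ⟨h, hh, hp, t, ht, rfl⟩ := hc.exists_proper_of_mem (coaHist_mem_of_append h a ha)
  by_cases hI : h ∈ I
  · have key : ∀ j, j ≠ i → ∃ c', h ++ [c'] ∈ G.hist ∧ c' j = b j := by
      intro j hj
      obtain ⟨c, hcm, hcj⟩ := hb j
      rcases (hc.append_mem_of_mem_left hI ht).1 hcm with ⟨h1, -⟩ | ⟨s, -, h2, h1⟩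
      · exact ⟨c, h1, hcj⟩
      · exact ⟨_, h1, by simpa [hj] using hcj⟩
    refine (hc.append_mem_of_mem_left hI ht).2 ?_
    obtain ⟨c, hcm, hci⟩ := hb i
    rcases (hc.append_mem_of_mem_left hI ht).1 hcm with ⟨h1, h2⟩ | ⟨s, hs, h2, h1⟩
    · refine Or.inl ⟨G.append_mem_of_forall h1 fun j => ?_, hci ▸ h2⟩
      by_cases hj : j = i
      · subst hj; exact ⟨c, h1, hci⟩
      · exact key j hj
    · refine Or.inr ⟨s, hs, hci ▸ h2, G.append_mem_of_forall h1 fun j => ?_⟩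
      by_cases hj : j = i
      · subst hj; exact ⟨_, h1, by simp⟩
      · simpa [hj] using key j hj
  · by_cases hJ : h ∈ J
    · refine (hc.append_mem_of_mem_right hJ hp ht).2 ⟨?_, ?_⟩
      · obtain ⟨c, hcm, hci⟩ := hb i
        rw [← hci]
        exact ((hc.append_mem_of_mem_right hJ hp ht).1 hcm).1
      · refine G.append_mem_of_forall ((hc.append_mem_of_mem_right hJ hp ht).1 ha).2 fun j => ?_
        obtain ⟨c, hcm, hcj⟩ := hb j
        refine ⟨_, ((hc.append_mem_of_mem_right hJ hp ht).1 hcm).2, ?_⟩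
        by_cases hj : j = i
        · subst hj; simp
        · simpa [hj] using hcj
    · simp only [hc.append_mem_of_notMem hh hI hJ ht] at ha hb ⊢
      exact G.append_mem_of_forall ha hb

theorem coaHist_root (j : N) : [] ∈ decisionNodes (G.coaHist i I J x) j := by
  obtain ⟨t, ht⟩ := reported_nonempty i ([] : Hist (Report Θ))
  rw [← coaMap_nil (I := I) (J := J) (x := x) t]
  by_cases hj : j = i
  · subst hj
    exact (hc.mem_decisionNodes_self G.nil_mem hc.proper_nil ht).2
      ⟨G.root_active j, fun h => not_passes_nil (hc.passes_of_mem h)⟩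
  · exact (hc.mem_decisionNodes_of_ne G.nil_mem hc.proper_nil ht hj).2 (G.root_active j)

theorem exists_coaSets {j : N} {h : Hist (Report Θ)} (hh : h ∈ G.hist) (hp : G.Proper i J h)
    {t : Θ i} (ht : t ∈ reported i h)
    (hj : coaMap i I J x t h ∈ decisionNodes (G.coaHist i I J x) j) {K : Set (Hist (Report Θ))}
    (hK : K ∈ G.infoSets j) (hhK : h ∈ K) :
    {h' | h' ∈ decisionNodes (G.coaHist i I J x) j ∧ ∃ h ∈ K, G.IsSource i I J x h' h} ∈
        G.coaSets i I J x j ∧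
      coaMap i I J x t h ∈
        {h' | h' ∈ decisionNodes (G.coaHist i I J x) j ∧ ∃ h ∈ K, G.IsSource i I J x h' h} := by
  have : coaMap i I J x t h ∈
      {h' | h' ∈ decisionNodes (G.coaHist i I J x) j ∧ ∃ h ∈ K, G.IsSource i I J x h' h} :=
    ⟨hj, h, hhK, hc.isSource_iff.2 ⟨hh, hp, t, ht, rfl⟩⟩
  exact ⟨⟨⟨_, this⟩, K, hK, rfl⟩, this⟩

theorem coaSets_cover (j : N) :
    ⋃₀ G.coaSets i I J x j = decisionNodes (G.coaHist i I J x) j := by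
  ext h'
  constructor
  · rintro ⟨_, ⟨-, K, -, rfl⟩, h1, -⟩
    exact h1
  · intro hh'
    obtain ⟨h, hh, hp, t, ht, rfl⟩ :=
      hc.exists_proper_of_mem (mem_coaHist_of_decisionNodes hh')
    obtain ⟨K, hK, hhK⟩ := G.exists_infoSet (hc.mem_decisionNodes_of_mem hh hp ht hh')
    obtain ⟨h1, h2⟩ := hc.exists_coaSets hh hp ht hh' hK hhK
    exact ⟨_, h1, h2⟩

theorem coaSets_available_eq (j : N) (K' : Set (Hist (Report Θ)))
    (hK' : K' ∈ G.coaSets i I J x j) (h' : Hist (Report Θ)) (hh' : h' ∈ K')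
    (k' : Hist (Report Θ)) (hk' : k' ∈ K') :
    available (G.coaHist i I J x) j h' = available (G.coaHist i I J x) j k' := by
  obtain ⟨-, K, hK, rfl⟩ := hK'
  obtain ⟨hhn, h, hhK, hs⟩ := hh'
  obtain ⟨hkn, k, hkK, hs'⟩ := hk'
  obtain ⟨hh, hp, t, ht, rfl⟩ := hc.isSource_iff.1 hs
  obtain ⟨hk, hp', t', ht', rfl⟩ := hc.isSource_iff.1 hs'
  have heq := G.available_eq j K hK h hhK k hkK
  by_cases hj : j = i
  · subst hj
    by_cases hKI : K = I
    · subst hKI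
      rw [hc.available_self_of_mem_left hhK ht, hc.available_self_of_mem_left hkK ht', heq]
    · have hI : ∀ l ∈ K, l ∉ I := fun l h1 h2 => hKI (G.infoSet_unique hK hc.left_mem h1 h2)
      rw [hc.available_self_of_notMem hh (hI h hhK)
          ((hc.mem_decisionNodes_self hh hp ht).1 hhn).2 ht,
        hc.available_self_of_notMem hk (hI k hkK)
          ((hc.mem_decisionNodes_self hk hp' ht').1 hkn).2 ht', heq]
  · rw [hc.available_of_ne hh hp ht hj, hc.available_of_ne hk hp' ht' hj, heq]

/-- Decision nodes of the new tree are pulled back to their sources, where perfect recall of `G`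
applies, and the resulting node is mapped forward again. -/
theorem coaSets_perfect_recall (j : N) (K' : Set (Hist (Report Θ)))
    (hK' : K' ∈ G.coaSets i I J x j) (h' : Hist (Report Θ)) (hh' : h' ∈ K')
    (k' : Hist (Report Θ)) (hk' : k' ∈ K') :
    decisions j h' = decisions j k' ∧
      ∀ l' ∈ decisionNodes (G.coaHist i I J x) j, l' <+: h' →
        ∃ m', m' <+: k' ∧ ∃ L ∈ G.coaSets i I J x j, l' ∈ L ∧ m' ∈ L := by
  obtain ⟨-, K, hK, rfl⟩ := hK'
  obtain ⟨hhn, h, hhK, hs⟩ := hh'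
  obtain ⟨hkn, k, hkK, hs'⟩ := hk'
  obtain ⟨hh, hp, t, ht, rfl⟩ := hc.isSource_iff.1 hs
  obtain ⟨hk, hp', t', ht', rfl⟩ := hc.isSource_iff.1 hs'
  refine ⟨?_, ?_⟩
  · rw [hc.decisions_coaMap_of_mem_decisionNodes hh hp ht hhn,
      hc.decisions_coaMap_of_mem_decisionNodes hk hp' ht' hkn, G.decisions_eq hK hhK hkK]
  · intro l' hl' hpre
    obtain ⟨l, hlh, rfl, hl2⟩ := exists_of_prefix_expand (coaStep_length_le t) hpre
    have hl := G.mem_of_prefix hh hlh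
    have hlt := G.reported_anti hh hlh ht
    have hlp : G.Proper i J l := by
      rcases hl2 with rfl | ⟨b, c, hb, hbc⟩
      · exact hp
      · exact hc.proper_of_coaStep_ne_nil (t := t) (G.mem_of_prefix hh hb) (by rw [hbc]; simp)
    have hln := hc.mem_decisionNodes_of_mem hl hlp hlt hl'
    obtain ⟨m, hmk, L, hL, hlL, hmL⟩ := (G.perfect_recall j K hK h hhK k hkK).2 l hln hlh
    have hm := G.mem_hist_of_mem hL hmL
    have hmt := G.reported_anti hk hmk ht'
    have hmn := G.mem_decisionNodes_of_mem hL hmL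
    -- The node `m` must still be a decision node after coalescing. For `i` it avoids `J` because
    -- `l`, in the same information set, does; for another agent `j`, her own activity at `m` makes
    -- `m` proper.
    have hmp : G.Proper i J m ∧
        coaMap i I J x t' m ∈ decisionNodes (G.coaHist i I J x) j := by
      by_cases hj : j = i
      · subst hj
        have hmJ : m ∉ J := by
          intro hmJ
          obtain rfl := G.infoSet_unique hc.right_mem hL hmJ hmL
          exact ((hc.mem_decisionNodes_self hl hlp hlt).1 hl').2 hlL
        have hmp : G.Proper j J m := fun h => absurd h hmJ
        exact ⟨hmp, (hc.mem_decisionNodes_self hm hmp hmt).2 ⟨hmn, hmJ⟩⟩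
      · obtain ⟨b, hb, hbj⟩ := id hmn
        have hmp : G.Proper i J m := fun _ => ⟨b, hb, j, hj, hbj⟩
        exact ⟨hmp, (hc.mem_decisionNodes_of_ne hm hmp hmt hj).2 hmn⟩
    obtain ⟨h1, h2⟩ := hc.exists_coaSets hl hlp hlt hl' hL hlL
    obtain ⟨-, h3⟩ := hc.exists_coaSets hm hmp.1 hmt hmp.2 hL hmL
    exact ⟨_, coaMap_prefix t' hmk, _, h1, h2, h3⟩

theorem coaHist_actions_disjoint (j : N) (h' : Hist (Report Θ))
    (hh' : h' ∈ decisionNodes (G.coaHist i I J x) j) (y : Report Θ j)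
    (hy : y ∈ available (G.coaHist i I J x) j h') (y' : Report Θ j)
    (hy' : y' ∈ available (G.coaHist i I J x) j h') (hne : y ≠ y') : Disjoint y.1 y'.1 := by
  obtain ⟨h, hh, hp, t, ht, rfl⟩ :=
    hc.exists_proper_of_mem (mem_coaHist_of_decisionNodes hh')
  have hn := hc.mem_decisionNodes_of_mem hh hp ht hh'
  by_cases hj : j = i
  · subst hj
    by_cases hI : h ∈ I
    · have hx := hc.available_left
      rw [G.availableAt_eq hc.left_mem hI] at hx
      -- An exact type replacing `x` lies inside `x`, which is disjoint from the other actions at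
      -- `I`.
      have key : ∀ z ∈ available G.hist j h, z ≠ x → ∀ s ∈ x.1,
          Disjoint z.1 (exactReport s).1 := by
        intro z hz hzx s hs
        exact (G.actions_disjoint j h hn z hz x hx hzx).mono_right
          (Set.singleton_subset_iff.2 hs)
      rw [hc.available_self_of_mem_left hI ht] at hy hy'
      rcases hy with ⟨h1, h2⟩ | ⟨s, hs, rfl⟩ <;> rcases hy' with ⟨h3, h4⟩ | ⟨s', hs', rfl⟩
      · exact G.actions_disjoint j h hn y h1 y' h3 hne
      · exact key y h1 h2 s' hs'
      · exact (key y' h3 h4 s hs).symm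
      · refine Set.disjoint_singleton.2 ?_
        rintro rfl
        exact hne rfl
    · rw [hc.available_self_of_notMem hh hI ((hc.mem_decisionNodes_self hh hp ht).1 hh').2 ht]
        at hy hy'
      exact G.actions_disjoint j h hn y hy y' hy' hne
  · rw [hc.available_of_ne hh hp ht hj] at hy hy'
    exact G.actions_disjoint j h hn y hy y' hy' hne

theorem coaHist_actions_cover (j : N) (h' : Hist (Report Θ))
    (hh' : h' ∈ decisionNodes (G.coaHist i I J x) j) :
    ⋃ y ∈ available (G.coaHist i I J x) j h', y.1 = reported j h' := by
  obtain ⟨h, hh, hp, t, ht, rfl⟩ :=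
    hc.exists_proper_of_mem (mem_coaHist_of_decisionNodes hh')
  have hn := hc.mem_decisionNodes_of_mem hh hp ht hh'
  rw [reported_of_decisions_eq (hc.decisions_coaMap_of_mem_decisionNodes hh hp ht hh'),
    ← G.actions_cover j h hn]
  by_cases hj : j = i
  · subst hj
    by_cases hI : h ∈ I
    · have hx := hc.available_left
      rw [G.availableAt_eq hc.left_mem hI] at hx
      rw [hc.available_self_of_mem_left hI ht]
      ext s
      simp only [Set.mem_iUnion, exists_prop]
      constructor
      · rintro ⟨y, ⟨h1, -⟩ | ⟨r, hr, rfl⟩, hs⟩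
        · exact ⟨y, h1, hs⟩
        · obtain rfl : s = r := hs
          exact ⟨x, hx, hr⟩
      -- Replacing `x` by the singletons of its elements leaves the union unchanged.
      · rintro ⟨y, hy, hs⟩
        by_cases hyx : y = x
        · subst hyx
          exact ⟨exactReport s, Or.inr ⟨s, hs, rfl⟩, Set.mem_singleton s⟩
        · exact ⟨y, Or.inl ⟨hy, hyx⟩, hs⟩
    · rw [hc.available_self_of_notMem hh hI ((hc.mem_decisionNodes_self hh hp ht).1 hh').2 ht]
  · rw [hc.available_of_ne hh hp ht hj]

theorem exists_isSource_of_terminal {z' : Hist (Report Θ)}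
    (hz' : z' ∈ terminals (G.coaHist i I J x)) :
    ∃ z ∈ terminals G.hist, G.IsSource i I J x z' z ∧
      ∀ j, reported j z' ⊆ reported j z := by
  obtain ⟨h, hh, hp, t, ht, rfl⟩ := hc.exists_proper_of_mem hz'.1
  exact ⟨h, hc.mem_terminals hh hp ht hz', hc.isSource_iff.2 ⟨hh, hp, t, ht, rfl⟩,
    hc.reported_coaMap_subset hh ht⟩

end Coalescible

section Construction

variable [∀ i, Nonempty (Θ i)]

/-- The mechanism after moving the actions at `J` forward to `I`. -/
noncomputable def coalesce (hc : G.Coalescible i I J x) : GradualMechanism f :=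
  ofTree f (G.coaHist i I J x)
    ⟨[], G.nil_mem, _, (reported_nonempty i []).some_mem, rfl⟩
    coaHist_mem_of_append coaHist_bounded hc.coaHist_eq_none hc.coaHist_ne_none
    hc.coaHist_prod_mem hc.coaHist_root (G.coaSets i I J x) (fun _ _ h => h.1)
    coaSets_disjoint hc.coaSets_cover hc.coaSets_available_eq hc.coaSets_perfect_recall
    hc.coaHist_actions_disjoint hc.coaHist_actions_cover
    (by
      intro z' hz' θ hθ θ' hθ'
      obtain ⟨z, hz, -, hsub⟩ := hc.exists_isSource_of_terminal hz'
      exact G.const_of_terminal hz (fun j => hsub j (hθ j)) (fun j => hsub j (hθ' j)))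

/-- Every agent's exact type is revealed when the game ends. -/
def RevealsTypes (G : GradualMechanism f) : Prop :=
  ∀ z ∈ terminals G.hist, ∀ i, (reported i z).Subsingleton

variable (hc : G.Coalescible i I J x)

theorem coalesces_coalesce : G.Coalesces (coalesce hc) := by
  refine ⟨i, I, hc.left_mem, J, hc.right_mem, x, hc.available_left, hc.isImmediateSucc,
    hc.acquired_eq, ?_, fun j => rfl, ?_⟩
  · ext h'
    constructor
    · rintro ⟨h, hh, t, ht, rfl⟩
      exact ⟨h, hc.coalesced_iff.2 ⟨hh, t, ht, rfl⟩⟩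
    · rintro ⟨h, hh⟩
      obtain ⟨h1, t, ht, rfl⟩ := hc.coalesced_iff.1 hh
      exact ⟨h, h1, t, ht, rfl⟩
  · intro z'
    obtain ⟨z, hz, hs, hsub⟩ := hc.exists_isSource_of_terminal z'.2
    refine ⟨⟨z, hz⟩, hs, ?_⟩
    obtain ⟨θ, hθ⟩ := reportedProfiles_nonempty z'.1
    rw [(coalesce hc).outcome_eq z' θ hθ, G.outcome_eq ⟨z, hz⟩ θ fun j => hsub j (hθ j)]

/-- An agent who is active at an image has made the same decisions there as at its source, so the
condition is inherited. -/
theorem stopsWhenRevealed_coalesce (hG : G.StopsWhenRevealed) :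
    (coalesce hc).StopsWhenRevealed := by
  intro j h' hh' hne
  obtain ⟨h, hh, hp, t, ht, rfl⟩ :=
    hc.exists_proper_of_mem (mem_coaHist_of_decisionNodes hh')
  rw [reported_of_decisions_eq (hc.decisions_coaMap_of_mem_decisionNodes hh hp ht hh')]
  refine hG j h (hc.mem_decisionNodes_of_mem hh hp ht hh') ?_
  rintro rfl
  exact hne rfl

theorem revealsTypes_coalesce (hG : G.RevealsTypes) : (coalesce hc).RevealsTypes := by
  intro z' hz' j
  obtain ⟨z, hz, -, hsub⟩ := hc.exists_isSource_of_terminal hz'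
  exact (hG z hz j).anti (hsub j)

/-- Each new information set arises from an old one of the same agent. `J` contributes none for `i`,
since she is inactive at the images of proper nodes of `J`. -/
theorem infoCount_coalesce_lt [Finite N] [∀ i, Finite (Θ i)] :
    (coalesce hc).infoCount < G.infoCount := by
  have himg : ∀ j, ∀ S : Set (Set (Hist (Report Θ))), S ⊆ G.infoSets j →
      (∀ K' ∈ G.coaSets i I J x j, ∃ K ∈ S, K' = {h' |
        h' ∈ decisionNodes (G.coaHist i I J x) j ∧ ∃ h ∈ K, G.IsSource i I J x h' h}) →
      ((coalesce hc).infoSets j).ncard ≤ S.ncard := by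
    intro j S hS hex
    have hfin := (G.finite_infoSets j).subset hS
    refine (Set.ncard_le_ncard ?_ (hfin.image fun K => {h' |
      h' ∈ decisionNodes (G.coaHist i I J x) j ∧ ∃ h ∈ K, G.IsSource i I J x h' h})).trans
      (Set.ncard_image_le hfin)
    intro K' hK'
    obtain ⟨K, hK, rfl⟩ := hex K' hK'
    exact ⟨K, hK, rfl⟩
  refine infoCount_lt_of_le_of_lt (i := i) (fun j => himg j _ subset_rfl ?_) ?_
  · rintro K' ⟨-, K, hK, rfl⟩
    exact ⟨K, hK, rfl⟩
  · refine (himg i (G.infoSets i \ {J}) Set.sdiff_subset ?_).trans_lt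
      (Set.ncard_sdiff_singleton_lt_of_mem hc.right_mem (G.finite_infoSets i))
    rintro K' ⟨⟨h', hh'⟩, K, hK, rfl⟩
    refine ⟨K, ⟨hK, ?_⟩, rfl⟩
    rintro rfl
    obtain ⟨hn, h, hhK, hs⟩ := hh'
    obtain ⟨hh, hp, t, ht, rfl⟩ := hc.isSource_iff.1 hs
    exact ((hc.mem_decisionNodes_self hh hp ht).1 hn).2 hhK

end Construction

end GradualMechanism

end Coalescence

/-! ### Choosing the next transformation, and termination -/

section Elicitation

universe u v w

variable {N : Type u} {Θ : N → Type v} {X : Type w} {f : (∀ i, Θ i) → X}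

namespace GradualMechanism

variable (G : GradualMechanism f) {i : N} {I : Set (Hist (Report Θ))} {x : Report Θ i}

/-- At every decision node of agent `i` after she has chosen `x` at `I`, only exact types can be
reported. -/
structure LastCoarse (i : N) (I : Set (Hist (Report Θ))) (x : Report Θ i) : Prop where
  mem : I ∈ G.infoSets i
  mem_available : x ∈ G.availableAt i I
  nontrivial : x.1.Nontrivial
  exact : ∀ l ∈ decisionNodes G.hist i, Passes i I x l → ∀ y ∈ available G.hist i l,
    ∃ t, y = exactReport t

theorem eq_exactReport_of_not_nontrivial {y : Report Θ i} (hy : ¬ y.1.Nontrivial) :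
    ∃ t, y = exactReport t := by
  obtain ⟨t, ht⟩ := Set.exists_eq_singleton_iff_nonempty_subsingleton.2
    ⟨y.2, Set.not_nontrivial_iff.1 hy⟩
  exact ⟨t, Subtype.ext ht⟩

theorem exists_lastCoarse [Finite N] [∀ i, Finite (Θ i)] {h : Hist (Report Θ)}
    (hx : x ∈ available G.hist i h) (hxn : x.1.Nontrivial) :
    ∃ (I : Set (Hist (Report Θ))) (x : Report Θ i), G.LastCoarse i I x := by
  -- The node with the most earlier decisions of `i` among those offering a non-singleton: after `x`
  -- her count is larger, so only singletons can be offered.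
  obtain ⟨h, ⟨x, hx, hxn⟩, hmax⟩ := Set.exists_max_image
    {h | ∃ x ∈ available G.hist i h, x.1.Nontrivial} (fun h => (decisions i h).length)
    (G.finite_hist.subset fun h ⟨x, hx, _⟩ =>
      G.mem_of_mem_decisionNodes (mem_decisionNodes_iff.2 ⟨x, hx⟩)) ⟨h, x, hx, hxn⟩
  obtain ⟨I, hI, hhI⟩ := G.exists_infoSet (mem_decisionNodes_iff.2 ⟨x, hx⟩)
  refine ⟨I, x, hI, ⟨h, hhI, hx⟩, hxn, ?_⟩
  rintro l hl ⟨k, hk, a, ha, hp⟩ y hy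
  refine eq_exactReport_of_not_nontrivial fun hyn => ?_
  have h1 := hmax l ⟨y, hy, hyn⟩
  have h2 := G.decisions_length_lt (G.mem_decisionNodes_of_mem hI hk)
    (G.mem_of_mem_decisionNodes hl) ((List.prefix_append _ _).trans hp)
    (by rintro rfl; exact not_snoc_prefix_self _ _ hp)
  rw [G.decisions_eq hI hk hhI] at h2
  omega

theorem exists_decisionNode_of_passes {k g : Hist (Report Θ)} {a : ActProfile (Report Θ)} (hk : k ∈ I)
    (ha : a i = some x) (hh : k ++ [a] ++ g ∈ G.hist) (hg : decisions i g ≠ []) :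
    ∃ l ∈ decisionNodes G.hist i, Passes i I x l ∧ l <+: k ++ [a] ++ g ∧
      l ≠ k ++ [a] ++ g := by
  obtain ⟨g₁, b, g₂, y, rfl, hy, -⟩ := exists_last_decision hg
  have hp : k ++ [a] ++ g₁ ++ [b] <+: k ++ [a] ++ (g₁ ++ [b] ++ g₂) := ⟨g₂, by simp⟩
  refine ⟨k ++ [a] ++ g₁, ⟨b, G.mem_of_prefix hh hp, by simp [hy]⟩,
    ⟨k, hk, a, ha, List.prefix_append _ _⟩, (List.prefix_append _ _).trans hp, ?_⟩
  intro heq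
  rw [← heq] at hp
  exact not_snoc_prefix_self _ _ hp

namespace LastCoarse

variable {G} (hc : G.LastCoarse i I x) (hG : G.StopsWhenRevealed)
include hc hG

/-- At her first node after `x` agent `i` reports an exact type; a second node would contradict
`StopsWhenRevealed`. -/
theorem eq_of_prefix {l m : Hist (Report Θ)} (hl : l ∈ decisionNodes G.hist i)
    (hlp : Passes i I x l) (hm : m ∈ decisionNodes G.hist i) (hp : l <+: m) : l = m := by
  by_contra hne
  obtain ⟨b, hb⟩ := exists_snoc_prefix hp hne
  have hmm := G.mem_of_mem_decisionNodes hm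
  have hbm := G.mem_of_prefix hmm hb
  obtain ⟨y, hy⟩ := Option.ne_none_iff_exists'.1 (G.ne_none_of_mem_decisionNodes hl hbm)
  obtain ⟨t, rfl⟩ := hc.exact l hl hlp y ⟨b, hbm, hy⟩
  have hsub := G.reported_anti (i := i) hmm hb
  rw [reported_append_some hy] at hsub
  refine Set.not_subsingleton_iff.2 (hG i m hm ?_) (Set.subsingleton_singleton.anti hsub)
  rintro rfl
  simp at hb

theorem decisions_eq {k l : Hist (Report Θ)} (hk : k ∈ I) (hl : l ∈ decisionNodes G.hist i)
    (hlp : Passes i I x l) : decisions i l = decisions i k ++ [x] := by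
  obtain ⟨k', hk', a, ha, g, rfl⟩ := hlp
  have hg : decisions i g = [] := by
    by_contra hg
    obtain ⟨m, hm, hmp, hp, hne⟩ :=
      G.exists_decisionNode_of_passes hk' ha (G.mem_of_mem_decisionNodes hl) hg
    exact hne (hc.eq_of_prefix hG hm hmp hl hp)
  rw [decisions_append, decisions_append, hg, decisions_singleton, ha,
    G.decisions_eq hc.mem hk' hk]
  simp

/-- The last action before `l` is `x`, so the actions at `l` partition `x`; as all of them are
singletons, they are all the singletons from `x`. -/
theorem available_iff {l : Hist (Report Θ)} (hl : l ∈ decisionNodes G.hist i)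
    (hlp : Passes i I x l) (y : Report Θ i) :
    y ∈ available G.hist i l ↔ ∃ t ∈ x.1, y = exactReport t := by
  have hrep : reported i l = x.1 := by
    obtain ⟨k, hk, -⟩ := id hlp
    simp [reported, hc.decisions_eq hG hk hl hlp]
  constructor
  · intro hy
    obtain ⟨t, rfl⟩ := hc.exact l hl hlp y hy
    exact ⟨t, hrep ▸ G.subset_reported hy (Set.mem_singleton t), rfl⟩
  · rintro ⟨t, ht, rfl⟩
    obtain ⟨y, hy, hty⟩ := G.exists_available_mem hl (hrep ▸ ht)
    obtain ⟨s, rfl⟩ := hc.exact l hl hlp y hy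
    obtain rfl : t = s := hty
    exact hy

/-- Perfect recall makes `m` pass through `I` with the same decisions as `l`, so the decision taken
at `I` was also `x`. -/
theorem passes_of_mem {J : Set (Hist (Report Θ))} (hJ : J ∈ G.infoSets i)
    {l m : Hist (Report Θ)} (hl : l ∈ J) (hm : m ∈ J) (hlp : Passes i I x l) :
    Passes i I x m := by
  obtain ⟨k, hk, a, ha, hp⟩ := id hlp
  have hln := G.mem_decisionNodes_of_mem hJ hl
  have hmm := G.mem_hist_of_mem hJ hm
  obtain ⟨q, hq, hqm⟩ := G.exists_prefix_mem hc.mem hJ hl hm hk ((List.prefix_append _ _).trans hp)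
  have hdec : decisions i m = decisions i q ++ [x] := by
    rw [G.decisions_eq hJ hm hl, hc.decisions_eq hG hq hln hlp]
  obtain ⟨b, hb⟩ := exists_snoc_prefix hqm (by rintro rfl; simp at hdec)
  obtain ⟨y, hy⟩ := Option.ne_none_iff_exists'.1
    (G.ne_none_of_mem_decisionNodes (G.mem_decisionNodes_of_mem hc.mem hq)
      (G.mem_of_prefix hmm hb))
  refine ⟨q, hq, b, ?_, hb⟩
  obtain ⟨g, rfl⟩ := hb
  rw [decisions_append, decisions_append, decisions_singleton, hy, List.append_assoc] at hdec
  have := List.append_cancel_left hdec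
  simp at this
  rw [hy, this.1]

omit hG in
-- If `i` did not move after `x`, her final report would be the non-singleton `x`.
theorem exists_prefix_of_terminal (hR : ∀ z ∈ terminals G.hist, (reported i z).Subsingleton)
    {z : Hist (Report Θ)} (hz : z ∈ terminals G.hist) (hzp : Passes i I x z) :
    ∃ l ∈ decisionNodes G.hist i, Passes i I x l ∧ l <+: z := by
  obtain ⟨k, hk, a, ha, g, rfl⟩ := hzp
  have hg : decisions i g ≠ [] := by
    intro hg
    have := hR _ hz
    rw [reported_append_of_decisions_eq_nil hg, reported_append_some ha] at this
    exact Set.not_subsingleton_iff.2 hc.nontrivial this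
  obtain ⟨l, hl, hlp, hp, -⟩ := G.exists_decisionNode_of_passes hk ha hz.1 hg
  exact ⟨l, hl, hlp, hp⟩

/-- At all nodes after `x` the agent has the same actions and the same decisions behind her, and
never moves again. Her earlier nodes lie at or before `I`, so perfect recall at `I` settles the
rest. -/
theorem mergeable {J₁ J₂ : Set (Hist (Report Θ))} (h₁ : J₁ ∈ G.infoSets i)
    (h₂ : J₂ ∈ G.infoSets i) (hne : J₁ ≠ J₂) (hp₁ : ∃ l ∈ J₁, Passes i I x l)
    (hp₂ : ∃ l ∈ J₂, Passes i I x l) : G.Mergeable i J₁ J₂ := by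
  have key : ∀ l ∈ J₁ ∪ J₂, l ∈ decisionNodes G.hist i ∧ Passes i I x l := by
    rintro l (hl | hl)
    · obtain ⟨m, hm, hmp⟩ := hp₁
      exact ⟨G.mem_decisionNodes_of_mem h₁ hl, hc.passes_of_mem hG h₁ hm hl hmp⟩
    · obtain ⟨m, hm, hmp⟩ := hp₂
      exact ⟨G.mem_decisionNodes_of_mem h₂ hl, hc.passes_of_mem hG h₂ hm hl hmp⟩
  obtain ⟨r, hr⟩ := G.infoSets_nonempty i I hc.mem
  refine ⟨h₁, h₂, hne, ?_, ?_, ?_, ?_⟩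
  · intro l hl m hm
    ext y
    rw [hc.available_iff hG (key l hl).1 (key l hl).2,
      hc.available_iff hG (key m hm).1 (key m hm).2]
  · intro l hl m hm
    rw [hc.decisions_eq hG hr (key l hl).1 (key l hl).2,
      hc.decisions_eq hG hr (key m hm).1 (key m hm).2]
  · intro l hl m hm h' hh' hp hne'
    obtain ⟨hln, hlp⟩ := key l hl
    obtain ⟨-, q, hq, b, -, hqm⟩ := key m hm
    obtain ⟨p, hpI, a, -, hpl⟩ := id hlp
    have hlm := G.mem_of_mem_decisionNodes hln
    have hlt := G.decisions_length_lt hh' hlm hp hne'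
    rw [hc.decisions_eq hG hpI hln hlp, List.length_append, List.length_singleton] at hlt
    have hp' := G.prefix_of_decisions_length_le (G.mem_decisionNodes_of_mem hc.mem hpI) hlm
      ((List.prefix_append _ _).trans hpl) hp (by omega)
    obtain ⟨k', hk', hL⟩ := (G.perfect_recall i I hc.mem p hpI q hq).2 h' hh' hp'
    exact ⟨k', hk'.trans ((List.prefix_append _ _).trans hqm), hL⟩
  · intro l hl m hm hp
    exact hc.eq_of_prefix hG (key l hl).1 (key l hl).2 hm hp

/-- If the nodes of `i` after `x` meet two information sets, these can be merged; otherwise they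
form a single one, which every play through `x` reaches. -/
theorem exists_coalescible_or_mergeable [∀ i, Nonempty (Θ i)] (hR : G.RevealsTypes) :
    (∃ J, G.Coalescible i I J x) ∨ ∃ J₁ J₂, G.Mergeable i J₁ J₂ := by
  by_cases hJ : ∃ J₁ ∈ G.infoSets i, ∃ J₂ ∈ G.infoSets i, J₁ ≠ J₂ ∧
      (∃ l ∈ J₁, Passes i I x l) ∧ ∃ l ∈ J₂, Passes i I x l
  · obtain ⟨J₁, h₁, J₂, h₂, hne, hp₁, hp₂⟩ := hJ
    exact Or.inr ⟨J₁, J₂, hc.mergeable hG h₁ h₂ hne hp₁ hp₂⟩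
  · left
    obtain ⟨h, hh, a, ha, hax⟩ := hc.mem_available
    obtain ⟨θ, hθ⟩ := reportedProfiles_nonempty (h ++ [a])
    obtain ⟨z, hz, hpz, -⟩ := G.exists_terminal ha hθ
    obtain ⟨l, hl, hlp, -⟩ := hc.exists_prefix_of_terminal (fun z hz => hR z hz i) hz
      ⟨h, hh, a, hax, hpz⟩
    obtain ⟨J, hJm, hlJ⟩ := G.exists_infoSet hl
    have hmem : ∀ m, m ∈ J ↔ m ∈ decisionNodes G.hist i ∧ Passes i I x m := by
      intro m
      constructor
      · exact fun hm => ⟨G.mem_decisionNodes_of_mem hJm hm, hc.passes_of_mem hG hJm hlJ hm hlp⟩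
      · rintro ⟨hm, hmp⟩
        obtain ⟨K, hK, hmK⟩ := G.exists_infoSet hm
        by_cases hKJ : K = J
        · exact hKJ ▸ hmK
        · exact absurd ⟨K, hK, J, hJm, hKJ, ⟨m, hmK, hmp⟩, l, hlJ, hlp⟩ hJ
    refine ⟨J, hc.mem, hJm, hc.mem_available, hmem, ?_, ?_⟩
    · intro m hm
      exact hc.available_iff hG ((hmem m).1 hm).1 ((hmem m).1 hm).2
    · intro z hz hzp
      obtain ⟨m, hm, hmp, hmz⟩ :=
        hc.exists_prefix_of_terminal (fun z hz => hR z hz i) hz hzp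
      exact ⟨m, (hmem m).2 ⟨hm, hmp⟩, hmz⟩

end LastCoarse

/-- If some action is not an exact type, then two information sets can be merged, or an
information set can be moved forward. -/
theorem exists_step [DecidableEq N] [Finite N] [∀ i, Finite (Θ i)] [∀ i, Nonempty (Θ i)]
    (hG : G.StopsWhenRevealed) (hR : G.RevealsTypes) {h : Hist (Report Θ)}
    (hx : x ∈ available G.hist i h) (hxn : x.1.Nontrivial) :
    ∃ G' : GradualMechanism f, G.Step G' ∧ G'.StopsWhenRevealed ∧ G'.RevealsTypes ∧
      G'.infoCount < G.infoCount := by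
  obtain ⟨I, x, hc⟩ := G.exists_lastCoarse hx hxn
  rcases hc.exists_coalescible_or_mergeable hG hR with ⟨J, hJ⟩ | ⟨J₁, J₂, hm⟩
  · exact ⟨coalesce hJ, Or.inr (Or.inl (coalesces_coalesce hJ)),
      stopsWhenRevealed_coalesce hJ hG, revealsTypes_coalesce hJ hR, infoCount_coalesce_lt hJ⟩
  · exact ⟨G.merge hm, Or.inr (Or.inr (illuminates_merge hm)), hG, hR, infoCount_merge_lt hm⟩

/-- A mechanism in which agents can only report their exact types, and do so once, is the direct
mechanism. -/
theorem eq_directMechanism [Nonempty N] [∀ i, Nonempty (Θ i)] (hG : G.StopsWhenRevealed)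
    (hex : ∀ i, ∀ h, ∀ x ∈ available G.hist i h, ¬ x.1.Nontrivial) :
    G = directMechanism f := by
  have hroot : ∀ a, [a] ∈ G.hist → ∃ θ, a = typeReport θ := by
    intro a ha
    have : ∀ i, ∃ t : Θ i, a i = some ⟨{t}, Set.singleton_nonempty t⟩ := by
      intro i
      have ha' : [] ++ [a] ∈ G.hist := ha
      obtain ⟨x, hx⟩ := Option.ne_none_iff_exists'.1
        (G.ne_none_of_mem_decisionNodes (G.root_active i) ha')
      obtain ⟨t, rfl⟩ := eq_exactReport_of_not_nontrivial (hex i [] x ⟨a, ha', hx⟩)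
      exact ⟨t, hx⟩
    choose θ hθ using this
    exact ⟨θ, funext hθ⟩
  -- All types are revealed in the first round, so an active agent in a second round would violate
  -- `StopsWhenRevealed`.
  have hterm : ∀ a b, [a, b] ∉ G.hist := by
    intro a b hab
    have hab' : [a] ++ [b] ∈ G.hist := hab
    obtain ⟨θ, rfl⟩ := hroot a (G.mem_of_append _ _ hab')
    obtain ⟨j, hj⟩ := G.exists_ne_none hab'
    have := hG j [typeReport θ] ⟨b, hab', hj⟩ (by simp)
    rw [reported_typeReport] at this
    exact Set.not_nontrivial_singleton this
  have hhist : G.hist = directHist Θ := by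
    ext h
    constructor
    · intro hh
      rcases h with - | ⟨a, - | ⟨b, r⟩⟩
      · exact Or.inl rfl
      · obtain ⟨θ, rfl⟩ := hroot a hh
        exact Or.inr ⟨θ, rfl⟩
      · exact absurd (G.mem_of_prefix hh ⟨r, rfl⟩) (hterm a b)
    · rintro (rfl | ⟨θ, rfl⟩)
      · exact G.nil_mem
      · have hθ : θ ∈ reportedProfiles ([] : Hist (Report Θ)) := by
          intro i
          rw [reported_nil]
          trivial
        -- Truthful play of `θ` at the root must be the profile of exact reports of `θ`, so each
        -- such profile occurs.
        obtain ⟨a, ha, hθa⟩ := G.exists_append_mem G.nil_mem G.nil_notMem_terminals hθ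
        obtain ⟨θ', rfl⟩ := hroot a ha
        have : θ = θ' := by
          funext i
          have := hθa i
          rw [List.nil_append, reported_typeReport] at this
          exact this
        exact this ▸ ha
  refine eq_of_hist_of_infoSets hhist ?_
  funext i
  have hnode : ∀ h ∈ decisionNodes G.hist i, h = [] := by
    intro h hh
    rw [hhist] at hh
    exact mem_directHist_nodes.1 hh
  have hsing : ∀ I ∈ G.infoSets i, I = {[]} := by
    intro I hI
    obtain ⟨h, hh⟩ := G.infoSets_nonempty i I hI
    have h0 : ∀ k ∈ I, k = [] := fun k hk => hnode k (G.mem_decisionNodes_of_mem hI hk)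
    exact Set.eq_singleton_iff_unique_mem.2 ⟨h0 h hh ▸ hh, h0⟩
  change G.infoSets i = {{[]}}
  obtain ⟨I, hI, -⟩ := G.exists_infoSet (G.root_active i)
  exact Set.eq_singleton_iff_unique_mem.2 ⟨hsing I hI ▸ hI, hsing⟩

theorem reflTransGen_directMechanism_of_revealsTypes [DecidableEq N] [Nonempty N] [Finite N]
    [∀ i, Finite (Θ i)] [∀ i, Nonempty (Θ i)] (hG : G.StopsWhenRevealed) (hR : G.RevealsTypes) :
    Relation.ReflTransGen Step G (directMechanism f) := by
  induction hn : G.infoCount using Nat.strong_induction_on generalizing G with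
  | _ n ih =>
    by_cases hex : ∃ (i : N) (h : Hist (Report Θ)), ∃ x ∈ available G.hist i h, x.1.Nontrivial
    · obtain ⟨i, h, x, hx, hxn⟩ := hex
      obtain ⟨G', hs, hG', hR', hlt⟩ := G.exists_step hG hR hx hxn
      exact .head hs (ih _ (hn ▸ hlt) G' hG' hR' rfl)
    · push Not at hex
      rw [G.eq_directMechanism hG fun i h x hx => Set.not_nontrivial_iff.2 (hex i h x hx)]

theorem reflTransGen_directMechanism [DecidableEq N] [Nonempty N] [Finite N]
    [∀ i, Finite (Θ i)] [∀ i, Nonempty (Θ i)] (hG : G.StopsWhenRevealed) :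
    Relation.ReflTransGen Step G (directMechanism f) := by
  induction hn : G.unseparated.ncard using Nat.strong_induction_on generalizing G with
  | _ n ih =>
    by_cases hR : G.RevealsTypes
    · exact G.reflTransGen_directMechanism_of_revealsTypes hG hR
    · simp only [RevealsTypes, not_forall, Set.not_subsingleton_iff] at hR
      obtain ⟨z, hz, i, hzi⟩ := hR
      obtain ⟨G', hs, hG', hlt⟩ := G.exists_splits hG hz hzi
      exact .head (Or.inl hs)
        (ih _ (hn ▸ Set.ncard_lt_ncard hlt (Set.toFinite _)) G' hG' rfl)

end GradualMechanism

end Elicitation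

theorem proposition8 {N : Type*} [Finite N] [Nonempty N] [DecidableEq N] {Θ : N → Type*}
    [∀ i, Finite (Θ i)] [∀ i, Nonempty (Θ i)] {X : Type*} (f : (∀ i, Θ i) → X)
    (G : GradualMechanism f)
    (hG : ∀ i, ∀ h ∈ decisionNodes G.hist i, h ≠ [] → (reported i h).Nontrivial) :
    Relation.ReflTransGen GradualMechanism.Step G (directMechanism f) :=
  G.reflTransGen_directMechanism hG
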